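/- Let $\nu\ge 0$ and $\beta\in\mathbb R$ be fixed. Let $J_\nu,Y_\nu$ be the Bessel functions of the first and second kind (principal branches) and put $$G^{m,k}_\nu(\kappa,z)=J_\nu^{(m)}(z)Y_\nu^{(k)}(\kappa z)-J_\nu^{(k)}(\kappa z)Y_\nu^{(m)}(z),$$ $$g_\nu(\beta,\kappa,z)=G^{1,1}_\nu(\kappa,z)-\frac{i\beta\nu}{z}G^{0,1}_\nu(\kappa,z)-\frac{i\beta\nu}{\kappa z}G^{1,0}_\nu(\kappa,z)-\frac{\beta^2\nu^2}{\kappa z^2}G^{0,0}_\nu(\kappa,z),\qquad \kappa>1.$$ Let $$a_k(\nu)=\frac{(4\nu^2-1^2)(4\nu^2-3^2)\cdots(4\nu^2-(2k-1)^2)}{k!\,8^k}\ (k\ge0),\qquad b_k(\nu)=\frac{(4\nu^2-1^2)\cdots(4\nu^2-(2k-3)^2)\,(4\nu^2+4k^2-1)}{k!\,8^k}\ (k\ge1),$$ where empty products are $1$ (so $a_0=1$, $b_1=(4\nu^2+3)/8$), let $c_k=b_k(\nu)+i\beta\nu\,a_{k-1}(\nu)$ for $k\ge1$, and $$p=\frac{c_1}{\kappa},\qquad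 q=-\frac{\kappa^3-1}{\kappa^3(\kappa-1)}\Big(\frac{c_1^3}{3}+c_3-c_2c_1\Big).$$ Then there are $\kappa_0>1$ and $R>0$ (depending on $\nu,\beta$) such that for every $\kappa\in(1,\kappa_0)$ the zeros $z$ of $g_\nu(\beta,\kappa,\cdot)$ with $\operatorname{Re}z>0$ and $|z|>R$ are exactly the members of a sequence of distinct numbers $z_s(\kappa)$, $s=1,2,3,\dots$. For each $s\ge1$, $|z_s(\kappa)|\to\infty$ as $\kappa\to1^+$, and $$z_s(\kappa)=\alpha+p\,\alpha^{-1}+(q-p^2)\,\alpha^{-3}+\dots,\qquad \alpha=\frac{s\pi}{\kappa-1},$$ in the following sense: there are coefficients $d_j(\kappa)$, $j\ge0$, depending only on $\nu,\beta,\kappa$ (not on $s$), with $d_0=p$ and $d_1=q-p^2$, such that for every $N\ge0$ there is a constant $C$ (depending on $\nu,\beta,N$ only) with $$\Big|z_s(\kappa)-\alpha-\sum_{j=0}^{N-1}d_j(\kappa)\,\alpha^{-(2j+1)}\Big|\le C\,\alpha^{-(2N+1)}\qquad\text{for all }\kappa\in(1,\kappa_0),\ s\ge1.$$ For $\beta=0$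 one has $g_\nu(0,\kappa,z)=G^{1,1}_\nu(\kappa,z)$ (the Neumann cross-product) and $$p=\frac{4\nu^2+3}{8\kappa},\qquad q=\frac{(\kappa^3-1)(16\nu^4+184\nu^2-63)}{384\,\kappa^3(\kappa-1)},$$ the coefficients of the known Neumann McMahon expansion. -/

import Mathlib

open Filter Topology

noncomputable section

/-- Bessel function of the first kind of real order `μ` (principal branch),
`J_μ(z) = (z/2)^μ ∑ₖ (-1)^k / (k! Γ(μ+k+1)) (z/2)^{2k}`.  The reciprocal Gamma function vanishes at
the poles of `Γ`, in agreement with `Complex.Gamma = 0` there. -/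
def besselJ (μ : ℝ) (z : ℂ) : ℂ :=
  (z / 2) ^ (μ : ℂ) *
    ∑' k : ℕ, (-1 : ℂ) ^ k * ((k.factorial : ℂ) * Complex.Gamma ((μ : ℂ) + k + 1))⁻¹ *
      (z / 2) ^ (2 * k)

/-- The quotient `(J_μ(z) cos(μπ) - J_{-μ}(z)) / sin(μπ)`, meaningful for non-integer `μ`. -/
def besselYQuot (μ : ℝ) (z : ℂ) : ℂ :=
  (besselJ μ z * (Real.cos (μ * Real.pi) : ℂ) - besselJ (-μ) z) / (Real.sin (μ * Real.pi) : ℂ)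

open Classical in
/-- Bessel function of the second kind of real order `ν`: the quotient above, replaced by its
limiting value in the order when `ν` is an integer. -/
def besselY (ν : ℝ) (z : ℂ) : ℂ :=
  if ∃ n : ℤ, ν = n then limUnder (𝓝[≠] ν) (fun μ : ℝ => besselYQuot μ z)
  else besselYQuot ν z

/-- `G^{m,k}_ν(κ, z) = J_ν^{(m)}(z) Y_ν^{(k)}(κz) - J_ν^{(k)}(κz) Y_ν^{(m)}(z)`. -/
def besselG (ν : ℝ) (m k : ℕ) (κ : ℝ) (z : ℂ) : ℂ :=
  iteratedDeriv m (besselJ ν) z * iteratedDeriv k (besselY ν) (κ * z) -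
    iteratedDeriv k (besselJ ν) (κ * z) * iteratedDeriv m (besselY ν) z

/-- The oblique-derivative cross-product `g_ν(β, κ, z)`. -/
def obliqueG (ν β κ : ℝ) (z : ℂ) : ℂ :=
  besselG ν 1 1 κ z - Complex.I * (β * ν / z) * besselG ν 0 1 κ z
    - Complex.I * (β * ν / (κ * z)) * besselG ν 1 0 κ z
    - β ^ 2 * ν ^ 2 / (κ * z ^ 2) * besselG ν 0 0 κ z

/-- `a_k(ν) = (4ν² - 1²)(4ν² - 3²)⋯(4ν² - (2k-1)²) / (k! 8^k)`. -/
def hankelA (ν : ℝ) (k : ℕ) : ℝ :=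
  (∏ i ∈ Finset.range k, (4 * ν ^ 2 - (2 * (i : ℝ) + 1) ^ 2)) / ((k.factorial : ℝ) * 8 ^ k)

/-- `b_0(ν) = 1` and, for `k ≥ 1`,
`b_k(ν) = (4ν² - 1²)(4ν² - 3²)⋯(4ν² - (2k-3)²) (4ν² + 4k² - 1) / (k! 8^k)`;
the product of squares is empty for `k = 1`. -/
def hankelB (ν : ℝ) : ℕ → ℝ
  | 0 => 1
  | k + 1 =>
    (∏ i ∈ Finset.range k, (4 * ν ^ 2 - (2 * (i : ℝ) + 1) ^ 2)) *
      (4 * ν ^ 2 + 4 * ((k : ℝ) + 1) ^ 2 - 1) / (((k + 1).factorial : ℝ) * 8 ^ (k + 1))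

/-- `c_k(β, ν) = b_k(ν) + iβν a_{k-1}(ν)`, used for `k ≥ 1` only. -/
def hankelC (ν β : ℝ) (k : ℕ) : ℂ :=
  hankelB ν k + Complex.I * β * ν * hankelA ν (k - 1)

/-- `p = c_1 / κ`. -/
def mcMahonP (ν β κ : ℝ) : ℂ := hankelC ν β 1 / κ

/-- `q = -(κ³ - 1) / (κ³ (κ - 1)) (c_1³ / 3 + c_3 - c_2 c_1)`. -/
def mcMahonQ (ν β κ : ℝ) : ℂ :=
  -(((κ : ℂ) ^ 3 - 1) / ((κ : ℂ) ^ 3 * ((κ : ℂ) - 1))) *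
    (hankelC ν β 1 ^ 3 / 3 + hankelC ν β 3 - hankelC ν β 2 * hankelC ν β 1)

/-- The leading term `α = sπ / (κ - 1)`. -/
def mcMahonAlpha (s : ℕ) (κ : ℝ) : ℝ := s * Real.pi / (κ - 1)

end

/-!
The cross-product `g_ν(β, κ, z)` is a two-point Wronskian-like expression in `J_ν` and `Y_ν`: with
the boundary operator `L f = f' - iβν f / z` it equals `LJ(z) LY(κz) - LJ(κz) LY(z)`.  Up to a
nonzero factor such an expression depends only on the two-dimensional space of solutions of the
differential equation, so `J_ν, Y_ν` may be replaced by any other basis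
(`crossProduct_change_basis`, `obliqueG_eq_zero_iff`).  This needs no asymptotics of the Bessel
functions themselves, only that `J_ν` and `Y_ν` solve Bessel's equation with Wronskian `2/(πz)`
(`besselJ_besselY_system`); for integer order `Y_ν` is a limit in the order, and the statement
passes to the limit by local uniformity.

The convenient basis is a pair of travelling waves.  In the normal form `f'' + (1 - m/z²) f = 0`,
`m = ν² - 1/4`, put `f = e^{ωz} A` with `ω = ±i`; then `A'' + 2ωA' = mA/z²`, that is
`A = 1 + m ∫₀^∞ K(t) A(z+t) / (z+t)² dt` along the horizontal ray from `z`, with a kernel bounded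
for both signs of `ω`.  In `Re z > 0` the integral of `|z+t|⁻²` is at most `π/(2|z|)`, so for large
`|z|` the equation is solved by iteration and the expansion of `A` in powers of `1/z` holds
uniformly up to the imaginary axis (`exists_volterra`, `exists_wave_solution`).  The boundary
operator gives `ω e^{ωz}` times an amplitude with expansion `∑ ω^k c_k z^{-k}`
(`exists_amplitude`, `coeff_amplitudeSeries_eq_hankelC`).

With `θ = (log P₊ - log P₋) / (2i)` for the two amplitudes, `g_ν(β, κ, z) = 0` becomes
`(κ - 1) z + θ(κz) - θ(z) ∈ πℤ` (`exists_phase`).  The phase has an expansion in odd powers of `1/z`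
since the two amplitude series are exchanged by `z ↦ -z`.  After division by `κ - 1` the equation
reads `z + ψ_κ(z) = α`, where the difference quotient `ψ_κ` of `θ` is `O(1/z)` and is expanded with
constants independent of `κ` (`exists_phaseQuot_expansion`): this is what makes the result uniform
as `κ → 1`.  For `α` large it has exactly one solution near `α`, by Banach's fixed point theorem
(`exists_phase_solution`, `phase_solution_unique`), and formal inversion gives the expansion of that
solution (`exists_inversion_expansion`).  Every `α = nπ/(κ-1)` with `n ≥ 1` is large if `κ` is close
to `1`, and `n ≤ 0` cannot occur far out in the right half-plane.

Uniform asymptotic expansions are handled by the predicate `HasExpansion`, which attaches formal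
power series to functions and is compatible with the ring operations and inverses.
-/

/-! ### Uniform asymptotic expansions with formal power series as coefficients -/

namespace PowerSeries

/-- The power series `(F - F(0)) / X`. -/
noncomputable def shift (F : PowerSeries ℂ) : PowerSeries ℂ := mk fun p => coeff (p + 1) F

@[simp] lemma coeff_shift (F : PowerSeries ℂ) (n : ℕ) : coeff n (shift F) = coeff (n + 1) F := by
  simp [shift]

lemma shift_add (F G : PowerSeries ℂ) : shift (F + G) = shift F + shift G := by
  ext n; simp

lemma shift_mul (F G : PowerSeries ℂ) :
    shift (F * G) = C (coeff 0 F) * shift G + shift F * G := by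
  have hF : F = X * shift F + C (coeff 0 F) := by
    simpa [shift] using eq_X_mul_shift_add_const F
  have hF' : F * G = X * (shift F * G) + C (coeff 0 F) * G := by
    conv_lhs => rw [hF]
    ring
  ext n
  rw [coeff_shift, hF']
  simp [coeff_succ_X_mul]
  ring

lemma shift_C (c : ℂ) : shift (C c) = 0 := by
  ext n; simp

lemma shift_X_mul (F : PowerSeries ℂ) : shift (X * F) = F := by
  ext n; simp [coeff_succ_X_mul]

lemma shift_inv {F : PowerSeries ℂ} (hF : coeff 0 F = 1) :
    shift F⁻¹ = C (-1) * (shift F * F⁻¹) := by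
  have h1 : F * F⁻¹ = 1 := PowerSeries.mul_inv_cancel F (by
    rw [← coeff_zero_eq_constantCoeff_apply, hF]; exact one_ne_zero)
  have h2 := shift_mul F F⁻¹
  rw [h1, hF] at h2
  have h3 : shift (1 : PowerSeries ℂ) = 0 := shift_C 1
  rw [h3] at h2
  simp only [map_one, one_mul, map_neg] at h2 ⊢
  linear_combination -h2

end PowerSeries

open PowerSeries in
/-- `HasExpansion x N F f`: the functions `f` on the index type `ι` satisfy
`f i = ∑ k < N, (coeff k (F i)) * (x i) ^ k + O((x i) ^ N)`, uniformly in `i`, and the coefficients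
used are uniformly bounded.  Encoded by recursion on the order: `f = F(0) + x * f₁`, where
`f₁` is expanded to one order less along `(F - F(0)) / X`. -/
def HasExpansion {ι : Type*} (x : ι → ℂ) : ℕ → (ι → PowerSeries ℂ) → (ι → ℂ) → Prop
  | 0, _, f => ∃ B : ℝ, ∀ i, ‖f i‖ ≤ B
  | N + 1, F, f => (∃ B : ℝ, ∀ i, ‖coeff 0 (F i)‖ ≤ B) ∧
      HasExpansion x N (fun i => shift (F i)) (fun i => (f i - coeff 0 (F i)) / x i)

namespace HasExpansion

open PowerSeries

variable {ι : Type*} {x : ι → ℂ} {N : ℕ} {F G : ι → PowerSeries ℂ} {f g : ι → ℂ}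

lemma congr (h : HasExpansion x N F f) (hF : ∀ i, F i = G i) (hf : ∀ i, f i = g i) :
    HasExpansion x N G g := by
  rwa [← funext hF, ← funext hf]

lemma bounded (hx : ∀ i, x i ≠ 0) (hb : ∀ i, ‖x i‖ ≤ 1) (h : HasExpansion x N F f) :
    ∃ B : ℝ, ∀ i, ‖f i‖ ≤ B := by
  induction N generalizing F f with
  | zero => exact h
  | succ N ih =>
    obtain ⟨⟨B, hB⟩, h2⟩ := h
    obtain ⟨B', hB'⟩ := ih h2
    refine ⟨B + B', fun i => ?_⟩
    have e : f i = coeff 0 (F i) + x i * ((f i - coeff 0 (F i)) / x i) := by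
      field_simp [hx i]; ring
    rw [e]
    refine (norm_add_le _ _).trans (add_le_add (hB i) ?_)
    rw [norm_mul]
    exact (mul_le_of_le_one_left (norm_nonneg _) (hb i)).trans (hB' i)

lemma of_succ (hx : ∀ i, x i ≠ 0) (hb : ∀ i, ‖x i‖ ≤ 1) (h : HasExpansion x (N + 1) F f) :
    HasExpansion x N F f := by
  induction N generalizing F f with
  | zero => exact h.bounded hx hb
  | succ N ih => exact ⟨h.1, ih h.2⟩

lemma add (h : HasExpansion x N F f) (h' : HasExpansion x N G g) :
    HasExpansion x N (fun i => F i + G i) (fun i => f i + g i) := by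
  induction N generalizing F G f g with
  | zero =>
    obtain ⟨B, hB⟩ := h
    obtain ⟨B', hB'⟩ := h'
    exact ⟨B + B', fun i => (norm_add_le _ _).trans (add_le_add (hB i) (hB' i))⟩
  | succ N ih =>
    obtain ⟨⟨B, hB⟩, h2⟩ := h
    obtain ⟨⟨B', hB'⟩, h2'⟩ := h'
    refine ⟨⟨B + B', fun i => ?_⟩, ?_⟩
    · rw [map_add]; exact (norm_add_le _ _).trans (add_le_add (hB i) (hB' i))
    · refine (ih h2 h2').congr (fun i => (shift_add _ _).symm) fun i => ?_
      rw [map_add]; ring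

lemma const (N : ℕ) {c : ι → ℂ} (hc : ∃ B : ℝ, ∀ i, ‖c i‖ ≤ B) :
    HasExpansion x N (fun i => C (c i)) c := by
  have hz : ∀ N, HasExpansion x N (fun _ => 0) (fun _ => 0) := by
    intro N
    induction N with
    | zero => exact ⟨0, fun i => by simp⟩
    | succ N ih =>
      refine ⟨⟨0, fun i => by simp⟩, ?_⟩
      exact ih.congr (fun i => by ext n; simp) fun i => by simp
  cases N with
  | zero => exact hc
  | succ N =>
    refine ⟨by simpa using hc, ?_⟩
    exact (hz N).congr (fun i => (shift_C _).symm) fun i => by simp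

lemma mul (hx : ∀ i, x i ≠ 0) (hb : ∀ i, ‖x i‖ ≤ 1)
    (h : HasExpansion x N F f) (h' : HasExpansion x N G g) :
    HasExpansion x N (fun i => F i * G i) (fun i => f i * g i) := by
  induction N generalizing F G f g with
  | zero =>
    obtain ⟨B, hB⟩ := h
    obtain ⟨B', hB'⟩ := h'
    refine ⟨B * B', fun i => ?_⟩
    rw [norm_mul]
    exact mul_le_mul (hB i) (hB' i) (norm_nonneg _) ((norm_nonneg _).trans (hB i))
  | succ N ih =>
    refine ⟨?_, ?_⟩
    · obtain ⟨⟨B, hB⟩, -⟩ := h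
      obtain ⟨⟨B', hB'⟩, -⟩ := h'
      refine ⟨B * B', fun i => ?_⟩
      rw [coeff_zero_mul', norm_mul]
      exact mul_le_mul (hB i) (hB' i) (norm_nonneg _) ((norm_nonneg _).trans (hB i))
    · have h3 := (ih (const N h.1) h'.2).add (ih h.2 (h'.of_succ hx hb))
      refine h3.congr (fun i => (shift_mul _ _).symm) fun i => ?_
      rw [coeff_zero_mul']
      field_simp [hx i]
      ring
where
  coeff_zero_mul' {F G : PowerSeries ℂ} : coeff 0 (F * G) = coeff 0 F * coeff 0 G := by
    simp

lemma const_mul (hx : ∀ i, x i ≠ 0) (hb : ∀ i, ‖x i‖ ≤ 1) (c : ℂ) (h : HasExpansion x N F f) :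
    HasExpansion x N (fun i => C c * F i) (fun i => c * f i) :=
  (const N ⟨‖c‖, fun _ => le_rfl⟩).mul hx hb h

lemma neg (hx : ∀ i, x i ≠ 0) (hb : ∀ i, ‖x i‖ ≤ 1) (h : HasExpansion x N F f) :
    HasExpansion x N (fun i => - F i) (fun i => - f i) := by
  simpa using h.const_mul hx hb (-1)

lemma sub (hx : ∀ i, x i ≠ 0) (hb : ∀ i, ‖x i‖ ≤ 1)
    (h : HasExpansion x N F f) (h' : HasExpansion x N G g) :
    HasExpansion x N (fun i => F i - G i) (fun i => f i - g i) := by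
  simpa [sub_eq_add_neg] using h.add (h'.neg hx hb)

lemma pow (hx : ∀ i, x i ≠ 0) (hb : ∀ i, ‖x i‖ ≤ 1) (h : HasExpansion x N F f) (n : ℕ) :
    HasExpansion x N (fun i => F i ^ n) (fun i => f i ^ n) := by
  induction n with
  | zero => simpa using const (x := x) (c := fun _ : ι => (1 : ℂ)) N ⟨1, fun _ => by simp⟩
  | succ n ih => simpa [pow_succ] using ih.mul hx hb h

lemma sum {κ : Type*} (s : Finset κ) {F : κ → ι → PowerSeries ℂ} {f : κ → ι → ℂ}
    (h : ∀ k ∈ s, HasExpansion x N (F k) (f k)) :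
    HasExpansion x N (fun i => ∑ k ∈ s, F k i) (fun i => ∑ k ∈ s, f k i) := by
  classical
  induction s using Finset.induction_on with
  | empty => simpa using const (x := x) (c := fun _ : ι => (0 : ℂ)) N ⟨0, fun _ => by simp⟩
  | insert a s ha ih =>
    simp only [Finset.sum_insert ha]
    exact (h a (by simp)).add (ih fun k hk => h k (by simp [hk]))

/-- Multiplication by the expansion variable gains one order. -/
lemma X_mul (hx : ∀ i, x i ≠ 0) (h : HasExpansion x N F f) :
    HasExpansion x (N + 1) (fun i => X * F i) (fun i => x i * f i) := by
  refine ⟨⟨0, fun i => by simp⟩, ?_⟩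
  exact h.congr (fun i => (shift_X_mul _).symm) fun i => by simp [hx i]

lemma X_pow_mul (hx : ∀ i, x i ≠ 0) (h : HasExpansion x N F f) (n : ℕ) :
    HasExpansion x (N + n) (fun i => X ^ n * F i) (fun i => x i ^ n * f i) := by
  induction n with
  | zero => simpa using h
  | succ n ih => simpa [pow_succ', mul_assoc, add_assoc] using ih.X_mul hx

/-- Inversion; by induction, using `shift F⁻¹ = -(shift F) F⁻¹`. -/
lemma inv (hx : ∀ i, x i ≠ 0) (hb : ∀ i, ‖x i‖ ≤ 1) (h : HasExpansion x N F f)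
    (hF : ∀ i, coeff 0 (F i) = 1) (hf : ∀ i, 1 / 2 ≤ ‖f i‖) :
    HasExpansion x N (fun i => (F i)⁻¹) (fun i => (f i)⁻¹) := by
  have h0 : ∃ B : ℝ, ∀ i, ‖(f i)⁻¹‖ ≤ B := ⟨2, fun i => by
    rw [norm_inv]
    exact (inv_anti₀ (by norm_num) (hf i)).trans (by norm_num)⟩
  induction N with
  | zero => exact h0
  | succ N ih =>
    refine ⟨⟨1, fun i => by simp [show constantCoeff (F i) = 1 by simpa using hF i]⟩, ?_⟩
    have h3 := (h.2.mul hx hb (ih (h.of_succ hx hb))).const_mul hx hb (-1)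
    refine h3.congr (fun i => (shift_inv (hF i)).symm) fun i => ?_
    have hfi : f i ≠ 0 := fun h0 => by have := hf i; rw [h0] at this; norm_num at this
    rw [hF i, coeff_zero_eq_constantCoeff_apply, constantCoeff_inv,
      ← coeff_zero_eq_constantCoeff_apply, hF i]
    field_simp [hx i, hfi]
    ring

lemma reindex {ι' : Type*} (φ : ι' → ι) (h : HasExpansion x N F f) :
    HasExpansion (fun i => x (φ i)) N (fun i => F (φ i)) (fun i => f (φ i)) := by
  induction N generalizing F f with
  | zero => exact ⟨h.choose, fun i => h.choose_spec _⟩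
  | succ N ih => exact ⟨⟨h.1.choose, fun i => h.1.choose_spec _⟩, ih h.2⟩

/-- The recursive definition, unfolded to the usual form of an asymptotic expansion. -/
lemma norm_sub_le (hx : ∀ i, x i ≠ 0) (h : HasExpansion x N F f) :
    ∃ B : ℝ, ∀ i, ‖f i - ∑ k ∈ Finset.range N, coeff k (F i) * x i ^ k‖ ≤ B * ‖x i‖ ^ N := by
  induction N generalizing F f with
  | zero => obtain ⟨B, hB⟩ := h; exact ⟨B, fun i => by simpa using hB i⟩
  | succ N ih =>
    obtain ⟨B, hB⟩ := ih h.2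
    refine ⟨B, fun i => ?_⟩
    have e : f i - ∑ k ∈ Finset.range (N + 1), coeff k (F i) * x i ^ k = x i *
        ((f i - coeff 0 (F i)) / x i -
          ∑ k ∈ Finset.range N, coeff k (shift (F i)) * x i ^ k) := by
      rw [Finset.sum_range_succ', mul_sub, Finset.mul_sum, mul_div_cancel₀ _ (hx i)]
      simp only [coeff_shift, pow_succ, pow_zero, mul_one]
      rw [sub_add_eq_sub_sub_swap]
      congr 1
      exact Finset.sum_congr rfl fun k _ => by ring
    rw [e, norm_mul, pow_succ]
    calc _ ≤ ‖x i‖ * (B * ‖x i‖ ^ N) := by gcongr; exact hB i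
      _ = _ := by ring

lemma of_norm_sub_le (hx : ∀ i, x i ≠ 0)
    (hF : ∀ k < N, ∃ B : ℝ, ∀ i, ‖coeff k (F i)‖ ≤ B)
    (h : ∃ B : ℝ, ∀ i, ‖f i - ∑ k ∈ Finset.range N, coeff k (F i) * x i ^ k‖ ≤ B * ‖x i‖ ^ N) :
    HasExpansion x N F f := by
  induction N generalizing F f with
  | zero => obtain ⟨B, hB⟩ := h; exact ⟨B, fun i => by simpa using hB i⟩
  | succ N ih =>
    obtain ⟨B, hB⟩ := h
    refine ⟨hF 0 (by omega), ih (fun k hk => by simpa using hF (k + 1) (by omega)) ⟨B, fun i => ?_⟩⟩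
    have e : (f i - coeff 0 (F i)) / x i -
          ∑ k ∈ Finset.range N, coeff k (shift (F i)) * x i ^ k =
        (f i - ∑ k ∈ Finset.range (N + 1), coeff k (F i) * x i ^ k) / x i := by
      rw [eq_div_iff (hx i), sub_mul, div_mul_cancel₀ _ (hx i), Finset.sum_range_succ',
        Finset.sum_mul]
      simp only [coeff_shift, pow_succ, pow_zero, mul_one]
      rw [sub_add_eq_sub_sub_swap]
      congr 1
      exact Finset.sum_congr rfl fun k _ => by ring
    have hxi : 0 < ‖x i‖ := norm_pos_iff.2 (hx i)
    rw [e, norm_div, div_le_iff₀ hxi]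
    simpa [pow_succ, mul_assoc] using hB i

lemma of_norm_le (hx : ∀ i, x i ≠ 0) (h : ∃ B : ℝ, ∀ i, ‖f i‖ ≤ B * ‖x i‖ ^ N) :
    HasExpansion x N (fun _ => 0) f :=
  of_norm_sub_le hx (fun k _ => ⟨0, fun i => by simp⟩) (by simpa using h)

end HasExpansion

/-! ### The entire function behind the Bessel functions of the first kind -/

/-- The `k`-th coefficient `(-1)^k / (k! Γ(μ + k + 1))` of `besselF μ`. -/
noncomputable def besselCoeff (μ : ℂ) (k : ℕ) : ℂ :=
  (-1 : ℂ) ^ k * ((k.factorial : ℂ) * Complex.Gamma (μ + k + 1))⁻¹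

/-- The function `F_μ(w) = ∑ₖ (-1)^k w^k / (k! Γ(μ + k + 1))` of complex order `μ`, entire in both
variables, for which `J_μ(z) = (z/2)^μ F_μ((z/2)²)`. -/
noncomputable def besselF (μ w : ℂ) : ℂ := ∑' k : ℕ, besselCoeff μ k * w ^ k

/-- Uniform bound for `1/Γ(μ + k + 1)`: the norm decreases in `k` once `k ≥ ‖μ‖`, by the functional
equation. -/
lemma exists_norm_inv_Gamma_le (M : ℝ) :
    ∃ B : ℝ, 0 ≤ B ∧ ∀ k : ℕ, ∀ μ : ℂ, ‖μ‖ ≤ M → ‖(Complex.Gamma (μ + k + 1))⁻¹‖ ≤ B := by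
  have hc : ∀ k : ℕ, ∃ B : ℝ, ∀ μ : ℂ, ‖μ‖ ≤ M → ‖(Complex.Gamma (μ + k + 1))⁻¹‖ ≤ B := by
    intro k
    have hcont : Continuous fun μ : ℂ => (Complex.Gamma (μ + k + 1))⁻¹ :=
      Complex.differentiable_one_div_Gamma.continuous.comp (by fun_prop)
    obtain ⟨B, hB⟩ := (isCompact_closedBall (0 : ℂ) M).exists_bound_of_continuousOn
      hcont.continuousOn
    exact ⟨B, fun μ hμ => hB μ (by simpa using hμ)⟩
  choose B hB using hc
  obtain ⟨K, hK⟩ := exists_nat_ge M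
  refine ⟨∑ k ∈ Finset.range (K + 1), |B k|, by positivity, fun k μ hμ => ?_⟩
  have hlt : ∀ k < K + 1, ‖(Complex.Gamma (μ + k + 1))⁻¹‖ ≤ ∑ k ∈ Finset.range (K + 1), |B k| :=
    fun k hk => (hB k μ hμ).trans ((le_abs_self _).trans
      (Finset.single_le_sum (f := fun k => |B k|) (fun _ _ => abs_nonneg _)
        (Finset.mem_range.2 hk)))
  rcases lt_or_ge k (K + 1) with hk | hk
  · exact hlt k hk
  · induction k, hk using Nat.le_induction with
    | base =>
      have h1 := hlt K (by omega)
      refine le_trans ?_ h1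
      exact step hμ hK le_rfl
    | succ k hk ih => exact (step hμ hK (by omega)).trans ih
where
  step {M : ℝ} {μ : ℂ} {K k : ℕ} (hμ : ‖μ‖ ≤ M) (hK : M ≤ K) (hk : K ≤ k) :
      ‖(Complex.Gamma (μ + (k + 1 : ℕ) + 1))⁻¹‖ ≤ ‖(Complex.Gamma (μ + k + 1))⁻¹‖ := by
    have h1 := Complex.one_div_Gamma_eq_self_mul_one_div_Gamma_add_one (μ + k + 1)
    have h2 : 1 ≤ ‖μ + k + 1‖ := by
      have : ((k + 1 : ℕ) : ℝ) ≤ ‖μ + k + 1‖ + ‖μ‖ := by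
        have := norm_sub_le (μ + k + 1) μ
        rwa [show μ + k + 1 - μ = ((k + 1 : ℕ) : ℂ) by push_cast; ring, Complex.norm_natCast] at this
      have hk' : (K : ℝ) ≤ k := by exact_mod_cast hk
      push_cast at this
      linarith
    rw [h1, norm_mul]
    push_cast
    rw [← add_assoc]
    exact le_mul_of_one_le_left (norm_nonneg _) h2

lemma exists_norm_besselCoeff_le (M : ℝ) :
    ∃ B : ℝ, 0 ≤ B ∧ ∀ k : ℕ, ∀ μ w : ℂ, ‖μ‖ ≤ M →
      ‖besselCoeff μ k * w ^ k‖ ≤ B * (‖w‖ ^ k / k.factorial) := by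
  obtain ⟨B, hB0, hB⟩ := exists_norm_inv_Gamma_le M
  refine ⟨B, hB0, fun k μ w hμ => ?_⟩
  have := hB k μ hμ
  rw [besselCoeff, mul_inv, norm_mul, norm_mul, norm_mul, norm_pow, norm_pow, norm_neg, norm_one,
    one_pow, one_mul, norm_inv, Complex.norm_natCast]
  calc _ ≤ (k.factorial : ℝ)⁻¹ * B * ‖w‖ ^ k := by gcongr
    _ = _ := by ring

lemma summable_besselCoeff (μ w : ℂ) : Summable fun k => besselCoeff μ k * w ^ k := by
  obtain ⟨B, -, hB⟩ := exists_norm_besselCoeff_le ‖μ‖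
  exact Summable.of_norm_bounded ((Real.summable_pow_div_factorial ‖w‖).mul_left B)
    fun k => hB k μ w le_rfl

lemma differentiable_besselF_order (w : ℂ) : Differentiable ℂ fun μ => besselF μ w := by
  intro μ
  obtain ⟨B, -, hB⟩ := exists_norm_besselCoeff_le (‖μ‖ + 1)
  have := Complex.differentiableOn_tsum_of_summable_norm
    (F := fun k μ => besselCoeff μ k * w ^ k)
    ((Real.summable_pow_div_factorial ‖w‖).mul_left B) (U := Metric.ball 0 (‖μ‖ + 1))
    (fun k => by
      have h1 : Differentiable ℂ fun μ : ℂ => (Complex.Gamma (μ + k + 1))⁻¹ :=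
        Complex.differentiable_one_div_Gamma.comp (by fun_prop)
      simp only [besselCoeff, mul_inv]
      exact ((((h1.const_mul _).const_mul _).mul_const _)).differentiableOn)
    Metric.isOpen_ball
    (fun k μ' hμ' => hB k μ' w (by simpa using (Metric.mem_ball.1 hμ').le))
  exact this.differentiableAt (Metric.isOpen_ball.mem_nhds (by simp))

lemma besselCoeff_succ (μ : ℂ) (k : ℕ) :
    besselCoeff μ (k + 1) * (k + 1) = - besselCoeff (μ + 1) k := by
  have : ((k : ℂ) + 1) ≠ 0 := by exact_mod_cast k.succ_ne_zero
  simp only [besselCoeff, Nat.factorial_succ, pow_succ]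
  rw [show μ + ((k + 1 : ℕ) : ℂ) + 1 = μ + 1 + k + 1 by push_cast; ring]
  simp only [mul_inv]
  push_cast
  field_simp

lemma besselCoeff_eq_mul (μ : ℂ) (k : ℕ) :
    besselCoeff μ k = (μ + 1 + k) * besselCoeff (μ + 1) k := by
  simp only [besselCoeff, mul_inv]
  rw [Complex.one_div_Gamma_eq_self_mul_one_div_Gamma_add_one (μ + k + 1),
    show μ + (k : ℂ) + 1 + 1 = μ + 1 + k + 1 by ring]
  ring

lemma hasDerivAt_besselF (μ w : ℂ) : HasDerivAt (besselF μ) (- besselF (μ + 1) w) w := by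
  obtain ⟨B, hB0, hB⟩ := exists_norm_besselCoeff_le ‖μ‖
  have hsum := (Real.summable_pow_div_factorial (‖w‖ + 1)).mul_left B
  have hd : ∀ k : ℕ, DifferentiableOn ℂ (fun w => besselCoeff μ k * w ^ k)
    (Metric.ball 0 (‖w‖ + 1)) := fun k => by fun_prop
  have hle : ∀ (k : ℕ) (w' : ℂ), w' ∈ Metric.ball (0 : ℂ) (‖w‖ + 1) →
      ‖besselCoeff μ k * w' ^ k‖ ≤ B * ((‖w‖ + 1) ^ k / k.factorial) := fun k w' hw' => by
    have : ‖w'‖ ≤ ‖w‖ + 1 := by simpa using (Metric.mem_ball.1 hw').le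
    exact (hB k μ w' le_rfl).trans (by gcongr)
  have hw : w ∈ Metric.ball (0 : ℂ) (‖w‖ + 1) := by simp
  have h1 := Complex.differentiableOn_tsum_of_summable_norm hsum hd Metric.isOpen_ball hle
  have h2 := Complex.hasSum_deriv_of_summable_norm hsum hd Metric.isOpen_ball hle hw
  have h3 : HasSum (fun k => deriv (fun w => besselCoeff μ k * w ^ k) w) (- besselF (μ + 1) w) := by
    have h4 : HasSum (fun k => - (besselCoeff (μ + 1) k * w ^ k)) (- besselF (μ + 1) w) :=
      (summable_besselCoeff (μ + 1) w).hasSum.neg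
    rw [← hasSum_nat_add_iff' 1]
    simp only [Finset.range_one, Finset.sum_singleton, pow_zero, mul_one, deriv_const, sub_zero]
    convert! h4 using 2 with k
    rw [deriv_const_mul _ (by fun_prop), deriv_pow_field, Nat.add_sub_cancel, ← neg_mul,
      ← besselCoeff_succ]
    push_cast
    ring
  have h5 := (h1.differentiableAt (Metric.isOpen_ball.mem_nhds hw)).hasDerivAt
  rw [h2.unique h3] at h5
  exact h5

lemma besselF_eq (μ w : ℂ) :
    besselF μ w = (μ + 1) * besselF (μ + 1) w - w * besselF (μ + 2) w := by
  have h1 : HasSum (fun k : ℕ => (μ + 1) * (besselCoeff (μ + 1) k * w ^ k))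
      ((μ + 1) * besselF (μ + 1) w) := (summable_besselCoeff (μ + 1) w).hasSum.mul_left _
  have h2 : HasSum (fun k : ℕ => (k : ℂ) * (besselCoeff (μ + 1) k * w ^ k))
      (- (w * besselF (μ + 2) w)) := by
    rw [← hasSum_nat_add_iff' 1]
    simp only [Finset.range_one, Finset.sum_singleton, Nat.cast_zero, zero_mul, sub_zero]
    have h4 : HasSum (fun k => - (w * (besselCoeff (μ + 2) k * w ^ k)))
      (- (w * besselF (μ + 2) w)) := ((summable_besselCoeff (μ + 2) w).hasSum.mul_left w).neg
    convert! h4 using 2 with k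
    have := besselCoeff_succ (μ + 1) k
    rw [show μ + 1 + 1 = μ + 2 by ring] at this
    push_cast
    linear_combination w ^ (k + 1) * this
  have h3 := h1.add h2
  rw [sub_eq_add_neg, ← h3.tsum_eq, besselF]
  refine tsum_congr fun k => ?_
  rw [besselCoeff_eq_mul]; ring

lemma besselF_zero (μ : ℂ) : besselF μ 0 = (Complex.Gamma (μ + 1))⁻¹ := by
  rw [besselF, tsum_eq_single 0 (fun k hk => by simp [hk])]
  simp [besselCoeff]

/-- Locally uniform bound in both variables. -/
lemma exists_norm_besselF_le (M r : ℝ) :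
    ∃ B : ℝ, ∀ μ w : ℂ, ‖μ‖ ≤ M → ‖w‖ ≤ r → ‖besselF μ w‖ ≤ B := by
  obtain ⟨B, hB0, hB⟩ := exists_norm_besselCoeff_le M
  refine ⟨∑' k : ℕ, B * (r ^ k / k.factorial), fun μ w hμ hw => ?_⟩
  exact tsum_of_norm_bounded ((Real.summable_pow_div_factorial r).mul_left B).hasSum
    fun k => (hB k μ w hμ).trans (by gcongr)

/-- The modified Wronskian of `F_μ` and `F_{-μ}` is constant. -/
lemma besselF_wronskian (μ w : ℂ) :
    -2 * μ * besselF μ w * besselF (-μ) w -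
      2 * w * (besselF μ w * besselF (-μ + 1) w - besselF (-μ) w * besselF (μ + 1) w) =
    -2 * μ * ((Complex.Gamma (μ + 1))⁻¹ * (Complex.Gamma (-μ + 1))⁻¹) := by
  have hd : ∀ w, HasDerivAt (fun w => -2 * μ * besselF μ w * besselF (-μ) w -
      2 * w * (besselF μ w * besselF (-μ + 1) w - besselF (-μ) w * besselF (μ + 1) w)) 0 w := by
    intro w
    have h1 := hasDerivAt_besselF μ w
    have h2 := hasDerivAt_besselF (-μ) w
    have h3 := hasDerivAt_besselF (μ + 1) w
    have h4 := hasDerivAt_besselF (-μ + 1) w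
    have h5 := ((h1.const_mul (-2 * μ)).mul h2).sub
      (((hasDerivAt_id' w).const_mul 2).mul ((h1.mul h4).sub (h2.mul h3)))
    refine h5.congr_deriv ?_
    have e1 := besselF_eq μ w
    have e2 := besselF_eq (-μ) w
    rw [show μ + 1 + 1 = μ + 2 by ring, show -μ + 1 + 1 = -μ + 2 by ring]
    simp only [Pi.sub_apply, Pi.mul_apply]
    linear_combination 2 * besselF μ w * e2 - 2 * besselF (-μ) w * e1
  have hc := is_const_of_deriv_eq_zero (fun w => (hd w).differentiableAt)
    (fun w => (hd w).deriv) w 0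
  rw [hc]
  simp only [besselF_zero]
  ring

/-- For negative integer order, `F_{-n}(w) = (-w)^n F_n(w)`. -/
lemma besselF_neg_nat (n : ℕ) (w : ℂ) : besselF (-n) w = (-w) ^ n * besselF n w := by
  have key : ∀ n : ℕ, besselF (-n) w = (-w) ^ n * besselF n w ∧
      besselF (-(n + 1 : ℕ)) w = (-w) ^ (n + 1) * besselF (n + 1 : ℕ) w := by
    intro n
    induction n with
    | zero =>
      refine ⟨by simp, ?_⟩
      have := besselF_eq (-1) w
      norm_num at this ⊢
      exact this
    | succ n ih =>
      refine ⟨ih.2, ?_⟩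
      have h1 := besselF_eq (-(n + 1 + 1 : ℕ)) w
      have h2 := besselF_eq (n : ℂ) w
      rw [show -((n + 1 + 1 : ℕ) : ℂ) + 1 = -((n + 1 : ℕ) : ℂ) by push_cast; ring,
        show -((n + 1 + 1 : ℕ) : ℂ) + 2 = -(n : ℂ) by push_cast; ring, ih.1, ih.2, h2] at h1
      rw [h1]
      push_cast
      rw [show (n : ℂ) + 1 + 1 = n + 2 by ring]
      ring
  exact (key n).1

/-! ### Bessel functions of the first kind of complex order -/

/-- The Bessel function of the first kind of complex order. -/
noncomputable def besselJC (μ z : ℂ) : ℂ := (z / 2) ^ μ * besselF μ ((z / 2) ^ 2)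

lemma besselJ_eq (μ : ℝ) (z : ℂ) : besselJ μ z = besselJC μ z := by
  simp only [besselJ, besselJC, besselF, besselCoeff, pow_mul]

/-- The open right half-plane. -/
def rightHalfPlane : Set ℂ := {z | 0 < z.re}

lemma isOpen_rightHalfPlane : IsOpen rightHalfPlane :=
  isOpen_lt continuous_const Complex.continuous_re

lemma ne_zero_of_mem_rightHalfPlane {z : ℂ} (hz : z ∈ rightHalfPlane) : z ≠ 0 := by
  rintro rfl
  simp [rightHalfPlane] at hz

lemma half_mem_slitPlane {z : ℂ} (hz : z ∈ rightHalfPlane) : z / 2 ∈ Complex.slitPlane := by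
  left
  have : 0 < z.re := hz
  simpa using this

lemma hasDerivAt_besselJC (μ : ℂ) {z : ℂ} (hz : z ∈ rightHalfPlane) :
    HasDerivAt (besselJC μ) (μ / z * besselJC μ z - besselJC (μ + 1) z) z := by
  have hz0 := ne_zero_of_mem_rightHalfPlane hz
  have hz2 : z / 2 ≠ 0 := div_ne_zero hz0 two_ne_zero
  have h0 : HasDerivAt (fun z : ℂ => z / 2) (1 / 2) z := (hasDerivAt_id' z).div_const 2
  have h1 : HasDerivAt (fun z : ℂ => (z / 2) ^ μ) (μ * (z / 2) ^ (μ - 1) * (1 / 2)) z :=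
    h0.cpow_const (half_mem_slitPlane hz)
  have h2 := (hasDerivAt_besselF μ ((z / 2) ^ 2)).comp z (h0.pow 2)
  refine (h1.mul h2).congr_deriv ?_
  simp only [besselJC]
  rw [Complex.cpow_sub _ _ hz2, Complex.cpow_add _ _ hz2, Complex.cpow_one]
  simp only [Function.comp, Pi.pow_apply]
  push_cast
  field_simp
  ring

lemma besselJC_recurrence (μ : ℂ) {z : ℂ} (hz : z ∈ rightHalfPlane) :
    besselJC μ z = 2 * (μ + 1) / z * besselJC (μ + 1) z - besselJC (μ + 2) z := by
  have hz0 := ne_zero_of_mem_rightHalfPlane hz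
  have hz2 : z / 2 ≠ 0 := div_ne_zero hz0 two_ne_zero
  simp only [besselJC]
  rw [Complex.cpow_add _ _ hz2, Complex.cpow_add _ _ hz2, Complex.cpow_one,
    show ((2 : ℂ)) = ((2 : ℕ) : ℂ) by norm_num, Complex.cpow_natCast, besselF_eq]
  push_cast
  field_simp

lemma differentiableOn_besselJC (μ : ℂ) : DifferentiableOn ℂ (besselJC μ) rightHalfPlane :=
  fun _ hz => (hasDerivAt_besselJC μ hz).differentiableAt.differentiableWithinAt

/-- `f` is a holomorphic solution in the right half-plane of Bessel's equation of order `μ`. -/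
structure IsBesselSolution (μ : ℂ) (f : ℂ → ℂ) : Prop where
  differentiableOn : DifferentiableOn ℂ f rightHalfPlane
  ode : ∀ z ∈ rightHalfPlane,
    z ^ 2 * deriv (deriv f) z + z * deriv f z + (z ^ 2 - μ ^ 2) * f z = 0

lemma isBesselSolution_besselJC (μ : ℂ) : IsBesselSolution μ (besselJC μ) := by
  refine ⟨differentiableOn_besselJC μ, fun z hz => ?_⟩
  have hz0 := ne_zero_of_mem_rightHalfPlane hz
  have h1 : deriv (besselJC μ) =ᶠ[𝓝 z] fun z => μ / z * besselJC μ z - besselJC (μ + 1) z :=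
    (isOpen_rightHalfPlane.eventually_mem hz).mono fun w hw => (hasDerivAt_besselJC μ hw).deriv
  have h2 : HasDerivAt (fun z : ℂ => μ / z) (- μ / z ^ 2) z := by
    simpa [div_eq_mul_inv] using (hasDerivAt_inv hz0).const_mul μ
  have h3 := (h2.mul (hasDerivAt_besselJC μ hz)).sub (hasDerivAt_besselJC (μ + 1) hz)
  rw [h1.deriv_eq, h1.eq_of_nhds]
  erw [h3.deriv]
  have h4 := besselJC_recurrence μ hz
  rw [show μ + 1 + 1 = μ + 2 by ring]
  have h5 : besselJC (μ + 2) z = 2 * (μ + 1) / z * besselJC (μ + 1) z - besselJC μ z := by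
    rw [h4]; ring
  rw [h5]
  field_simp
  ring

lemma besselJC_wronskian (μ : ℂ) {z : ℂ} (hz : z ∈ rightHalfPlane) :
    z * (besselJC μ z * deriv (besselJC (-μ)) z - deriv (besselJC μ) z * besselJC (-μ) z) =
    -2 * μ * ((Complex.Gamma (μ + 1))⁻¹ * (Complex.Gamma (-μ + 1))⁻¹) := by
  have hz0 := ne_zero_of_mem_rightHalfPlane hz
  have hz2 : z / 2 ≠ 0 := div_ne_zero hz0 two_ne_zero
  rw [(hasDerivAt_besselJC μ hz).deriv, (hasDerivAt_besselJC (-μ) hz).deriv,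
    ← besselF_wronskian μ ((z / 2) ^ 2)]
  have h1 : (z / 2) ^ μ * (z / 2) ^ (-μ) = 1 := by
    rw [← Complex.cpow_add _ _ hz2]; simp
  simp only [besselJC]
  rw [Complex.cpow_add _ _ hz2, Complex.cpow_add _ _ hz2, Complex.cpow_one]
  generalize (z / 2) ^ μ = a at *
  generalize (z / 2) ^ (-μ) = b at *
  generalize besselF μ ((z / 2) ^ 2) = A
  generalize besselF (-μ) ((z / 2) ^ 2) = B
  generalize besselF (μ + 1) ((z / 2) ^ 2) = C
  generalize besselF (-μ + 1) ((z / 2) ^ 2) = D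
  field_simp
  linear_combination (-4 * μ * A * B - z ^ 2 * (A * D - B * C)) * h1

lemma Gamma_reflection_inv {μ : ℂ} (hμ : μ ≠ 0) :
    -2 * μ * ((Complex.Gamma (μ + 1))⁻¹ * (Complex.Gamma (-μ + 1))⁻¹) =
      -2 / Real.pi * Complex.sin (μ * Real.pi) := by
  have h1 := Complex.Gamma_mul_Gamma_one_sub μ
  have hpi : (Real.pi : ℂ) ≠ 0 := by exact_mod_cast Real.pi_ne_zero
  rw [Complex.Gamma_add_one μ hμ, show -μ + 1 = 1 - μ by ring]
  rw [← mul_inv, mul_assoc μ, h1, mul_comm μ (Real.pi : ℂ), mul_inv, inv_div]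
  field_simp

/-! ### Bessel's equation and the Wronskian of `J` and `Y` -/

namespace IsBesselSolution

variable {μ : ℂ} {f g : ℂ → ℂ}

lemma hasDerivAt (hf : IsBesselSolution μ f) {z : ℂ} (hz : z ∈ rightHalfPlane) :
    HasDerivAt f (deriv f z) z :=
  (hf.differentiableOn.differentiableAt (isOpen_rightHalfPlane.mem_nhds hz)).hasDerivAt

lemma hasDerivAt_deriv (hf : IsBesselSolution μ f) {z : ℂ} (hz : z ∈ rightHalfPlane) :
    HasDerivAt (deriv f) (deriv (deriv f) z) z :=
  ((hf.differentiableOn.deriv isOpen_rightHalfPlane).differentiableAt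
    (isOpen_rightHalfPlane.mem_nhds hz)).hasDerivAt

lemma of_neg (hf : IsBesselSolution (-μ) f) : IsBesselSolution μ f :=
  ⟨hf.differentiableOn, fun z hz => by simpa using hf.ode z hz⟩

lemma congr (hf : IsBesselSolution μ f) (h : Set.EqOn f g rightHalfPlane) :
    IsBesselSolution μ g := by
  refine ⟨hf.differentiableOn.congr fun z hz => (h hz).symm, fun z hz => ?_⟩
  have h1 : g =ᶠ[𝓝 z] f :=
    (isOpen_rightHalfPlane.eventually_mem hz).mono fun w hw => (h hw).symm
  rw [h1.deriv.deriv_eq, h1.deriv_eq, h1.eq_of_nhds]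
  exact hf.ode z hz

lemma linear_comb (hf : IsBesselSolution μ f) (hg : IsBesselSolution μ g) (a b : ℂ) :
    IsBesselSolution μ (fun z => a * f z + b * g z) := by
  refine ⟨(hf.differentiableOn.const_mul a).add (hg.differentiableOn.const_mul b),
    fun z hz => ?_⟩
  have h1 : ∀ z ∈ rightHalfPlane, HasDerivAt (fun z => a * f z + b * g z)
      (a * deriv f z + b * deriv g z) z := fun z hz =>
    ((hf.hasDerivAt hz).const_mul a).add ((hg.hasDerivAt hz).const_mul b)
  have h2 : deriv (fun z => a * f z + b * g z) =ᶠ[𝓝 z] fun z => a * deriv f z + b * deriv g z :=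
    (isOpen_rightHalfPlane.eventually_mem hz).mono fun w hw => (h1 w hw).deriv
  have h3 := (((hf.hasDerivAt_deriv hz).const_mul a).add ((hg.hasDerivAt_deriv hz).const_mul b))
  rw [h2.deriv_eq, h2.eq_of_nhds]
  erw [h3.deriv]
  linear_combination a * hf.ode z hz + b * hg.ode z hz

/-- Locally uniform limits of solutions, of varying order, are solutions. -/
lemma of_tendsto {ι : Type*} {l : Filter ι} [l.NeBot] {m : ι → ℂ} {F : ι → ℂ → ℂ}
    (hm : Tendsto m l (𝓝 μ)) (hF : ∀ i, IsBesselSolution (m i) (F i))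
    (h : TendstoLocallyUniformlyOn F f l rightHalfPlane) : IsBesselSolution μ f := by
  have hd : ∀ᶠ i in l, DifferentiableOn ℂ (F i) rightHalfPlane :=
    Eventually.of_forall fun i => (hF i).differentiableOn
  have hd' : ∀ᶠ i in l, DifferentiableOn ℂ ((deriv ∘ F) i) rightHalfPlane :=
    Eventually.of_forall fun i => (hF i).differentiableOn.deriv isOpen_rightHalfPlane
  have h1 := h.deriv hd isOpen_rightHalfPlane
  have h2 := h1.deriv hd' isOpen_rightHalfPlane
  refine ⟨h.differentiableOn hd isOpen_rightHalfPlane, fun z hz => ?_⟩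
  have h3 : Tendsto (fun i => z ^ 2 * deriv (deriv (F i)) z + z * deriv (F i) z +
      (z ^ 2 - m i ^ 2) * F i z) l
      (𝓝 (z ^ 2 * deriv (deriv f) z + z * deriv f z + (z ^ 2 - μ ^ 2) * f z)) :=
    (((h2.tendsto_at hz).const_mul _).add ((h1.tendsto_at hz).const_mul _)).add
      ((tendsto_const_nhds.sub (hm.pow 2)).mul (h.tendsto_at hz))
  refine tendsto_nhds_unique h3 ?_
  simp only [(hF _).ode z hz]
  exact tendsto_const_nhds

end IsBesselSolution

/-- The numerator `J_μ(z) cos(μπ) - J_{-μ}(z)` in the definition of `Y_μ`, for complex `μ`. -/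
noncomputable def besselYNum (μ z : ℂ) : ℂ :=
  besselJC μ z * Complex.cos (μ * Real.pi) - besselJC (-μ) z

lemma isBesselSolution_besselYNum (μ : ℂ) : IsBesselSolution μ (besselYNum μ) :=
  ((isBesselSolution_besselJC μ).linear_comb (isBesselSolution_besselJC (-μ)).of_neg
    (Complex.cos (μ * Real.pi)) (-1)).congr fun z _ => by simp only [besselYNum]; ring

lemma besselYNum_wronskian (μ : ℂ) {z : ℂ} (hz : z ∈ rightHalfPlane) :
    z * (besselJC μ z * deriv (besselYNum μ) z - deriv (besselJC μ) z * besselYNum μ z) =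
      2 / Real.pi * Complex.sin (μ * Real.pi) := by
  have h1 : deriv (besselYNum μ) z =
      deriv (besselJC μ) z * Complex.cos (μ * Real.pi) - deriv (besselJC (-μ)) z :=
    (((isBesselSolution_besselJC μ).hasDerivAt hz).mul_const _ |>.sub
      ((isBesselSolution_besselJC (-μ)).hasDerivAt hz)).deriv
  have h2 := besselJC_wronskian μ hz
  rw [h1]
  rcases eq_or_ne μ 0 with rfl | hμ
  · simp only [besselYNum, neg_zero, zero_mul, Complex.cos_zero, Complex.sin_zero]
    ring
  · rw [Gamma_reflection_inv hμ] at h2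
    simp only [besselYNum]
    linear_combination -h2

lemma Complex.cos_nat_mul_pi' (n : ℕ) : Complex.cos (n * Real.pi) = (-1) ^ n := by
  have := congrArg (fun x : ℝ => (x : ℂ)) (Real.cos_nat_mul_pi n)
  simpa using this

/-- At integer order numerator and denominator of `Y_μ` vanish, so `Y_n` is a quotient of derivatives. -/
lemma besselYNum_nat (n : ℕ) {z : ℂ} (hz : z ∈ rightHalfPlane) : besselYNum n z = 0 := by
  have hz2 : z / 2 ≠ 0 := div_ne_zero (ne_zero_of_mem_rightHalfPlane hz) two_ne_zero
  simp only [besselYNum, besselJC, besselF_neg_nat, Complex.cos_nat_mul_pi']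
  rw [Complex.cpow_neg, Complex.cpow_natCast, neg_pow ((z / 2) ^ 2), ← pow_mul, two_mul, pow_add]
  field_simp
  ring

lemma differentiable_besselJC_order {z : ℂ} (hz : z ∈ rightHalfPlane) :
    Differentiable ℂ fun μ => besselJC μ z := by
  have hz2 : z / 2 ≠ 0 := div_ne_zero (ne_zero_of_mem_rightHalfPlane hz) two_ne_zero
  refine Differentiable.mul (fun μ => ?_) (differentiable_besselF_order _)
  exact differentiableAt_id.const_cpow (Or.inl hz2)

lemma differentiable_besselYNum_order {z : ℂ} (hz : z ∈ rightHalfPlane) :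
    Differentiable ℂ fun μ => besselYNum μ z := by
  have h1 := differentiable_besselJC_order hz
  have h2 : Differentiable ℂ fun μ => besselJC (-μ) z := h1.comp differentiable_neg
  have h3 : Differentiable ℂ fun μ : ℂ => Complex.cos (μ * Real.pi) :=
    Complex.differentiable_cos.comp (by fun_prop)
  exact (h1.mul h3).sub h2

lemma exists_norm_besselJC_le (M : ℝ) {K : Set ℂ} (hK : IsCompact K) (hKs : K ⊆ rightHalfPlane) :
    ∃ B : ℝ, ∀ μ : ℂ, ‖μ‖ ≤ M → ∀ z ∈ K, ‖besselJC μ z‖ ≤ B := by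
  obtain ⟨r, hr⟩ := hK.exists_bound_of_continuousOn (f := fun z : ℂ => (z / 2) ^ 2) (by fun_prop)
  obtain ⟨B, hB⟩ := exists_norm_besselF_le M r
  have hc : ContinuousOn (fun p : ℂ × ℂ => (p.2 / 2) ^ p.1) (Metric.closedBall 0 M ×ˢ K) :=
    ContinuousOn.cpow (by fun_prop) (by fun_prop) fun p hp => half_mem_slitPlane (hKs hp.2)
  obtain ⟨B', hB'⟩ := ((isCompact_closedBall (0 : ℂ) M).prod hK).exists_bound_of_continuousOn hc
  refine ⟨B' * B, fun μ hμ z hz => ?_⟩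
  have h1 := hB' (μ, z) ⟨by simpa using hμ, hz⟩
  rw [besselJC, norm_mul]
  exact mul_le_mul h1 (hB _ _ hμ (hr z hz)) (norm_nonneg _) ((norm_nonneg _).trans h1)

lemma exists_norm_besselYNum_le (M : ℝ) {K : Set ℂ} (hK : IsCompact K)
    (hKs : K ⊆ rightHalfPlane) :
    ∃ B : ℝ, 0 < B ∧ ∀ μ : ℂ, ‖μ‖ ≤ M → ∀ z ∈ K, ‖besselYNum μ z‖ < B := by
  obtain ⟨B, hB⟩ := exists_norm_besselJC_le M hK hKs
  obtain ⟨B', hB'⟩ := (isCompact_closedBall (0 : ℂ) M).exists_bound_of_continuousOn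
    (f := fun μ : ℂ => Complex.cos (μ * Real.pi))
    (Complex.continuous_cos.comp (by fun_prop)).continuousOn
  refine ⟨|B| * |B'| + |B| + 1, by positivity, fun μ hμ z hz => ?_⟩
  rw [besselYNum]
  refine (norm_sub_le _ _).trans_lt ?_
  rw [norm_mul]
  have h1 := (hB μ hμ z hz).trans (le_abs_self _)
  have h2 := (hB' μ (by simpa using hμ)).trans (le_abs_self _)
  have h3 := (hB (-μ) (by simpa using hμ) z hz).trans (le_abs_self _)
  have h4 := mul_le_mul h1 h2 (norm_nonneg _) (abs_nonneg _)
  linarith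

/-- Two applications of the Schwarz lemma: a difference quotient at a zero of a bounded holomorphic
function approaches the derivative at a linear rate that depends on the bound only. -/
lemma norm_div_sub_deriv_le {h : ℂ → ℂ} {c μ : ℂ} {B : ℝ} (hd : Differentiable ℂ h) (hc : h c = 0)
    (hB : ∀ μ ∈ Metric.ball c 1, ‖h μ‖ < B) (hμ : μ ∈ Metric.ball c 1) (hne : μ ≠ c) :
    ‖h μ / (μ - c) - deriv h c‖ ≤ (2 * B + 1) * ‖μ - c‖ := by
  have hg : DifferentiableOn ℂ (dslope h c) (Metric.ball c 1) :=
    (Complex.differentiableOn_dslope (Metric.isOpen_ball.mem_nhds (by simp))).2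
      hd.differentiableOn
  have hgB : ∀ μ ∈ Metric.ball c 1, ‖dslope h c μ‖ ≤ B := fun μ hμ => by
    have := Complex.norm_dslope_le_div_of_mapsTo_ball (f := h) (c := c) (R₁ := 1) (R₂ := B)
      hd.differentiableOn (fun w hw => by simpa [hc] using! (hB w hw).le) hμ
    simpa using this
  have h2 := Complex.norm_dslope_le_div_of_mapsTo_ball (f := dslope h c) (c := c) (R₁ := 1)
    (R₂ := 2 * B + 1) hg (fun w hw => by
      have h1 := hgB w hw
      have h2 := hgB c (by simp)
      have h3 := norm_sub_le (dslope h c w) (dslope h c c)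
      rw [Metric.mem_closedBall, dist_eq_norm]
      linarith) hμ
  rw [dslope_of_ne _ hne, slope_def_field, norm_div, div_one, div_le_iff₀
    (norm_pos_iff.2 (sub_ne_zero.2 hne))] at h2
  rw [dslope_same, dslope_of_ne _ hne, slope_def_field, hc, sub_zero] at h2
  exact h2

/-- The derivative in the order, at `μ = n`, of `besselYNum`. -/
noncomputable def besselYNumDeriv (n : ℕ) (z : ℂ) : ℂ := deriv (fun μ => besselYNum μ z) n

lemma tendstoLocallyUniformlyOn_besselYNum (n : ℕ) :
    TendstoLocallyUniformlyOn (fun μ z => (μ - (n : ℂ))⁻¹ * besselYNum μ z) (besselYNumDeriv n)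
      (𝓝[≠] (n : ℂ)) rightHalfPlane := by
  rw [tendstoLocallyUniformlyOn_iff_forall_isCompact isOpen_rightHalfPlane]
  intro K hKs hK
  obtain ⟨B, hB0, hB⟩ := exists_norm_besselYNum_le (n + 1) hK hKs
  rw [Metric.tendstoUniformlyOn_iff]
  intro ε hε
  have hB1 : 0 < 2 * B + 1 := by positivity
  have h1 : ∀ᶠ μ in 𝓝[≠] (n : ℂ), μ ∈ Metric.ball (n : ℂ) 1 :=
    nhdsWithin_le_nhds (Metric.isOpen_ball.mem_nhds (by simp))
  have h2 : ∀ᶠ μ in 𝓝[≠] (n : ℂ), μ ∈ Metric.ball (n : ℂ) (ε / (2 * B + 1)) :=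
    nhdsWithin_le_nhds (Metric.isOpen_ball.mem_nhds (by simpa using by positivity))
  filter_upwards [h1, h2, self_mem_nhdsWithin] with μ h1 h2 h3 z hz
  have h4 := norm_div_sub_deriv_le (differentiable_besselYNum_order (hKs hz))
    (besselYNum_nat n (hKs hz)) (B := B) (fun μ hμ => hB μ (by
      have := norm_add_le (μ - n) n
      rw [Metric.mem_ball, dist_eq_norm] at hμ
      rw [sub_add_cancel, Complex.norm_natCast] at this
      linarith) z hz) h1 h3
  rw [dist_comm, dist_eq_norm, inv_mul_eq_div]
  refine h4.trans_lt ?_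
  rw [Metric.mem_ball, dist_eq_norm, lt_div_iff₀ hB1] at h2
  linarith

lemma tendsto_sin_slope (n : ℕ) :
    Tendsto (fun μ : ℂ => (μ - n)⁻¹ * Complex.sin (μ * Real.pi)) (𝓝[≠] (n : ℂ))
      (𝓝 (Real.pi * (-1) ^ n)) := by
  have h1 : HasDerivAt (fun μ : ℂ => Complex.sin (μ * Real.pi)) (Real.pi * (-1) ^ n) (n : ℂ) := by
    have := ((hasDerivAt_id' (n : ℂ)).mul_const (Real.pi : ℂ)).csin
    rw [Complex.cos_nat_mul_pi'] at this
    simpa [mul_comm] using this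
  have h2 := h1.tendsto_slope
  refine h2.congr fun μ => ?_
  rw [slope_def_field, Complex.sin_nat_mul_pi, sub_zero, inv_mul_eq_div]

lemma isBesselSolution_besselYNumDeriv (n : ℕ) : IsBesselSolution n (besselYNumDeriv n) :=
  IsBesselSolution.of_tendsto (m := fun μ : ℂ => μ) (tendsto_id.mono_left nhdsWithin_le_nhds)
    (fun μ => ((isBesselSolution_besselYNum μ).linear_comb (isBesselSolution_besselYNum μ)
      (μ - n)⁻¹ 0).congr fun z _ => by simp) (tendstoLocallyUniformlyOn_besselYNum n)

lemma besselYNumDeriv_wronskian (n : ℕ) {z : ℂ} (hz : z ∈ rightHalfPlane) :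
    z * (besselJC n z * deriv (besselYNumDeriv n) z -
      deriv (besselJC n) z * besselYNumDeriv n z) = 2 * (-1) ^ n := by
  have h1 := tendstoLocallyUniformlyOn_besselYNum n
  have h2 := h1.deriv (Eventually.of_forall fun μ =>
    (isBesselSolution_besselYNum μ).differentiableOn.const_mul _) isOpen_rightHalfPlane
  have hJ : ∀ m : ℂ, Tendsto (fun μ => besselJC μ z) (𝓝 m) (𝓝 (besselJC m z)) := fun m =>
    (differentiable_besselJC_order hz).continuous.tendsto m
  have h3 : Tendsto (fun μ => besselJC μ z) (𝓝[≠] (n : ℂ)) (𝓝 (besselJC n z)) :=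
    (hJ n).mono_left nhdsWithin_le_nhds
  have h4 : Tendsto (fun μ => deriv (besselJC μ) z) (𝓝[≠] (n : ℂ)) (𝓝 (deriv (besselJC n) z)) := by
    simp only [fun μ => (hasDerivAt_besselJC μ hz).deriv]
    refine Tendsto.mono_left ?_ nhdsWithin_le_nhds
    exact ((tendsto_id.div_const z).mul (hJ n)).sub
      ((hJ (n + 1)).comp (tendsto_id.add_const (1 : ℂ)))
  have h5 := ((h3.mul (h2.tendsto_at hz)).sub (h4.mul (h1.tendsto_at hz))).const_mul z
  have h6 := (tendsto_sin_slope n).const_mul (2 / Real.pi : ℂ)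
  have hpi : (Real.pi : ℂ) ≠ 0 := by exact_mod_cast Real.pi_ne_zero
  rw [show (2 / Real.pi : ℂ) * (Real.pi * (-1) ^ n) = 2 * (-1) ^ n by field_simp] at h6
  refine tendsto_nhds_unique h5 (h6.congr fun μ => ?_)
  have h7 := besselYNum_wronskian μ hz
  have h8 : deriv (fun z => (μ - n)⁻¹ * besselYNum μ z) z =
      (μ - n)⁻¹ * deriv (besselYNum μ) z :=
    (((isBesselSolution_besselYNum μ).hasDerivAt hz).const_mul _).deriv
  simp only [Function.comp, h8]
  linear_combination -(μ - n)⁻¹ * h7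

lemma besselYQuot_eq (μ : ℝ) (z : ℂ) :
    besselYQuot μ z = besselYNum μ z / Complex.sin (μ * Real.pi) := by
  simp only [besselYQuot, besselYNum, besselJ_eq]
  push_cast
  rfl

lemma besselY_nat (n : ℕ) {z : ℂ} (hz : z ∈ rightHalfPlane) :
    besselY n z = besselYNumDeriv n z / (Real.pi * (-1) ^ n) := by
  have h : ∃ m : ℤ, ((n : ℝ)) = m := ⟨n, by simp⟩
  rw [besselY, if_pos h]
  refine Tendsto.limUnder_eq ?_
  have hpi : (Real.pi : ℂ) ≠ 0 := by exact_mod_cast Real.pi_ne_zero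
  have h1 := ((tendstoLocallyUniformlyOn_besselYNum n).tendsto_at hz).div (tendsto_sin_slope n)
    (mul_ne_zero hpi (pow_ne_zero _ (by norm_num)))
  have h2 : Tendsto (fun x : ℝ => (x : ℂ)) (𝓝[≠] (n : ℝ)) (𝓝[≠] (n : ℂ)) := by
    refine tendsto_nhdsWithin_iff.2 ⟨?_, ?_⟩
    · have := (Complex.continuous_ofReal.tendsto (n : ℝ)).mono_left
        (nhdsWithin_le_nhds (s := {(n : ℝ)}ᶜ))
      simpa using this
    · filter_upwards [self_mem_nhdsWithin] with x hx hx'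
      exact hx (Set.mem_singleton_iff.2 (by exact_mod_cast Set.mem_singleton_iff.1 hx'))
  refine (h1.comp h2).congr' ?_
  filter_upwards [self_mem_nhdsWithin] with x hx
  have h3 : ((x : ℂ) - n) ≠ 0 := sub_ne_zero.2 fun h => hx (by exact_mod_cast h)
  simp only [Function.comp, Pi.div_apply, besselYQuot_eq]
  rw [mul_div_mul_left _ _ (inv_ne_zero h3)]

/-- `J_ν` and `Y_ν` are holomorphic solutions of Bessel's equation in the right half-plane with
nowhere vanishing Wronskian. -/
lemma besselJ_besselY_system {ν : ℝ} (hν : 0 ≤ ν) :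
    IsBesselSolution ν (besselJ ν) ∧ IsBesselSolution ν (besselY ν) ∧
      ∀ z ∈ rightHalfPlane,
        z * (besselJ ν z * deriv (besselY ν) z - deriv (besselJ ν) z * besselY ν z) =
          2 / Real.pi := by
  have hpi : (Real.pi : ℂ) ≠ 0 := by exact_mod_cast Real.pi_ne_zero
  have hJ : besselJ ν = besselJC ν := funext fun z => besselJ_eq ν z
  refine ⟨hJ ▸ isBesselSolution_besselJC ν, ?_⟩
  -- `Y_ν` is a nonzero multiple of a solution whose Wronskian with `J_ν` is known.
  suffices h : ∃ (g : ℂ → ℂ) (c w : ℂ), IsBesselSolution ν g ∧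
      (∀ z ∈ rightHalfPlane, besselY ν z = c * g z) ∧ c * w = 2 / Real.pi ∧
      ∀ z ∈ rightHalfPlane, z * (besselJC ν z * deriv g z - deriv (besselJC ν) z * g z) = w by
    obtain ⟨g, c, w, hg, hY, hw, hW⟩ := h
    refine ⟨(hg.linear_comb hg c 0).congr fun z hz => by simp [hY z hz], fun z hz => ?_⟩
    have h1 : besselY ν =ᶠ[𝓝 z] fun z => c * g z :=
      (isOpen_rightHalfPlane.eventually_mem hz).mono fun w hw => hY w hw
    rw [hJ, h1.deriv_eq, h1.eq_of_nhds, ((hg.hasDerivAt hz).const_mul c).deriv, ← hw, ← hW z hz]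
    ring
  by_cases hn : ∃ n : ℤ, ν = n
  · obtain ⟨n, rfl⟩ := hn
    lift n to ℕ using by exact_mod_cast hν
    refine ⟨besselYNumDeriv n, (Real.pi * (-1) ^ n)⁻¹, 2 * (-1) ^ n, ?_, fun z hz => ?_, ?_,
      fun z hz => ?_⟩
    · simpa using isBesselSolution_besselYNumDeriv n
    · have := besselY_nat n hz
      rw [div_eq_inv_mul] at this
      simpa using this
    · field_simp
    · simpa using besselYNumDeriv_wronskian n hz
  · have hs : Complex.sin (ν * Real.pi) ≠ 0 := by
      rw [Complex.sin_ne_zero_iff]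
      intro k hk
      exact hn ⟨k, by exact_mod_cast mul_right_cancel₀ hpi hk⟩
    refine ⟨besselYNum ν, (Complex.sin (ν * Real.pi))⁻¹, 2 / Real.pi * Complex.sin (ν * Real.pi),
      isBesselSolution_besselYNum ν, fun z _ => ?_, ?_, fun z hz => besselYNum_wronskian ν hz⟩
    · rw [besselY, if_neg hn, besselYQuot_eq, div_eq_inv_mul]
    · field_simp

/-! ### Integrals along horizontal rays -/

open MeasureTheory Set in
lemma integrableOn_inv_sq_add_sq {r : ℝ} (hr : 0 < r) :
    IntegrableOn (fun t : ℝ => (r ^ 2 + t ^ 2)⁻¹) (Ioi 0) := by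
  have h1 : Integrable fun t : ℝ => (1 + (r⁻¹ * t) ^ 2)⁻¹ :=
    integrable_inv_one_add_sq.comp_mul_left' (inv_ne_zero hr.ne')
  refine ((h1.const_mul (r ^ 2)⁻¹).congr (Eventually.of_forall fun t => ?_)).integrableOn
  simp only
  rw [← mul_inv]
  congr 1
  field_simp

open MeasureTheory Set in
lemma integral_Ioi_zero_inv_sq_add_sq {r : ℝ} (hr : 0 < r) :
    ∫ t in Ioi (0 : ℝ), (r ^ 2 + t ^ 2)⁻¹ = Real.pi / 2 * r⁻¹ := by
  have h1 := integral_comp_mul_left_Ioi (fun t : ℝ => (1 + t ^ 2)⁻¹) 0 (inv_pos.2 hr)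
  have h2 : ∀ t : ℝ, (r ^ 2 + t ^ 2)⁻¹ = (r ^ 2)⁻¹ * (1 + (r⁻¹ * t) ^ 2)⁻¹ := fun t => by
    rw [← mul_inv]
    congr 1
    field_simp
  simp only [h2]
  rw [integral_const_mul, h1, mul_zero, integral_Ioi_inv_one_add_sq, Real.arctan_zero, sub_zero,
    smul_eq_mul, inv_inv]
  field_simp

/-- The part of the right half-plane outside the disc of radius `R`. -/
def outerHalfPlane (R : ℝ) : Set ℂ := {z | 0 < z.re ∧ R < ‖z‖}

lemma isOpen_outerHalfPlane (R : ℝ) : IsOpen (outerHalfPlane R) :=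
  (isOpen_lt continuous_const Complex.continuous_re).inter (isOpen_lt continuous_const
    continuous_norm)

lemma outerHalfPlane_anti {R R' : ℝ} (h : R ≤ R') : outerHalfPlane R' ⊆ outerHalfPlane R :=
  fun _ hz => ⟨hz.1, h.trans_lt hz.2⟩

section outerHalfPlane

variable {R : ℝ} {z : ℂ}

lemma ne_zero_of_mem_outerHalfPlane (hz : z ∈ outerHalfPlane R) : z ≠ 0 :=
  ne_zero_of_mem_rightHalfPlane hz.1

lemma norm_pos_of_mem_outerHalfPlane (hz : z ∈ outerHalfPlane R) : 0 < ‖z‖ :=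
  norm_pos_iff.2 (ne_zero_of_mem_outerHalfPlane hz)

lemma norm_inv_lt_one_of_mem_outerHalfPlane (hR : 1 ≤ R) (hz : z ∈ outerHalfPlane R) :
    ‖z‖⁻¹ < 1 :=
  inv_lt_one_of_one_lt₀ (hR.trans_lt hz.2)

lemma sq_add_sq_le_norm_add_sq (hz : 0 ≤ z.re) {t : ℝ} (ht : 0 ≤ t) :
    ‖z‖ ^ 2 + t ^ 2 ≤ ‖z + t‖ ^ 2 := by
  rw [← Complex.normSq_eq_norm_sq, ← Complex.normSq_eq_norm_sq, Complex.normSq_apply,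
    Complex.normSq_apply]
  simp only [Complex.add_re, Complex.ofReal_re, Complex.add_im, Complex.ofReal_im, add_zero]
  nlinarith [mul_nonneg hz ht]

lemma norm_le_norm_add (hz : 0 ≤ z.re) {t : ℝ} (ht : 0 ≤ t) : ‖z‖ ≤ ‖z + t‖ := by
  refine le_of_sq_le_sq ?_ (norm_nonneg _)
  nlinarith [sq_add_sq_le_norm_add_sq hz ht]
where
  le_of_sq_le_sq {a b : ℝ} (h : a ^ 2 ≤ b ^ 2) (hb : 0 ≤ b) : a ≤ b := by nlinarith

lemma add_mem_outerHalfPlane (hz : z ∈ outerHalfPlane R) {t : ℝ} (ht : 0 ≤ t) :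
    z + t ∈ outerHalfPlane R :=
  ⟨by simpa using add_pos_of_pos_of_nonneg hz.1 ht, hz.2.trans_le (norm_le_norm_add hz.1.le ht)⟩

/-- Inverse powers along a horizontal ray are dominated by an integrable function. -/
lemma norm_inv_pow_add_le (hz : z ∈ outerHalfPlane R) {t : ℝ} (ht : 0 ≤ t) (m : ℕ) :
    ‖z + t‖⁻¹ ^ (m + 2) ≤ ‖z‖⁻¹ ^ m * (‖z‖ ^ 2 + t ^ 2)⁻¹ := by
  have h0 := norm_pos_of_mem_outerHalfPlane hz
  rw [pow_add]
  refine mul_le_mul ?_ ?_ (by positivity) (by positivity)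
  · gcongr
    exact norm_le_norm_add hz.1.le ht
  · rw [inv_pow]
    exact inv_anti₀ (by positivity) (sq_add_sq_le_norm_add_sq hz.1.le ht)

lemma continuousOn_comp_add {φ : ℂ → ℂ} (hφ : DifferentiableOn ℂ φ (outerHalfPlane R))
    (hz : z ∈ outerHalfPlane R) : ContinuousOn (fun t : ℝ => φ (z + t)) (Set.Ici 0) :=
  hφ.continuousOn.comp (by fun_prop) fun _ ht => add_mem_outerHalfPlane hz ht

lemma hasDerivAt_comp_add {φ : ℂ → ℂ} {φ' : ℂ} {t : ℝ} (h : HasDerivAt φ φ' (z + t)) :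
    HasDerivAt (fun t : ℝ => φ (z + t)) φ' t := by
  have h1 : HasDerivAt (fun t : ℝ => z + (t : ℂ)) 1 t := by
    simpa using (hasDerivAt_id' t).ofReal_comp.const_add z
  simpa using! HasDerivAt.comp_of_eq t h h1 rfl

end outerHalfPlane

open MeasureTheory Set in
/-- The integral `∫₀^∞ k(t) φ(z + t) dt` along the horizontal ray from `z` to the right. -/
noncomputable def rayIntegral (k : ℝ → ℂ) (φ : ℂ → ℂ) (z : ℂ) : ℂ :=
  ∫ t in Ioi (0 : ℝ), k t * φ (z + t)

section rayIntegral

open MeasureTheory Set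

variable {R B C : ℝ} {k k' : ℝ → ℂ} {φ : ℂ → ℂ} {z : ℂ}

lemma norm_mul_comp_add_le {m : ℕ} (hk : ∀ t, ‖k t‖ ≤ B) (hB : 0 ≤ B)
    (hφ : ∀ w ∈ outerHalfPlane R, ‖φ w‖ ≤ C * ‖w‖⁻¹ ^ (m + 2)) (hC : 0 ≤ C)
    (hz : z ∈ outerHalfPlane R) {t : ℝ} (ht : 0 ≤ t) :
    ‖k t * φ (z + t)‖ ≤ B * C * ‖z‖⁻¹ ^ m * (‖z‖ ^ 2 + t ^ 2)⁻¹ := by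
  rw [norm_mul]
  calc _ ≤ B * (C * (‖z‖⁻¹ ^ m * (‖z‖ ^ 2 + t ^ 2)⁻¹)) := by
        gcongr
        · exact hk t
        · exact (hφ _ (add_mem_outerHalfPlane hz ht)).trans
            (mul_le_mul_of_nonneg_left (norm_inv_pow_add_le hz ht m) hC)
    _ = _ := by ring

lemma integrableOn_rayIntegral (hk : ∀ t, ‖k t‖ ≤ B) (hkc : Continuous k) (hB : 0 ≤ B)
    (hd : DifferentiableOn ℂ φ (outerHalfPlane R))
    (hφ : ∀ w ∈ outerHalfPlane R, ‖φ w‖ ≤ C * ‖w‖⁻¹ ^ 2) (hC : 0 ≤ C)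
    (hz : z ∈ outerHalfPlane R) :
    IntegrableOn (fun t : ℝ => k t * φ (z + t)) (Ioi 0) := by
  refine Integrable.mono' ((integrableOn_inv_sq_add_sq (norm_pos_of_mem_outerHalfPlane hz)).const_mul
    (B * C * ‖z‖⁻¹ ^ 0)) ?_ ?_
  · exact ((hkc.continuousOn.mul (continuousOn_comp_add hd hz)).mono
      Ioi_subset_Ici_self).aestronglyMeasurable measurableSet_Ioi
  · refine (ae_restrict_iff' measurableSet_Ioi).2 (Eventually.of_forall fun t ht => ?_)
    exact norm_mul_comp_add_le hk hB (m := 0) hφ hC hz (le_of_lt ht)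

lemma norm_rayIntegral_le {m : ℕ} (hk : ∀ t, ‖k t‖ ≤ B) (hB : 0 ≤ B)
    (hφ : ∀ w ∈ outerHalfPlane R, ‖φ w‖ ≤ C * ‖w‖⁻¹ ^ (m + 2)) (hC : 0 ≤ C)
    (hz : z ∈ outerHalfPlane R) :
    ‖rayIntegral k φ z‖ ≤ B * C * (Real.pi / 2) * ‖z‖⁻¹ ^ (m + 1) := by
  have hz0 := norm_pos_of_mem_outerHalfPlane hz
  have h1 := norm_integral_le_of_norm_le (μ := volume.restrict (Ioi (0 : ℝ)))
    ((integrableOn_inv_sq_add_sq hz0).const_mul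
    (B * C * ‖z‖⁻¹ ^ m)) (f := fun t : ℝ => k t * φ (z + t))
    ((ae_restrict_iff' measurableSet_Ioi).2 (Eventually.of_forall fun t ht =>
      norm_mul_comp_add_le hk hB hφ hC hz (le_of_lt ht)))
  rw [integral_const_mul, integral_Ioi_zero_inv_sq_add_sq hz0] at h1
  refine h1.trans_eq ?_
  ring

lemma tendsto_mul_comp_add (hk : ∀ t, ‖k t‖ ≤ B) (hB : 0 ≤ B) (hC : 0 ≤ C)
    (hφ : ∀ w ∈ outerHalfPlane R, ‖φ w‖ ≤ C * ‖w‖⁻¹)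
    (hz : z ∈ outerHalfPlane R) :
    Tendsto (fun t : ℝ => k t * φ (z + t)) atTop (𝓝 0) := by
  have h1 : Tendsto (fun t : ℝ => B * C * t⁻¹) atTop (𝓝 0) := by
    simpa using tendsto_inv_atTop_zero.const_mul (B * C)
  refine squeeze_zero_norm' ?_ h1
  filter_upwards [eventually_gt_atTop 0] with t ht
  rw [norm_mul, mul_assoc]
  have h2 : t ≤ ‖z + t‖ := by
    have := Complex.re_le_norm (z + t)
    simp only [Complex.add_re, Complex.ofReal_re] at this
    have := hz.1
    linarith
  gcongr
  · exact hk t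
  · exact (hφ _ (add_mem_outerHalfPlane hz ht.le)).trans (by gcongr)

/-- Differentiation of a ray integral: moving the derivative from `φ` to the kernel. -/
lemma hasDerivAt_rayIntegral (hR : 1 ≤ R) (hk : ∀ t, ‖k t‖ ≤ B) (hB : 0 ≤ B)
    (hkd : ∀ t, HasDerivAt k (k' t) t) (hk'c : Continuous k') (hk' : ∀ t, ‖k' t‖ ≤ B)
    (hd : DifferentiableOn ℂ φ (outerHalfPlane R))
    (hφ : ∀ w ∈ outerHalfPlane R, ‖φ w‖ ≤ C * ‖w‖⁻¹ ^ 2) (hC : 0 ≤ C)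
    (hz : z ∈ outerHalfPlane R) :
    HasDerivAt (rayIntegral k φ) (- (k 0 * φ z) - rayIntegral k' φ z) z := by
  have hkc : Continuous k := continuous_iff_continuousAt.2 fun t => (hkd t).continuousAt
  have hR0 : 0 < R := by linarith
  obtain ⟨r, hr, hball⟩ := Metric.isOpen_iff.1 (isOpen_outerHalfPlane R) z hz
  have hr2 : 0 < r / 2 := by positivity
  have hd' : ∀ x ∈ Metric.ball z (r / 2), ∀ t : ℝ, 0 ≤ t → HasDerivAt φ (deriv φ (x + t)) (x + t) :=
    fun x hx t ht => (hd.differentiableAt ((isOpen_outerHalfPlane R).mem_nhds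
      (add_mem_outerHalfPlane (hball (Metric.ball_subset_ball (by linarith) hx)) ht))).hasDerivAt
  -- Cauchy's estimate on discs of radius `r / 4` dominates the derivative.
  have hcauchy : ∀ x ∈ Metric.ball z (r / 2), ∀ t : ℝ, 0 ≤ t →
      ‖deriv φ (x + t)‖ ≤ C * (R ^ 2 + t ^ 2)⁻¹ / (r / 4) := by
    intro x hx t ht
    have hsub : ∀ w ∈ Metric.closedBall (x + t) (r / 4), w - t ∈ outerHalfPlane R := by
      intro w hw
      apply hball
      rw [Metric.mem_closedBall, dist_eq_norm] at hw
      rw [Metric.mem_ball, dist_eq_norm] at hx ⊢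
      calc ‖w - t - z‖ = ‖(w - (x + t)) + (x - z)‖ := by congr 1; ring
        _ ≤ _ := norm_add_le _ _
        _ < r := by linarith
    refine Complex.norm_deriv_le_of_forall_mem_sphere_norm_le (by positivity) ?_ fun w hw => ?_
    · refine DifferentiableOn.diffContOnCl (hd.mono fun w hw => ?_)
      have := add_mem_outerHalfPlane (hsub w (Metric.closure_ball_subset_closedBall hw)) ht
      simpa using this
    · have hw' := hsub w (Metric.sphere_subset_closedBall hw)
      have h1 := hφ _ (add_mem_outerHalfPlane hw' ht)
      have h2 := norm_inv_pow_add_le hw' ht 0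
      rw [sub_add_cancel] at h1 h2
      refine h1.trans (mul_le_mul_of_nonneg_left (h2.trans ?_) hC)
      rw [pow_zero, one_mul]
      have := hw'.2.le
      gcongr
  have hbound_int : Integrable (fun t : ℝ => B * (C * (R ^ 2 + t ^ 2)⁻¹ / (r / 4)))
      (volume.restrict (Ioi 0)) :=
    (((integrableOn_inv_sq_add_sq hR0).const_mul C).div_const _).const_mul B
  have hmeas : ∀ x ∈ Metric.ball z (r / 2),
      AEStronglyMeasurable (fun t : ℝ => k t * φ (x + t)) (volume.restrict (Ioi 0)) := fun x hx =>
    (integrableOn_rayIntegral hk hkc hB hd hφ hC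
      (hball (Metric.ball_subset_ball (by linarith) hx))).aestronglyMeasurable
  have hdc : DifferentiableOn ℂ (deriv φ) (outerHalfPlane R) := hd.deriv (isOpen_outerHalfPlane R)
  have key := hasDerivAt_integral_of_dominated_loc_of_deriv_le
    (F := fun x (t : ℝ) => k t * φ (x + t)) (F' := fun x (t : ℝ) => k t * deriv φ (x + t))
    (μ := volume.restrict (Ioi (0 : ℝ))) (x₀ := z) (s := Metric.ball z (r / 2))
    (bound := fun t : ℝ => B * (C * (R ^ 2 + t ^ 2)⁻¹ / (r / 4)))
    (Metric.ball_mem_nhds z hr2)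
    (eventually_of_mem (Metric.ball_mem_nhds z hr2) hmeas)
    (integrableOn_rayIntegral hk hkc hB hd hφ hC hz)
    (((hkc.continuousOn.mul (continuousOn_comp_add hdc hz)).mono
      Ioi_subset_Ici_self).aestronglyMeasurable measurableSet_Ioi)
    ((ae_restrict_iff' measurableSet_Ioi).2 (Eventually.of_forall fun t ht x hx => by
      rw [norm_mul]
      gcongr
      · exact hk t
      · exact hcauchy x hx t (le_of_lt ht)))
    hbound_int
    ((ae_restrict_iff' measurableSet_Ioi).2 (Eventually.of_forall fun t ht x hx => by
      have h1 := hd' x hx t (le_of_lt ht)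
      have h2 : HasDerivAt (fun x : ℂ => x + (t : ℂ)) 1 x := (hasDerivAt_id' x).add_const _
      have h3 := HasDerivAt.comp x h1 h2
      simpa [Function.comp_def] using h3.const_mul (k t)))
  refine key.2.congr_deriv ?_
  have hk'int := integrableOn_rayIntegral hk' hk'c hB hd hφ hC hz
  have hibp := integral_Ioi_of_hasDerivAt_of_tendsto' (a := 0) (m := 0)
    (f := fun t : ℝ => k t * φ (z + t))
    (f' := fun t : ℝ => k' t * φ (z + t) + k t * deriv φ (z + t))
    (fun t ht => (hkd t).mul (hasDerivAt_comp_add (hd' z (Metric.mem_ball_self hr2) t ht)))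
    (hk'int.add key.1)
    (tendsto_mul_comp_add hk hB hC (fun w hw => (hφ w hw).trans (by
      have h0 := norm_inv_lt_one_of_mem_outerHalfPlane hR hw
      rw [pow_two]
      gcongr
      exact mul_le_of_le_one_left (by positivity) h0.le)) hz)
  rw [integral_add hk'int key.1] at hibp
  simp only [Complex.ofReal_zero, add_zero] at hibp
  rw [rayIntegral]
  linear_combination hibp

end rayIntegral

/-! ### The equation `A'' + 2ωA' = m A / z²` for `ω = ±i` -/

/-- The kernel `e^{2ωt}`. -/
noncomputable def expKernel (ω : ℂ) (t : ℝ) : ℂ := Complex.exp (2 * ω * t)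

/-- The kernel `(e^{2ωt} - 1) / (2ω)`, the primitive of `e^{2ωt}` vanishing at `0`. -/
noncomputable def waveKernel (ω : ℂ) (t : ℝ) : ℂ := (Complex.exp (2 * ω * t) - 1) / (2 * ω)

section kernels

variable {ω : ℂ}

lemma norm_eq_one_of_eq_I_or (hω : ω = Complex.I ∨ ω = -Complex.I) : ‖ω‖ = 1 := by
  rcases hω with rfl | rfl <;> simp

lemma ne_zero_of_eq_I_or (hω : ω = Complex.I ∨ ω = -Complex.I) : ω ≠ 0 := by
  rcases hω with rfl | rfl <;> simp

lemma sq_of_eq_I_or (hω : ω = Complex.I ∨ ω = -Complex.I) : ω ^ 2 = -1 := by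
  rcases hω with rfl | rfl <;> simp

lemma norm_expKernel (hω : ω = Complex.I ∨ ω = -Complex.I) (t : ℝ) : ‖expKernel ω t‖ = 1 := by
  rw [expKernel, Complex.norm_exp]
  rcases hω with rfl | rfl <;> simp

lemma norm_waveKernel_le (hω : ω = Complex.I ∨ ω = -Complex.I) (t : ℝ) : ‖waveKernel ω t‖ ≤ 1 := by
  have h1 : ‖Complex.exp (2 * ω * t)‖ = 1 := norm_expKernel hω t
  rw [waveKernel, norm_div, norm_mul, norm_eq_one_of_eq_I_or hω]
  have := norm_sub_le (Complex.exp (2 * ω * t)) 1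
  rw [h1, norm_one] at this
  rw [Complex.norm_ofNat, mul_one, div_le_one (by norm_num)]
  linarith

lemma hasDerivAt_expKernel (t : ℝ) : HasDerivAt (expKernel ω) (2 * ω * expKernel ω t) t := by
  have h1 : HasDerivAt (fun t : ℝ => 2 * ω * (t : ℂ)) (2 * ω) t := by
    simpa using (hasDerivAt_id' t).ofReal_comp.const_mul (2 * ω)
  exact h1.cexp.congr_deriv (by simp only [expKernel]; ring)

lemma hasDerivAt_waveKernel (hω : ω ≠ 0) (t : ℝ) :
    HasDerivAt (waveKernel ω) (expKernel ω t) t := by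
  refine (((hasDerivAt_expKernel (ω := ω) t).sub_const 1).div_const (2 * ω)).congr_deriv ?_
  field_simp

lemma continuous_expKernel : Continuous (expKernel ω) := by
  unfold expKernel; fun_prop

lemma continuous_waveKernel : Continuous (waveKernel ω) := by
  unfold waveKernel; fun_prop

end kernels

section inversion

open MeasureTheory Set

variable {ω : ℂ} {R C : ℝ} {φ : ℂ → ℂ} {z : ℂ}

lemma hasDerivAt_rayIntegral_waveKernel (hω : ω = Complex.I ∨ ω = -Complex.I) (hR : 1 ≤ R)
    (hd : DifferentiableOn ℂ φ (outerHalfPlane R))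
    (hφ : ∀ w ∈ outerHalfPlane R, ‖φ w‖ ≤ C * ‖w‖⁻¹ ^ 2) (hC : 0 ≤ C)
    (hz : z ∈ outerHalfPlane R) :
    HasDerivAt (rayIntegral (waveKernel ω) φ) (- rayIntegral (expKernel ω) φ z) z := by
  refine (hasDerivAt_rayIntegral hR (norm_waveKernel_le hω) zero_le_one
    (hasDerivAt_waveKernel (ne_zero_of_eq_I_or hω)) continuous_expKernel
    (fun t => (norm_expKernel hω t).le) hd hφ hC hz).congr_deriv ?_
  simp [waveKernel]

lemma hasDerivAt_rayIntegral_expKernel (hω : ω = Complex.I ∨ ω = -Complex.I) (hR : 1 ≤ R)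
    (hd : DifferentiableOn ℂ φ (outerHalfPlane R))
    (hφ : ∀ w ∈ outerHalfPlane R, ‖φ w‖ ≤ C * ‖w‖⁻¹ ^ 2) (hC : 0 ≤ C)
    (hz : z ∈ outerHalfPlane R) :
    HasDerivAt (rayIntegral (expKernel ω) φ)
      (- φ z - 2 * ω * rayIntegral (expKernel ω) φ z) z := by
  refine (hasDerivAt_rayIntegral hR (B := 2) (fun t => (norm_expKernel hω t).le.trans (by norm_num))
    zero_le_two hasDerivAt_expKernel (continuous_expKernel.const_mul _)
    (fun t => ?_) hd hφ hC hz).congr_deriv ?_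
  · rw [norm_mul, norm_mul, norm_expKernel hω, norm_eq_one_of_eq_I_or hω]
    simp
  · have : rayIntegral (fun t => 2 * ω * expKernel ω t) φ z =
        2 * ω * rayIntegral (expKernel ω) φ z := by
      simp only [rayIntegral, mul_assoc, integral_const_mul]
    rw [this]
    simp [expKernel]

/-- A decaying solution of `h'' + 2ωh' = φ` is a ray integral of `φ`, because
`K (h'' + 2ωh') = (K h' - h)'` for the kernel `K = waveKernel ω`. -/
lemma eq_rayIntegral_of_ode (hω : ω = Complex.I ∨ ω = -Complex.I) {h h' : ℂ → ℂ}
    (hh : ∀ z ∈ outerHalfPlane R, HasDerivAt h (h' z) z)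
    (hh' : ∀ z ∈ outerHalfPlane R, HasDerivAt h' (φ z - 2 * ω * h' z) z)
    {C₁ C₂ : ℝ} (hC₁ : 0 ≤ C₁) (hC₂ : 0 ≤ C₂)
    (hb : ∀ z ∈ outerHalfPlane R, ‖h z‖ ≤ C₁ * ‖z‖⁻¹)
    (hb' : ∀ z ∈ outerHalfPlane R, ‖h' z‖ ≤ C₂ * ‖z‖⁻¹)
    (hd : DifferentiableOn ℂ φ (outerHalfPlane R))
    (hφ : ∀ w ∈ outerHalfPlane R, ‖φ w‖ ≤ C * ‖w‖⁻¹ ^ 2) (hC : 0 ≤ C)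
    (hz : z ∈ outerHalfPlane R) :
    rayIntegral (waveKernel ω) φ z = h z ∧ rayIntegral (expKernel ω) φ z = - h' z := by
  have hω0 := ne_zero_of_eq_I_or hω
  have hmem : ∀ t ∈ Ici (0 : ℝ), z + (t : ℂ) ∈ outerHalfPlane R :=
    fun t ht => add_mem_outerHalfPlane hz ht
  have hE : ∀ t, ‖expKernel ω t‖ ≤ 1 := fun t => (norm_expKernel hω t).le
  constructor
  · have h1 := integral_Ioi_of_hasDerivAt_of_tendsto' (a := 0) (m := 0 - 0)
      (f := fun t : ℝ => waveKernel ω t * h' (z + t) - 1 * h (z + t))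
      (f' := fun t : ℝ => waveKernel ω t * φ (z + t))
      (fun t ht => (((hasDerivAt_waveKernel hω0 t).mul
        (hasDerivAt_comp_add (hh' _ (hmem t ht)))).sub
        ((hasDerivAt_comp_add (hh _ (hmem t ht))).const_mul 1)).congr_deriv (by
          simp only [expKernel, waveKernel]
          field_simp
          ring))
      (integrableOn_rayIntegral (norm_waveKernel_le hω) continuous_waveKernel zero_le_one hd hφ hC
        hz)
      ((tendsto_mul_comp_add (norm_waveKernel_le hω) zero_le_one hC₂ hb' hz).sub
        (tendsto_mul_comp_add (k := fun _ => 1) (B := 1) (by simp) zero_le_one hC₁ hb hz))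
    rw [rayIntegral, h1]
    simp [waveKernel]
  · have h1 := integral_Ioi_of_hasDerivAt_of_tendsto' (a := 0) (m := 0)
      (f := fun t : ℝ => expKernel ω t * h' (z + t))
      (f' := fun t : ℝ => expKernel ω t * φ (z + t))
      (fun t ht => ((hasDerivAt_expKernel t).mul
        (hasDerivAt_comp_add (hh' _ (hmem t ht)))).congr_deriv (by ring))
      (integrableOn_rayIntegral hE continuous_expKernel zero_le_one hd hφ hC hz)
      (tendsto_mul_comp_add hE zero_le_one hC₂ hb' hz)
    rw [rayIntegral, h1]
    simp [expKernel]

end inversion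

/-! ### Solution of the Volterra equation -/

/-- The successive corrections in the Volterra equation `A = 1 + m ∫₀^∞ K(t) A(z+t) / (z+t)² dt`. -/
noncomputable def volterraTerm (ω m : ℂ) : ℕ → ℂ → ℂ
  | 0, _ => 1
  | n + 1, z => m * rayIntegral (waveKernel ω) (fun w => volterraTerm ω m n w / w ^ 2) z

open MeasureTheory Set in
/-- The iteration converges because each step halves the bound: the ray integral contributes
`π/2 · ‖z‖⁻¹`, and `π ‖m‖ ≤ R ≤ ‖z‖`. -/
lemma exists_volterra {ω : ℂ} (hω : ω = Complex.I ∨ ω = -Complex.I) (m : ℂ) {R : ℝ} (hR : 1 ≤ R)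
    (hRm : Real.pi * ‖m‖ ≤ R) :
    ∃ A : ℂ → ℂ, DifferentiableOn ℂ A (outerHalfPlane R) ∧
      (∀ z ∈ outerHalfPlane R, ‖A z‖ ≤ 2) ∧
      ∀ z ∈ outerHalfPlane R, A z = 1 + m * rayIntegral (waveKernel ω) (fun w => A w / w ^ 2) z := by
  set δ := volterraTerm ω m with hδ
  have hne : ∀ w ∈ outerHalfPlane R, w ^ 2 ≠ 0 :=
    fun w hw => pow_ne_zero 2 (ne_zero_of_mem_outerHalfPlane hw)
  have hdiv : ∀ f : ℂ → ℂ, ∀ c : ℝ, (∀ z ∈ outerHalfPlane R, ‖f z‖ ≤ c) →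
      ∀ z ∈ outerHalfPlane R, ‖f z / z ^ 2‖ ≤ c * ‖z‖⁻¹ ^ 2 := fun f c hf z hz => by
    rw [norm_div, norm_pow, div_eq_mul_inv, inv_pow]
    exact mul_le_mul_of_nonneg_right (hf z hz) (by positivity)
  have hδ1 : ∀ n, DifferentiableOn ℂ (δ n) (outerHalfPlane R) ∧
      ∀ z ∈ outerHalfPlane R, ‖δ n z‖ ≤ (1 / 2) ^ n := by
    intro n
    induction n with
    | zero => exact ⟨differentiableOn_const 1, fun z _ => by simp [hδ, volterraTerm]⟩
    | succ n ih =>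
      have hd : DifferentiableOn ℂ (fun w => δ n w / w ^ 2) (outerHalfPlane R) :=
        ih.1.div (by fun_prop) hne
      have hb := hdiv _ _ ih.2
      refine ⟨fun z hz => ?_, fun z hz => ?_⟩
      · exact ((hasDerivAt_rayIntegral_waveKernel hω hR hd hb (by positivity)
          hz).const_mul m).differentiableAt.differentiableWithinAt
      · have h1 := norm_rayIntegral_le (m := 0) (norm_waveKernel_le hω) zero_le_one hb
          (by positivity) hz
        change ‖m * rayIntegral (waveKernel ω) (fun w => δ n w / w ^ 2) z‖ ≤ _
        rw [norm_mul]
        have h0 := norm_pos_of_mem_outerHalfPlane hz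
        have h2 : Real.pi * ‖m‖ * ‖z‖⁻¹ ≤ 1 := by
          rw [← div_eq_mul_inv, div_le_one h0]
          exact hRm.trans hz.2.le
        calc ‖m‖ * _ ≤ ‖m‖ * (1 * (1 / 2) ^ n * (Real.pi / 2) * ‖z‖⁻¹ ^ (0 + 1)) := by gcongr
          _ = (1 / 2) ^ (n + 1) * (Real.pi * ‖m‖ * ‖z‖⁻¹) := by ring
          _ ≤ (1 / 2) ^ (n + 1) * 1 := by gcongr
          _ = _ := mul_one _
  have hgeo : Summable fun n : ℕ => (1 / 2 : ℝ) ^ n := summable_geometric_two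
  have hsum : ∀ z ∈ outerHalfPlane R, Summable fun n => δ n z := fun z hz =>
    Summable.of_norm_bounded hgeo fun n => (hδ1 n).2 z hz
  refine ⟨fun z => ∑' n, δ n z, ?_, fun z hz => ?_, fun z hz => ?_⟩
  · exact Complex.differentiableOn_tsum_of_summable_norm hgeo (fun n => (hδ1 n).1)
      (isOpen_outerHalfPlane R) fun n w hw => (hδ1 n).2 w hw
  · have := tsum_of_norm_bounded hgeo.hasSum fun n => (hδ1 n).2 z hz
    rwa [tsum_geometric_two] at this
  · have hint : ∀ n, IntegrableOn (fun t : ℝ => waveKernel ω t * (δ n (z + t) / (z + t) ^ 2))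
        (Ioi 0) := fun n =>
      integrableOn_rayIntegral (φ := fun w => δ n w / w ^ 2) (norm_waveKernel_le hω)
        continuous_waveKernel zero_le_one
        ((hδ1 n).1.div (by fun_prop) hne) (hdiv _ _ (hδ1 n).2) (by positivity) hz
    have hI := integrableOn_inv_sq_add_sq (norm_pos_of_mem_outerHalfPlane hz)
    have hsI : Summable fun n => ∫ t in Ioi (0 : ℝ),
        ‖waveKernel ω t * (δ n (z + t) / (z + t) ^ 2)‖ := by
      refine Summable.of_nonneg_of_le (fun n => integral_nonneg fun t => norm_nonneg _)
        (fun n => ?_) (hgeo.mul_right (∫ t in Ioi (0 : ℝ), (‖z‖ ^ 2 + t ^ 2)⁻¹))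
      rw [← integral_const_mul]
      refine setIntegral_mono_on (hint n).norm (hI.const_mul _) measurableSet_Ioi fun t ht => ?_
      have := norm_mul_comp_add_le (m := 0) (norm_waveKernel_le hω) zero_le_one
        (hdiv _ _ (hδ1 n).2) (by positivity) hz (le_of_lt ht)
      simpa using this
    have h1 := hasSum_integral_of_summable_integral_norm hint hsI
    have h2 : rayIntegral (waveKernel ω) (fun w => (∑' n, δ n w) / w ^ 2) z =
        ∫ t in Ioi (0 : ℝ), ∑' n, waveKernel ω t * (δ n (z + t) / (z + t) ^ 2) := by
      rw [rayIntegral]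
      refine integral_congr_ae (Eventually.of_forall fun t => ?_)
      simp only [div_eq_mul_inv]
      rw [tsum_mul_left, tsum_mul_right]
    change ∑' n, δ n z = _
    rw [h2, ← h1.tsum_eq, (hsum z hz).tsum_eq_zero_add, ← tsum_mul_left]
    rfl

/-! ### Asymptotic expansion of the Volterra solution -/

/-- The coefficients of the formal solution `∑ α_k z^{-k}` of `A'' + 2ωA' = m A / z²`. -/
noncomputable def waveCoeff (ω m : ℂ) : ℕ → ℂ
  | 0 => 1
  | k + 1 => (k * (k + 1) - m) / (2 * ω * (k + 1)) * waveCoeff ω m k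

lemma waveCoeff_succ {ω : ℂ} (hω : ω ≠ 0) (m : ℂ) (k : ℕ) :
    2 * ω * (k + 1) * waveCoeff ω m (k + 1) = (k * (k + 1) - m) * waveCoeff ω m k := by
  have : (k : ℂ) + 1 ≠ 0 := by exact_mod_cast k.succ_ne_zero
  rw [waveCoeff]
  field_simp

lemma hasDerivAt_sum_inv_pow (α : ℕ → ℂ) (N : ℕ) {z : ℂ} (hz : z ≠ 0) :
    HasDerivAt (fun z : ℂ => ∑ k ∈ Finset.range N, α k * z⁻¹ ^ k)
      (∑ k ∈ Finset.range N, -(k * α k) * z⁻¹ ^ (k + 1)) z := by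
  refine HasDerivAt.fun_sum fun k _ => ?_
  have h1 : HasDerivAt (fun z : ℂ => z⁻¹ ^ k) (k * z⁻¹ ^ (k - 1) * -(z ^ 2)⁻¹) z :=
    (hasDerivAt_inv hz).pow k
  refine (h1.const_mul (α k)).congr_deriv ?_
  rcases k with _ | k
  · simp
  · rw [Nat.add_sub_cancel, ← inv_pow]
    ring

lemma hasDerivAt_sum_inv_pow_succ (α : ℕ → ℂ) (N : ℕ) {z : ℂ} (hz : z ≠ 0) :
    HasDerivAt (fun z : ℂ => ∑ k ∈ Finset.range N, -(k * α k) * z⁻¹ ^ (k + 1))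
      (∑ k ∈ Finset.range N, (k * (k + 1)) * α k * z⁻¹ ^ (k + 2)) z := by
  refine HasDerivAt.fun_sum fun k _ => ?_
  have h1 : HasDerivAt (fun z : ℂ => z⁻¹ ^ (k + 1)) ((k + 1 : ℕ) * z⁻¹ ^ (k + 1 - 1) * -(z ^ 2)⁻¹)
      z := (hasDerivAt_inv hz).pow (k + 1)
  refine (h1.const_mul (-(k * α k))).congr_deriv ?_
  rw [Nat.add_sub_cancel, ← inv_pow]
  push_cast
  ring

/-- A partial sum of the formal solution, with `x = 1/z`, satisfies the equation up to one term of
order `N + 2`. -/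
lemma waveCoeff_sum_ode {ω : ℂ} (hω : ω ≠ 0) (m x : ℂ) (N : ℕ) :
    ∑ k ∈ Finset.range (N + 1), (k * (k + 1)) * waveCoeff ω m k * x ^ (k + 2) =
      (m * (∑ k ∈ Finset.range (N + 1), waveCoeff ω m k * x ^ k) * x ^ 2 +
        (N * (N + 1) - m) * waveCoeff ω m N * x ^ (N + 2)) -
      2 * ω * ∑ k ∈ Finset.range (N + 1), -(k * waveCoeff ω m k) * x ^ (k + 1) := by
  induction N with
  | zero => simp
  | succ N ih =>
    rw [Finset.sum_range_succ, ih, Finset.sum_range_succ _ (N + 1), Finset.sum_range_succ _ (N + 1)]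
    have := waveCoeff_succ hω m N
    push_cast
    linear_combination -x ^ (N + 2) * this

lemma norm_sum_inv_pow_le (a : ℕ → ℂ) (N j : ℕ) {x : ℂ} (hx : ‖x‖ ≤ 1) :
    ‖∑ k ∈ Finset.range N, a k * x ^ (k + j)‖ ≤ (∑ k ∈ Finset.range N, ‖a k‖) * ‖x‖ ^ j := by
  rw [Finset.sum_mul]
  refine norm_sum_le_of_le _ fun k _ => ?_
  rw [norm_mul, norm_pow]
  exact mul_le_mul_of_nonneg_left (pow_le_pow_of_le_one (norm_nonneg _) hx (by omega))
    (norm_nonneg _)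

/-- A holomorphic solution of `A'' + 2ωA' = m A / z²` in the outer half-plane which, with its
derivative, has the formal solution as asymptotic expansion up to the imaginary axis.  The
difference to a partial sum of the formal solution solves a Volterra equation with a small
right-hand side; inserting an estimate of order `j` there produces one of order `j + 1`. -/
lemma exists_wave_solution {ω : ℂ} (hω : ω = Complex.I ∨ ω = -Complex.I) (m : ℂ) {R : ℝ}
    (hR : 1 ≤ R) (hRm : Real.pi * ‖m‖ ≤ R) :
    ∃ A A' : ℂ → ℂ, (∀ z ∈ outerHalfPlane R, HasDerivAt A (A' z) z) ∧
      (∀ z ∈ outerHalfPlane R, HasDerivAt A' (m * A z * z⁻¹ ^ 2 - 2 * ω * A' z) z) ∧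
      ∀ N : ℕ, ∃ C : ℝ, ∀ z ∈ outerHalfPlane R,
        ‖A z - ∑ k ∈ Finset.range (N + 1), waveCoeff ω m k * z⁻¹ ^ k‖ ≤ C * ‖z‖⁻¹ ^ (N + 1) ∧
        ‖A' z - ∑ k ∈ Finset.range (N + 1), -(k * waveCoeff ω m k) * z⁻¹ ^ (k + 1)‖ ≤
          C * ‖z‖⁻¹ ^ (N + 1) := by
  obtain ⟨A, hA, hA2, hAeq⟩ := exists_volterra hω m hR hRm
  have hω0 := ne_zero_of_eq_I_or hω
  have hne : ∀ w ∈ outerHalfPlane R, w ≠ 0 := fun w hw => ne_zero_of_mem_outerHalfPlane hw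
  have hx1 : ∀ w ∈ outerHalfPlane R, ‖w⁻¹‖ ≤ 1 := fun w hw => by
    rw [norm_inv]; exact (norm_inv_lt_one_of_mem_outerHalfPlane hR hw).le
  set ψ : ℂ → ℂ := fun w => A w / w ^ 2 with hψ
  have hψd : DifferentiableOn ℂ ψ (outerHalfPlane R) :=
    hA.div (by fun_prop) fun w hw => pow_ne_zero 2 (hne w hw)
  have hψb : ∀ w ∈ outerHalfPlane R, ‖ψ w‖ ≤ 2 * ‖w‖⁻¹ ^ 2 := fun w hw => by
    rw [hψ, norm_div, norm_pow, div_eq_mul_inv, inv_pow]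
    exact mul_le_mul_of_nonneg_right (hA2 w hw) (by positivity)
  have hA' : ∀ z ∈ outerHalfPlane R,
      HasDerivAt A (-(m * rayIntegral (expKernel ω) ψ z)) z := fun z hz => by
    have h1 := ((hasDerivAt_rayIntegral_waveKernel hω hR hψd hψb zero_le_two hz).const_mul m
      ).const_add 1
    refine (h1.congr_of_eventuallyEq (((isOpen_outerHalfPlane R).eventually_mem hz).mono
      fun w hw => hAeq w hw)).congr_deriv (by ring)
  refine ⟨A, fun z => -(m * rayIntegral (expKernel ω) ψ z), hA', fun z hz => ?_, fun N => ?_⟩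
  · refine ((hasDerivAt_rayIntegral_expKernel hω hR hψd hψb zero_le_two hz).const_mul m).neg
      |>.congr_deriv ?_
    simp only [hψ, inv_pow, div_eq_mul_inv]
    ring
  set α := waveCoeff ω m with hα
  set S : ℂ → ℂ := fun z => ∑ k ∈ Finset.range (N + 1), α k * z⁻¹ ^ k with hS
  set S' : ℂ → ℂ := fun z => ∑ k ∈ Finset.range (N + 1), -(k * α k) * z⁻¹ ^ (k + 1) with hS'
  set c : ℂ := (N * (N + 1) - m) * α N with hc
  set φ : ℂ → ℂ := fun z => m * S z * z⁻¹ ^ 2 + c * z⁻¹ ^ (N + 2) with hφ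
  set s : ℝ := ∑ k ∈ Finset.range (N + 1), ‖α k‖ with hs
  have hs0 : 0 ≤ s := Finset.sum_nonneg fun _ _ => norm_nonneg _
  have hSb : ∀ w ∈ outerHalfPlane R, ‖S w‖ ≤ s := fun w hw => by
    simpa only [add_zero, pow_zero, mul_one] using norm_sum_inv_pow_le α (N + 1) 0 (hx1 w hw)
  have hSd : DifferentiableOn ℂ S (outerHalfPlane R) := fun w hw =>
    (hasDerivAt_sum_inv_pow α (N + 1) (hne w hw)).differentiableAt.differentiableWithinAt
  have hinvd : ∀ j : ℕ, DifferentiableOn ℂ (fun z : ℂ => z⁻¹ ^ j) (outerHalfPlane R) := fun j =>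
    (differentiableOn_inv.mono fun w hw => hne w hw).pow j
  have hφd : DifferentiableOn ℂ φ (outerHalfPlane R) :=
    ((hSd.const_mul m).mul (hinvd 2)).add ((hinvd (N + 2)).const_mul c)
  have hcb : ∀ w ∈ outerHalfPlane R, ∀ j ≤ N, ‖c * w⁻¹ ^ (N + 2)‖ ≤ ‖c‖ * ‖w‖⁻¹ ^ (j + 2) :=
    fun w hw j hj => by
      rw [norm_mul, norm_pow, norm_inv]
      have := hx1 w hw
      rw [norm_inv] at this
      exact mul_le_mul_of_nonneg_left (pow_le_pow_of_le_one (by positivity) this (by omega))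
        (norm_nonneg _)
  have hφb : ∀ w ∈ outerHalfPlane R, ‖φ w‖ ≤ (‖m‖ * s + ‖c‖) * ‖w‖⁻¹ ^ 2 := fun w hw => by
    refine (norm_add_le _ _).trans ?_
    have h1 := hcb w hw 0 (Nat.zero_le _)
    have h2 : ‖m * S w * w⁻¹ ^ 2‖ ≤ ‖m‖ * s * ‖w‖⁻¹ ^ 2 := by
      rw [norm_mul, norm_mul, norm_pow, norm_inv]
      gcongr
      exact hSb w hw
    rw [zero_add] at h1
    linarith
  -- The partial sum, too, is a ray integral.
  have hSeq : ∀ z ∈ outerHalfPlane R, rayIntegral (waveKernel ω) φ z = S z - 1 ∧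
      rayIntegral (expKernel ω) φ z = - S' z := fun z hz =>
    eq_rayIntegral_of_ode hω (h := fun z => S z - 1) (h' := S')
      (C₁ := ∑ k ∈ Finset.range N, ‖α (k + 1)‖) (C₂ := ∑ k ∈ Finset.range (N + 1), ‖-(k * α k)‖)
      (C := ‖m‖ * s + ‖c‖)
      (fun z hz => (hasDerivAt_sum_inv_pow α (N + 1) (hne z hz)).sub_const 1)
      (fun z hz => (hasDerivAt_sum_inv_pow_succ α (N + 1) (hne z hz)).congr_deriv
        (waveCoeff_sum_ode hω0 m z⁻¹ N))
      (Finset.sum_nonneg fun _ _ => norm_nonneg _) (Finset.sum_nonneg fun _ _ => norm_nonneg _)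
      (fun z hz => by
        have h1 := norm_sum_inv_pow_le (fun k => α (k + 1)) N 1 (hx1 z hz)
        have h2 : S z - 1 = ∑ k ∈ Finset.range N, α (k + 1) * z⁻¹ ^ (k + 1) := by
          simp only [hS]
          rw [Finset.sum_range_succ']
          simp [hα, waveCoeff]
        rw [h2]
        simpa using h1)
      (fun z hz => by
        simpa only [pow_one, norm_inv] using
          norm_sum_inv_pow_le (fun k => -(k * α k)) (N + 1) 1 (hx1 z hz))
      hφd hφb (by positivity) hz
  set χ : ℂ → ℂ := fun z => m * (A z - S z) * z⁻¹ ^ 2 - c * z⁻¹ ^ (N + 2) with hχ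
  have hχeq : ∀ k : ℝ → ℂ, (∀ t, ‖k t‖ ≤ 1) → Continuous k → ∀ z ∈ outerHalfPlane R,
      rayIntegral k χ z = m * rayIntegral k ψ z - rayIntegral k φ z := by
    intro k hk hkc z hz
    have h1 := (integrableOn_rayIntegral hk hkc zero_le_one hψd hψb zero_le_two hz).const_mul m
    have h2 := integrableOn_rayIntegral hk hkc zero_le_one hφd hφb (by positivity) hz
    simp only [rayIntegral]
    rw [← MeasureTheory.integral_const_mul, ← MeasureTheory.integral_sub h1 h2]
    refine MeasureTheory.integral_congr_ae (Eventually.of_forall fun t => ?_)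
    simp only [hχ, hφ, hψ, inv_pow, div_eq_mul_inv]
    ring
  have hE : ∀ z ∈ outerHalfPlane R, A z - S z = rayIntegral (waveKernel ω) χ z := fun z hz => by
    rw [hχeq _ (norm_waveKernel_le hω) continuous_waveKernel z hz, (hSeq z hz).1, hAeq z hz]
    ring
  have hχb : ∀ j ≤ N, ∀ C : ℝ, (∀ z ∈ outerHalfPlane R, ‖A z - S z‖ ≤ C * ‖z‖⁻¹ ^ j) →
      ∀ z ∈ outerHalfPlane R, ‖χ z‖ ≤ (‖m‖ * |C| + ‖c‖) * ‖z‖⁻¹ ^ (j + 2) := by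
    intro j hj C hC z hz
    refine (norm_sub_le _ _).trans ?_
    have h1 := hcb z hz j hj
    have h2 : ‖m * (A z - S z) * z⁻¹ ^ 2‖ ≤ ‖m‖ * |C| * ‖z‖⁻¹ ^ (j + 2) := by
      rw [norm_mul, norm_mul, norm_pow, norm_inv]
      calc _ ≤ ‖m‖ * (|C| * ‖z‖⁻¹ ^ j) * ‖z‖⁻¹ ^ 2 := by
            gcongr
            exact (hC z hz).trans (by gcongr; exact le_abs_self C)
        _ = _ := by ring
    linarith
  have hEb : ∀ j ≤ N + 1, ∃ C : ℝ, ∀ z ∈ outerHalfPlane R, ‖A z - S z‖ ≤ C * ‖z‖⁻¹ ^ j := by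
    intro j
    induction j with
    | zero =>
      refine fun _ => ⟨2 + s, fun z hz => ?_⟩
      have := norm_sub_le (A z) (S z)
      have := hA2 z hz
      have := hSb z hz
      rw [pow_zero, mul_one]
      linarith
    | succ j ih =>
      intro hj
      obtain ⟨C, hC⟩ := ih (by omega)
      refine ⟨1 * (‖m‖ * |C| + ‖c‖) * (Real.pi / 2), fun z hz => ?_⟩
      rw [hE z hz]
      exact norm_rayIntegral_le (norm_waveKernel_le hω) zero_le_one (hχb j (by omega) C hC)
        (by positivity) hz
  obtain ⟨C₁, hC₁⟩ := hEb (N + 1) le_rfl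
  obtain ⟨C₂, hC₂⟩ := hEb N (by omega)
  have hEk : ∀ t, ‖expKernel ω t‖ ≤ 1 := fun t => (norm_expKernel hω t).le
  refine ⟨max C₁ (1 * (‖m‖ * |C₂| + ‖c‖) * (Real.pi / 2)), fun z hz => ⟨?_, ?_⟩⟩
  · exact (hC₁ z hz).trans (by gcongr; exact le_max_left _ _)
  · have h1 : -(m * rayIntegral (expKernel ω) ψ z) - S' z = -rayIntegral (expKernel ω) χ z := by
      rw [hχeq _ hEk continuous_expKernel z hz, (hSeq z hz).2]
      ring
    rw [h1, norm_neg]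
    exact (norm_rayIntegral_le hEk zero_le_one (hχb N le_rfl C₂ hC₂) (by positivity) hz).trans
      (by gcongr; exact le_max_right _ _)

/-! ### Formal power series in `1/z` -/

namespace PowerSeries

/-- The derivation `-X² d/dX`: differentiation with respect to `z` for `X = 1/z`. -/
noncomputable def invDeriv (F : PowerSeries ℂ) : PowerSeries ℂ := -(X ^ 2 * derivative ℂ F)

lemma coeff_zero_invDeriv (F : PowerSeries ℂ) : coeff 0 (invDeriv F) = 0 := by
  simp [invDeriv]

lemma coeff_succ_invDeriv (F : PowerSeries ℂ) (k : ℕ) :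
    coeff (k + 1) (invDeriv F) = -(k * coeff k F) := by
  rw [invDeriv, map_neg, pow_two, mul_assoc, coeff_succ_X_mul]
  rcases k with _ | k
  · simp
  · rw [coeff_succ_X_mul, coeff_derivative]
    push_cast
    ring

lemma invDeriv_add (F G : PowerSeries ℂ) : invDeriv (F + G) = invDeriv F + invDeriv G := by
  simp only [invDeriv, map_add]; ring

lemma invDeriv_sub (F G : PowerSeries ℂ) : invDeriv (F - G) = invDeriv F - invDeriv G := by
  simp only [invDeriv, map_sub]; ring

lemma invDeriv_C_mul (a : ℂ) (F : PowerSeries ℂ) : invDeriv (C a * F) = C a * invDeriv F := by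
  simp only [invDeriv, Derivation.leibniz, derivative_C, smul_eq_mul]; ring

lemma invDeriv_X_mul (F : PowerSeries ℂ) : invDeriv (X * F) = X * invDeriv F - X ^ 2 * F := by
  simp only [invDeriv, Derivation.leibniz, derivative_X, smul_eq_mul]; ring

lemma rescale_neg_one_invDeriv (F : PowerSeries ℂ) :
    rescale (-1) (invDeriv F) = - invDeriv (rescale (-1) F) := by
  ext n
  rcases n with _ | n
  · simp only [coeff_rescale, map_neg, coeff_zero_invDeriv]
    simp
  · simp only [coeff_rescale, map_neg, coeff_succ_invDeriv, pow_succ]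
    ring

/-- The logarithmic derivative with respect to `z` of a power series in `X = 1/z`. -/
noncomputable def invLogDeriv (F : PowerSeries ℂ) : PowerSeries ℂ := invDeriv F * F⁻¹

lemma rescale_neg_one_invLogDeriv {F : PowerSeries ℂ} (hF : coeff 0 F = 1) :
    rescale (-1) (invLogDeriv F) = - invLogDeriv (rescale (-1) F) := by
  have h1 : F * F⁻¹ = 1 := PowerSeries.mul_inv_cancel F (by
    rw [← coeff_zero_eq_constantCoeff_apply, hF]; exact one_ne_zero)
  have h2 : rescale (-1 : ℂ) F * rescale (-1) F⁻¹ = 1 := by rw [← map_mul, h1, map_one]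
  have h3 : rescale (-1 : ℂ) F * (rescale (-1) F)⁻¹ = 1 := PowerSeries.mul_inv_cancel _ (by
    rw [← coeff_zero_eq_constantCoeff_apply, coeff_rescale, hF]; simp)
  have h4 : rescale (-1 : ℂ) F⁻¹ = (rescale (-1) F)⁻¹ := by
    linear_combination (rescale (-1) F)⁻¹ * h2 - rescale (-1) F⁻¹ * h3
  rw [invLogDeriv, invLogDeriv, map_mul, rescale_neg_one_invDeriv, h4, neg_mul]

/-- The first coefficients of a logarithmic derivative. -/
lemma coeff_invLogDeriv {F : PowerSeries ℂ} (hF : coeff 0 F = 1) :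
    coeff 0 (invLogDeriv F) = 0 ∧ coeff 2 (invLogDeriv F) = - coeff 1 F ∧
    coeff 4 (invLogDeriv F) =
      -3 * coeff 3 F + 3 * coeff 2 F * coeff 1 F - coeff 1 F ^ 3 := by
  have h1 : F⁻¹ * F = 1 := PowerSeries.inv_mul_cancel F (by
    rw [← coeff_zero_eq_constantCoeff_apply, hF]; exact one_ne_zero)
  have h2 : invLogDeriv F * F = invDeriv F := by rw [invLogDeriv, mul_assoc, h1, mul_one]
  have hc : ∀ n, ∑ p ∈ Finset.HasAntidiagonal.antidiagonal n,
      coeff p.1 (invLogDeriv F) * coeff p.2 F = coeff n (invDeriv F) := fun n => by rw [← coeff_mul, h2]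
  have e0 := hc 0
  have e1 := hc 1
  have e2 := hc 2
  have e3 := hc 3
  have e4 := hc 4
  have hF' : constantCoeff F = 1 := by rw [← coeff_zero_eq_constantCoeff_apply, hF]
  simp only [Finset.Nat.antidiagonal_succ, Finset.Nat.antidiagonal_zero, Finset.sum_cons,
    Finset.map_singleton, Finset.sum_singleton, Finset.map_cons,
    coeff_zero_invDeriv, coeff_succ_invDeriv, zero_add, Nat.reduceAdd] at e0 e1 e2 e3 e4
  norm_num [hF'] at e0 e1 e2 e3 e4
  rw [coeff_zero_eq_constantCoeff_apply]
  simp only [e0, zero_mul, zero_add] at e1 e2 e3 e4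
  simp only [e1, zero_mul, zero_add] at e2 e3 e4
  have e3' : coeff 3 (invLogDeriv F) = -2 * coeff 2 F + coeff 1 F ^ 2 := by
    linear_combination e3 - coeff 1 F * e2
  refine ⟨e0, by linear_combination e2, ?_⟩
  linear_combination e4 - coeff 2 F * e2 - coeff 1 F * e3'

end PowerSeries

section phase

open PowerSeries

/-- The formal solution `∑ α_k X^k`, `X = 1/z`, of `A'' + 2ωA' = m A / z²`. -/
noncomputable def waveSeries (ω m : ℂ) : PowerSeries ℂ := mk (waveCoeff ω m)

lemma waveSeries_ode {ω : ℂ} (hω : ω ≠ 0) (m : ℂ) :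
    invDeriv (invDeriv (waveSeries ω m)) =
      C m * (X ^ 2 * waveSeries ω m) - C (2 * ω) * invDeriv (waveSeries ω m) := by
  ext n
  rcases n with _ | _ | n
  · simp only [map_sub, coeff_C_mul, coeff_zero_invDeriv]
    simp
  · simp only [map_sub, coeff_C_mul, coeff_zero_invDeriv, coeff_succ_invDeriv, pow_two, mul_assoc X,
      coeff_succ_X_mul]
    simp
  · simp only [map_sub, coeff_C_mul, coeff_succ_invDeriv, pow_two, mul_assoc X, coeff_succ_X_mul,
      waveSeries, coeff_mk]
    have := waveCoeff_succ hω m n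
    push_cast
    linear_combination -this

/-- The formal series `Â - ωÂ' + ωl Â/z`. -/
noncomputable def amplitudeSeries (ω m l : ℂ) : PowerSeries ℂ :=
  waveSeries ω m - C ω * invDeriv (waveSeries ω m) + C (ω * l) * (X * waveSeries ω m)

lemma coeff_amplitudeSeries_zero (ω m l : ℂ) : coeff 0 (amplitudeSeries ω m l) = 1 := by
  simp only [amplitudeSeries, map_sub, map_add, coeff_C_mul, coeff_zero_invDeriv]
  simp [waveSeries, waveCoeff]

lemma coeff_amplitudeSeries_succ (ω m l : ℂ) (k : ℕ) :
    coeff (k + 1) (amplitudeSeries ω m l) =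
      waveCoeff ω m (k + 1) + ω * (k + l) * waveCoeff ω m k := by
  simp only [amplitudeSeries, map_sub, map_add, coeff_C_mul, coeff_succ_invDeriv, coeff_succ_X_mul,
    waveSeries, coeff_mk]
  ring

lemma hankelA_succ (ν : ℝ) (k : ℕ) :
    hankelA ν (k + 1) = hankelA ν k * ((4 * ν ^ 2 - (2 * k + 1) ^ 2) / (8 * (k + 1))) := by
  have : (k.factorial : ℝ) ≠ 0 := by exact_mod_cast k.factorial_ne_zero
  rw [hankelA, hankelA, Finset.prod_range_succ, Nat.factorial_succ, pow_succ]
  push_cast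
  field_simp
  ring

lemma hankelB_succ (ν : ℝ) (k : ℕ) :
    hankelB ν (k + 1) = hankelA ν (k + 1) + (k + 1 / 2) * hankelA ν k := by
  have : (k.factorial : ℝ) ≠ 0 := by exact_mod_cast k.factorial_ne_zero
  rw [hankelA_succ, hankelB, hankelA, Nat.factorial_succ, pow_succ]
  push_cast
  field_simp
  ring

lemma waveCoeff_eq_hankelA {ω : ℂ} (hω : ω = Complex.I ∨ ω = -Complex.I) (ν : ℝ) (k : ℕ) :
    waveCoeff ω (ν ^ 2 - 1 / 4) k = ω ^ k * hankelA ν k := by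
  induction k with
  | zero => simp [waveCoeff, hankelA]
  | succ k ih =>
    have h2 := sq_of_eq_I_or hω
    have h0 := ne_zero_of_eq_I_or hω
    have : (k : ℂ) + 1 ≠ 0 := by exact_mod_cast k.succ_ne_zero
    have h3 : ((k : ℂ) * (k + 1) - (ν ^ 2 - 1 / 4)) / (2 * ω * (k + 1)) =
        ω * ((4 * ν ^ 2 - (2 * k + 1) ^ 2) / (8 * (k + 1))) := by
      field_simp
      rw [h2]
      ring
    rw [waveCoeff, ih, hankelA_succ, pow_succ ω, h3]
    push_cast
    ring

/-- The amplitude series of the oblique derivative has the coefficients `ω^k c_k`. -/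
lemma coeff_amplitudeSeries_eq_hankelC {ω : ℂ} (hω : ω = Complex.I ∨ ω = -Complex.I) (ν β : ℝ)
    (k : ℕ) :
    coeff (k + 1) (amplitudeSeries ω (ν ^ 2 - 1 / 4) (1 / 2 + Complex.I * β * ν)) =
      ω ^ (k + 1) * hankelC ν β (k + 1) := by
  rw [coeff_amplitudeSeries_succ, waveCoeff_eq_hankelA hω, waveCoeff_eq_hankelA hω, hankelC,
    hankelB_succ, Nat.add_sub_cancel]
  push_cast
  ring

/-- The two amplitude series are exchanged by `z ↦ -z`. -/
lemma rescale_amplitudeSeries (ν β : ℝ) :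
    rescale (-1) (amplitudeSeries Complex.I (ν ^ 2 - 1 / 4) (1 / 2 + Complex.I * β * ν)) =
      amplitudeSeries (-Complex.I) (ν ^ 2 - 1 / 4) (1 / 2 + Complex.I * β * ν) := by
  ext n
  rw [coeff_rescale]
  rcases n with _ | n
  · rw [coeff_amplitudeSeries_zero, coeff_amplitudeSeries_zero]; simp
  · rw [coeff_amplitudeSeries_eq_hankelC (Or.inl rfl), coeff_amplitudeSeries_eq_hankelC (Or.inr rfl),
      neg_pow Complex.I, mul_assoc]

/-- The formal derivative of the phase `θ = (log P₊ - log P₋) / (2i)`. -/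
noncomputable def phaseDerivSeries (ν β : ℝ) : PowerSeries ℂ :=
  C (2 * Complex.I)⁻¹ *
    (invLogDeriv (amplitudeSeries Complex.I (ν ^ 2 - 1 / 4) (1 / 2 + Complex.I * β * ν)) -
      invLogDeriv (amplitudeSeries (-Complex.I) (ν ^ 2 - 1 / 4) (1 / 2 + Complex.I * β * ν)))

/-- The phase is odd in `z`, because `P₋(z) = P₊(-z)` formally; its derivative is even. -/
lemma coeff_phaseDerivSeries_odd (ν β : ℝ) (j : ℕ) :
    coeff (2 * j + 1) (phaseDerivSeries ν β) = 0 := by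
  have h1 : rescale (-1) (phaseDerivSeries ν β) = phaseDerivSeries ν β := by
    have h0 := coeff_amplitudeSeries_zero
    rw [phaseDerivSeries, map_mul, map_sub, rescale_neg_one_invLogDeriv (h0 _ _ _),
      rescale_neg_one_invLogDeriv (h0 _ _ _), rescale_amplitudeSeries]
    have h2 : rescale (-1) (amplitudeSeries (-Complex.I) (ν ^ 2 - 1 / 4)
        (1 / 2 + Complex.I * β * ν)) =
        amplitudeSeries Complex.I (ν ^ 2 - 1 / 4) (1 / 2 + Complex.I * β * ν) := by
      rw [← rescale_amplitudeSeries, rescale_rescale]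
      simp
    have h3 : rescale (-1 : ℂ) (C (2 * Complex.I)⁻¹) = C (2 * Complex.I)⁻¹ := by
      ext n
      rw [coeff_rescale, coeff_C]
      split_ifs with hn <;> simp [hn]
    rw [h2, h3]
    ring
  have h2 := congrArg (coeff (2 * j + 1)) h1
  rw [coeff_rescale, pow_succ, pow_mul] at h2
  simp only [even_two, Even.neg_pow, one_pow, one_mul, neg_mul] at h2
  exact self_eq_neg.1 h2.symm

lemma coeff_phaseDerivSeries (ν β : ℝ) :
    coeff 0 (phaseDerivSeries ν β) = 0 ∧ coeff 2 (phaseDerivSeries ν β) = -hankelC ν β 1 ∧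
    coeff 4 (phaseDerivSeries ν β) =
      3 * hankelC ν β 3 - 3 * hankelC ν β 2 * hankelC ν β 1 + hankelC ν β 1 ^ 3 := by
  have hI2 := Complex.I_sq
  have hp := coeff_invLogDeriv (coeff_amplitudeSeries_zero Complex.I (ν ^ 2 - 1 / 4)
    (1 / 2 + Complex.I * β * ν))
  have hm := coeff_invLogDeriv (coeff_amplitudeSeries_zero (-Complex.I) (ν ^ 2 - 1 / 4)
    (1 / 2 + Complex.I * β * ν))
  have cp := fun k => coeff_amplitudeSeries_eq_hankelC (Or.inl rfl) ν β k (ω := Complex.I)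
  have cm := fun k => coeff_amplitudeSeries_eq_hankelC (Or.inr rfl) ν β k (ω := -Complex.I)
  rw [cp 0, cp 1, cp 2] at hp
  rw [cm 0, cm 1, cm 2] at hm
  simp only [phaseDerivSeries, coeff_C_mul, map_sub]
  have hinv : (2 * Complex.I)⁻¹ = -Complex.I / 2 := by
    rw [mul_inv, Complex.inv_I]; ring
  rw [hp.1, hp.2.1, hp.2.2, hm.1, hm.2.1, hm.2.2, hinv]
  refine ⟨by ring, ?_, ?_⟩
  · linear_combination hankelC ν β 1 * hI2
  · linear_combination (3 * hankelC ν β 3 - 3 * hankelC ν β 2 * hankelC ν β 1 +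
      hankelC ν β 1 ^ 3) * (Complex.I ^ 2 - 1) * hI2

/-! ### The amplitudes of the two travelling waves -/

/-- `f(z)` has the asymptotic expansion `F(1/z)` for `|z| → ∞`, uniformly in the open right
half-plane, up to the imaginary axis. -/
def HasInvExpansion (R : ℝ) (F : PowerSeries ℂ) (f : ℂ → ℂ) : Prop :=
  ∀ N, HasExpansion (fun z : outerHalfPlane R => (z : ℂ)⁻¹) N (fun _ => F) (fun z => f z)

namespace HasInvExpansion

variable {R R' : ℝ} {F G : PowerSeries ℂ} {f g : ℂ → ℂ}

lemma inv_ne_zero (z : outerHalfPlane R) : (z : ℂ)⁻¹ ≠ 0 :=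
  _root_.inv_ne_zero (ne_zero_of_mem_outerHalfPlane z.2)

lemma norm_inv_le_one (hR : 1 ≤ R) (z : outerHalfPlane R) : ‖(z : ℂ)⁻¹‖ ≤ 1 := by
  rw [norm_inv]; exact (norm_inv_lt_one_of_mem_outerHalfPlane hR z.2).le

lemma mono (h : HasInvExpansion R F f) (hR : R ≤ R') : HasInvExpansion R' F f := fun N =>
  (h N).reindex fun z : outerHalfPlane R' => ⟨z, outerHalfPlane_anti hR z.2⟩

lemma add (h : HasInvExpansion R F f) (h' : HasInvExpansion R G g) :
    HasInvExpansion R (F + G) (fun z => f z + g z) := fun N => (h N).add (h' N)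

lemma sub (hR : 1 ≤ R) (h : HasInvExpansion R F f) (h' : HasInvExpansion R G g) :
    HasInvExpansion R (F - G) (fun z => f z - g z) :=
  fun N => (h N).sub inv_ne_zero (norm_inv_le_one hR) (h' N)

lemma mul (hR : 1 ≤ R) (h : HasInvExpansion R F f) (h' : HasInvExpansion R G g) :
    HasInvExpansion R (F * G) (fun z => f z * g z) :=
  fun N => (h N).mul inv_ne_zero (norm_inv_le_one hR) (h' N)

lemma const_mul (hR : 1 ≤ R) (c : ℂ) (h : HasInvExpansion R F f) :
    HasInvExpansion R (C c * F) (fun z => c * f z) :=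
  fun N => (h N).const_mul inv_ne_zero (norm_inv_le_one hR) c

lemma inv_mul (hR : 1 ≤ R) (h : HasInvExpansion R F f) :
    HasInvExpansion R (X * F) (fun z => z⁻¹ * f z) :=
  fun N => ((h N).X_mul inv_ne_zero).of_succ inv_ne_zero (norm_inv_le_one hR)

lemma inv (hR : 1 ≤ R) (h : HasInvExpansion R F f) (hF : coeff 0 F = 1)
    (hf : ∀ z ∈ outerHalfPlane R, 1 / 2 ≤ ‖f z‖) :
    HasInvExpansion R F⁻¹ (fun z => (f z)⁻¹) :=
  fun N => (h N).inv inv_ne_zero (norm_inv_le_one hR) (fun _ => hF) fun z => hf z z.2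

lemma of_forall_succ (hR : 1 ≤ R) (h : ∀ N, ∃ B : ℝ, ∀ z ∈ outerHalfPlane R,
    ‖f z - ∑ k ∈ Finset.range (N + 1), coeff k F * z⁻¹ ^ k‖ ≤ B * ‖z‖⁻¹ ^ (N + 1)) :
    HasInvExpansion R F f := by
  intro N
  refine HasExpansion.of_succ inv_ne_zero (norm_inv_le_one hR) ?_
  refine HasExpansion.of_norm_sub_le inv_ne_zero (fun k _ => ⟨‖coeff k F‖, fun _ => le_rfl⟩) ?_
  obtain ⟨B, hB⟩ := h N
  exact ⟨B, fun z => by simpa only [norm_inv] using hB z z.2⟩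

lemma norm_sub_le (h : HasInvExpansion R F f) (N : ℕ) : ∃ B : ℝ, ∀ z ∈ outerHalfPlane R,
    ‖f z - ∑ k ∈ Finset.range N, coeff k F * z⁻¹ ^ k‖ ≤ B * ‖z‖⁻¹ ^ N := by
  obtain ⟨B, hB⟩ := (h N).norm_sub_le inv_ne_zero
  exact ⟨B, fun z hz => by simpa only [norm_inv] using hB ⟨z, hz⟩⟩

end HasInvExpansion

/-- The amplitude `P` in `f' - l f/z = ω e^{ωz} P` for the solution `f = e^{ωz} A` of
`f'' + (1 - m/z²) f = 0`. -/
lemma exists_amplitude {ω : ℂ} (hω : ω = Complex.I ∨ ω = -Complex.I) (m l : ℂ) :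
    ∃ R : ℝ, 1 ≤ R ∧ ∃ A A' P P' : ℂ → ℂ,
      (∀ z ∈ outerHalfPlane R, HasDerivAt A (A' z) z) ∧
      (∀ z ∈ outerHalfPlane R, HasDerivAt A' (m * A z * z⁻¹ ^ 2 - 2 * ω * A' z) z) ∧
      (∀ z, P z = A z - ω * A' z + ω * l * (z⁻¹ * A z)) ∧
      (∀ z ∈ outerHalfPlane R, HasDerivAt P (P' z) z) ∧
      (∀ z ∈ outerHalfPlane R, ‖A z - 1‖ ≤ 1 / 4 ∧ ‖A' z‖ ≤ 1 / 4 ∧ ‖P z - 1‖ ≤ 1 / 2) ∧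
      HasInvExpansion R (amplitudeSeries ω m l) P ∧
      HasInvExpansion R (invDeriv (amplitudeSeries ω m l)) P' := by
  have hω1 := norm_eq_one_of_eq_I_or hω
  have hω0 := ne_zero_of_eq_I_or hω
  have hω2 := sq_of_eq_I_or hω
  set R₀ : ℝ := max 1 (Real.pi * ‖m‖)
  obtain ⟨A, A', hA, hA', hexp⟩ := exists_wave_solution hω m (R := R₀) (le_max_left _ _)
    (le_max_right _ _)
  obtain ⟨K, hK⟩ := hexp 0
  set R : ℝ := max R₀ (8 * (|K| + ‖l‖ + 1)) with hR
  have hR₀ : R₀ ≤ R := le_max_left _ _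
  have hR1 : 1 ≤ R := (le_max_left _ _).trans hR₀
  have hR8 : 8 * (|K| + ‖l‖ + 1) ≤ R := le_max_right _ _
  have hsub := outerHalfPlane_anti hR₀
  have hne : ∀ z ∈ outerHalfPlane R, z ≠ 0 := fun z hz => ne_zero_of_mem_outerHalfPlane hz
  have hAe : HasInvExpansion R (waveSeries ω m) A := by
    refine HasInvExpansion.of_forall_succ hR1 fun N => ?_
    obtain ⟨B, hB⟩ := hexp N
    exact ⟨B, fun z hz => by simpa only [waveSeries, coeff_mk] using (hB z (hsub hz)).1⟩
  have hA'e : HasInvExpansion R (invDeriv (waveSeries ω m)) A' := by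
    refine HasInvExpansion.of_forall_succ hR1 fun N => ?_
    obtain ⟨B, hB⟩ := hexp N
    refine ⟨B + ‖N * waveCoeff ω m N‖, fun z hz => ?_⟩
    have h1 := (hB z (hsub hz)).2
    rw [Finset.sum_range_succ] at h1
    rw [Finset.sum_range_succ']
    simp only [coeff_zero_invDeriv, coeff_succ_invDeriv, waveSeries, coeff_mk, zero_mul, add_zero]
    have h2 := norm_add_le (A' z - (∑ k ∈ Finset.range N, -(k * waveCoeff ω m k) * z⁻¹ ^ (k + 1) +
      -(N * waveCoeff ω m N) * z⁻¹ ^ (N + 1))) (-(N * waveCoeff ω m N) * z⁻¹ ^ (N + 1))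
    rw [show A' z - (∑ k ∈ Finset.range N, -(k * waveCoeff ω m k) * z⁻¹ ^ (k + 1) +
      -(N * waveCoeff ω m N) * z⁻¹ ^ (N + 1)) + -(N * waveCoeff ω m N) * z⁻¹ ^ (N + 1) =
      A' z - ∑ k ∈ Finset.range N, -(k * waveCoeff ω m k) * z⁻¹ ^ (k + 1) by ring,
      norm_mul (-(N * waveCoeff ω m N)), norm_neg, norm_pow, norm_inv] at h2
    rw [add_mul]
    linarith
  refine ⟨R, hR1, A, A', fun z => A z - ω * A' z + ω * l * (z⁻¹ * A z),
    fun z => A' z - ω * (m * (z⁻¹ * (z⁻¹ * A z)) - 2 * ω * A' z) +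
      ω * l * (z⁻¹ * A' z - z⁻¹ * (z⁻¹ * A z)), fun z hz => hA z (hsub hz),
    fun z hz => hA' z (hsub hz), fun _ => rfl, fun z hz => ?_, fun z hz => ?_, ?_, ?_⟩
  · have h1 := hA z (hsub hz)
    have h2 := hA' z (hsub hz)
    refine ((h1.sub (h2.const_mul ω)).add (((hasDerivAt_inv (hne z hz)).mul h1).const_mul
      (ω * l))).congr_deriv ?_
    rw [← inv_pow]
    ring
  · obtain ⟨h1, h2⟩ := hK z (hsub hz)
    simp only [zero_add, Finset.range_one, Finset.sum_singleton, waveCoeff, pow_zero, mul_one,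
      pow_one, Nat.cast_zero, neg_zero, zero_mul, sub_zero] at h1 h2
    have hz0 := norm_pos_of_mem_outerHalfPlane hz
    have hKl : |K| * ‖z‖⁻¹ + ‖l‖ * ‖z‖⁻¹ ≤ 1 / 8 := by
      rw [← add_mul, ← div_eq_mul_inv, div_le_iff₀ hz0]
      have := hz.2
      linarith
    have hK1 : K * ‖z‖⁻¹ ≤ |K| * ‖z‖⁻¹ := by gcongr; exact le_abs_self K
    have hl0 : 0 ≤ ‖l‖ * ‖z‖⁻¹ := by positivity
    have hK0 : 0 ≤ |K| * ‖z‖⁻¹ := by positivity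
    have h3 : ‖A z - 1‖ ≤ 1 / 4 := by linarith
    refine ⟨h3, by linarith, ?_⟩
    have h4 : ‖A z‖ ≤ 5 / 4 := by
      have := norm_add_le (A z - 1) 1
      rw [sub_add_cancel, norm_one] at this
      linarith
    have h5 : ‖ω * l * (z⁻¹ * A z)‖ ≤ ‖l‖ * ‖z‖⁻¹ * (5 / 4) := by
      rw [norm_mul, norm_mul, norm_mul, hω1, one_mul, norm_inv, ← mul_assoc]
      gcongr
    have h6 : ‖ω * A' z‖ = ‖A' z‖ := by rw [norm_mul, hω1, one_mul]
    have h7 := norm_add_le (A z - 1 - ω * A' z) (ω * l * (z⁻¹ * A z))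
    have h8 := norm_sub_le (A z - 1) (ω * A' z)
    rw [show A z - ω * A' z + ω * l * (z⁻¹ * A z) - 1 =
      A z - 1 - ω * A' z + ω * l * (z⁻¹ * A z) by ring]
    linarith
  · exact (hAe.sub hR1 (hA'e.const_mul hR1 ω)).add ((hAe.inv_mul hR1).const_mul hR1 (ω * l))
  · -- The second derivative of `A` is expanded by means of the differential equation.
    have h1 : invDeriv (amplitudeSeries ω m l) = invDeriv (waveSeries ω m) -
        C ω * (C m * (X * (X * waveSeries ω m)) - C (2 * ω) * invDeriv (waveSeries ω m)) +
        C (ω * l) * (X * invDeriv (waveSeries ω m) - X * (X * waveSeries ω m)) := by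
      rw [amplitudeSeries, invDeriv_add, invDeriv_sub, invDeriv_C_mul, invDeriv_C_mul,
        invDeriv_X_mul, waveSeries_ode hω0]
      ring
    rw [h1]
    have hAxx := (hAe.inv_mul hR1).inv_mul hR1
    exact (hA'e.sub hR1 (((hAxx.const_mul hR1 m).sub hR1 (hA'e.const_mul hR1 (2 * ω))).const_mul
      hR1 ω)).add (((hA'e.inv_mul hR1).sub hR1 hAxx).const_mul hR1 (ω * l))

/-! ### Cross-products and the normal form of Bessel's equation -/

/-- `f` and `f'` form a solution of `f'' + (1 - m/z²) f = 0`, the normal form of Bessel's equation,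
in the outer half-plane. -/
def IsNormalSolution (m : ℂ) (R : ℝ) (f f' : ℂ → ℂ) : Prop :=
  ∀ z ∈ outerHalfPlane R, HasDerivAt f (f' z) z ∧ HasDerivAt f' (-(1 - m * z⁻¹ ^ 2) * f z) z

lemma mul_mem_outerHalfPlane {R : ℝ} {z : ℂ} (hz : z ∈ outerHalfPlane R) {t : ℝ} (ht : 1 ≤ t) :
    (t : ℂ) * z ∈ outerHalfPlane R := by
  have h0 := norm_pos_of_mem_outerHalfPlane hz
  refine ⟨?_, ?_⟩
  · rw [Complex.re_ofReal_mul]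
    exact mul_pos (by linarith) hz.1
  · rw [norm_mul, Complex.norm_real, Real.norm_of_nonneg (by linarith)]
    exact hz.2.trans_le (le_mul_of_one_le_left h0.le ht)

lemma hasDerivAt_comp_ofReal_mul {f : ℂ → ℂ} {f' z : ℂ} {t : ℝ} (h : HasDerivAt f f' (t * z)) :
    HasDerivAt (fun t : ℝ => f (t * z)) (f' * z) t := by
  have h1 : HasDerivAt (fun t : ℝ => (t : ℂ) * z) z t := by
    simpa using (hasDerivAt_id' t).ofReal_comp.mul_const z
  exact HasDerivAt.comp_of_eq t h h1 rfl

/-- The Wronskian of two solutions of the normal form is constant along rays from the origin. -/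
lemma IsNormalSolution.wronskian_mul {m : ℂ} {R : ℝ} {f f' g g' : ℂ → ℂ}
    (hf : IsNormalSolution m R f f') (hg : IsNormalSolution m R g g') {z : ℂ}
    (hz : z ∈ outerHalfPlane R) {κ : ℝ} (hκ : 1 ≤ κ) :
    f (κ * z) * g' (κ * z) - f' (κ * z) * g (κ * z) = f z * g' z - f' z * g z := by
  have hd : ∀ t : ℝ, 1 ≤ t → HasDerivAt (fun t : ℝ =>
      f (t * z) * g' (t * z) - f' (t * z) * g (t * z)) 0 t := fun t ht => by
    have hm := mul_mem_outerHalfPlane hz ht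
    obtain ⟨h1, h2⟩ := hf _ hm
    obtain ⟨h3, h4⟩ := hg _ hm
    refine (((hasDerivAt_comp_ofReal_mul h1).mul (hasDerivAt_comp_ofReal_mul h4)).sub
      ((hasDerivAt_comp_ofReal_mul h2).mul (hasDerivAt_comp_ofReal_mul h3))).congr_deriv ?_
    ring
  have h1 := constant_of_has_deriv_right_zero
    (fun t ht => (hd t ht.1).continuousAt.continuousWithinAt)
    (fun t ht => (hd t ht.1).hasDerivWithinAt) κ ⟨hκ, le_rfl⟩
  simpa using h1

lemma isNormalSolution_exp_mul {ω : ℂ} (hω : ω = Complex.I ∨ ω = -Complex.I) {m : ℂ} {R : ℝ}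
    {A A' : ℂ → ℂ} (hA : ∀ z ∈ outerHalfPlane R, HasDerivAt A (A' z) z)
    (hA' : ∀ z ∈ outerHalfPlane R, HasDerivAt A' (m * A z * z⁻¹ ^ 2 - 2 * ω * A' z) z) :
    IsNormalSolution m R (fun z => Complex.exp (ω * z) * A z)
      (fun z => Complex.exp (ω * z) * (ω * A z + A' z)) := by
  intro z hz
  have h0 : HasDerivAt (fun z : ℂ => Complex.exp (ω * z)) (Complex.exp (ω * z) * ω) z := by
    simpa using ((hasDerivAt_id' z).const_mul ω).cexp
  have h2 := sq_of_eq_I_or hω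
  refine ⟨(h0.mul (hA z hz)).congr_deriv (by ring),
    (h0.mul (((hA z hz).const_mul ω).add (hA' z hz))).congr_deriv ?_⟩
  simp only [Pi.add_apply]
  linear_combination Complex.exp (ω * z) * A z * h2

/-- Multiplication by `√z` turns Bessel functions into solutions of the normal form. -/
lemma IsBesselSolution.isNormalSolution {ν : ℂ} {f : ℂ → ℂ} (hf : IsBesselSolution ν f) (R : ℝ) :
    IsNormalSolution (ν ^ 2 - 1 / 4) R (fun z => z ^ (1 / 2 : ℂ) * f z)
      (fun z => z ^ (1 / 2 : ℂ) * (deriv f z + z⁻¹ * f z / 2)) := by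
  intro z hz
  have hz0 := ne_zero_of_mem_outerHalfPlane hz
  have h0 : HasDerivAt (fun z : ℂ => z ^ (1 / 2 : ℂ)) (z ^ (1 / 2 : ℂ) * (z⁻¹ / 2)) z := by
    refine ((hasDerivAt_id' z).cpow_const (Or.inl hz.1)).congr_deriv ?_
    rw [Complex.cpow_sub _ _ hz0, Complex.cpow_one]
    field_simp
  have h1 := hf.hasDerivAt hz.1
  have h2 := hf.hasDerivAt_deriv hz.1
  refine ⟨(h0.mul h1).congr_deriv (by ring),
    (h0.mul (h2.add (((hasDerivAt_inv hz0).mul h1).div_const 2))).congr_deriv ?_⟩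
  have h3 := hf.ode z hz.1
  have h4 : deriv (deriv f) z = -(z⁻¹ * deriv f z) - (1 - ν ^ 2 * z⁻¹ ^ 2) * f z := by
    field_simp
    linear_combination h3
  rw [h4, ← inv_pow]
  simp only [Pi.add_apply, Pi.mul_apply]
  ring

/-- Change of basis for a cross-product: two pairs of vectors, each taken at two points, with equal
Wronskians at both points have proportional cross-products for any boundary operator
`f' - μ f`. -/
lemma crossProduct_change_basis {J J' Y Y' u u' v v' J₂ J₂' Y₂ Y₂' u₂ u₂' v₂ v₂' μ μ₂ : ℂ}
    (hJY : J₂ * Y₂' - J₂' * Y₂ = J * Y' - J' * Y) (hJu : J₂ * u₂' - J₂' * u₂ = J * u' - J' * u)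
    (hJv : J₂ * v₂' - J₂' * v₂ = J * v' - J' * v) (hYu : Y₂ * u₂' - Y₂' * u₂ = Y * u' - Y' * u)
    (hYv : Y₂ * v₂' - Y₂' * v₂ = Y * v' - Y' * v) (hw : J * Y' - J' * Y ≠ 0) :
    (J * Y' - J' * Y) * ((u' - μ * u) * (v₂' - μ₂ * v₂) - (u₂' - μ₂ * u₂) * (v' - μ * v)) =
    (u * v' - u' * v) * ((J' - μ * J) * (Y₂' - μ₂ * Y₂) - (J₂' - μ₂ * J₂) * (Y' - μ * Y)) := by
  set w := J * Y' - J' * Y with hwdef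
  have e1 : w * (u' - μ * u) = -(Y * u' - Y' * u) * (J' - μ * J) + (J * u' - J' * u) * (Y' - μ * Y) := by
    rw [hwdef]; ring
  have e2 : w * (v' - μ * v) = -(Y * v' - Y' * v) * (J' - μ * J) + (J * v' - J' * v) * (Y' - μ * Y) := by
    rw [hwdef]; ring
  have e3 : w * (u₂' - μ₂ * u₂) =
      -(Y * u' - Y' * u) * (J₂' - μ₂ * J₂) + (J * u' - J' * u) * (Y₂' - μ₂ * Y₂) := by
    rw [← hJY, ← hYu, ← hJu]; ring
  have e4 : w * (v₂' - μ₂ * v₂) =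
      -(Y * v' - Y' * v) * (J₂' - μ₂ * J₂) + (J * v' - J' * v) * (Y₂' - μ₂ * Y₂) := by
    rw [← hJY, ← hYv, ← hJv]; ring
  have e5 : -(Y * u' - Y' * u) * (J * v' - J' * v) + (J * u' - J' * u) * (Y * v' - Y' * v) =
      w * (u * v' - u' * v) := by rw [hwdef]; ring
  apply mul_left_cancel₀ hw
  calc _ = (w * (u' - μ * u)) * (w * (v₂' - μ₂ * v₂)) -
        (w * (u₂' - μ₂ * u₂)) * (w * (v' - μ * v)) := by ring
    _ = (-(Y * u' - Y' * u) * (J * v' - J' * v) + (J * u' - J' * u) * (Y * v' - Y' * v)) *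
        ((J' - μ * J) * (Y₂' - μ₂ * Y₂) - (J₂' - μ₂ * J₂) * (Y' - μ * Y)) := by
      rw [e1, e2, e3, e4]; ring
    _ = _ := by rw [e5]; ring

/-- The cross-product vanishes exactly where that of two travelling waves does. -/
lemma obliqueG_eq_zero_iff {ν β : ℝ} (hν : 0 ≤ ν) {R : ℝ} {u u' v v' : ℂ → ℂ}
    (hu : IsNormalSolution (ν ^ 2 - 1 / 4) R u u') (hv : IsNormalSolution (ν ^ 2 - 1 / 4) R v v')
    (hW : ∀ z ∈ outerHalfPlane R, u z * v' z - u' z * v z ≠ 0) {κ : ℝ} (hκ : 1 < κ) {z : ℂ}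
    (hz : z ∈ outerHalfPlane R) :
    obliqueG ν β κ z = 0 ↔
      (u' z - (1 / 2 + Complex.I * β * ν) * z⁻¹ * u z) *
          (v' (κ * z) - (1 / 2 + Complex.I * β * ν) * (κ * z)⁻¹ * v (κ * z)) -
        (u' (κ * z) - (1 / 2 + Complex.I * β * ν) * (κ * z)⁻¹ * u (κ * z)) *
          (v' z - (1 / 2 + Complex.I * β * ν) * z⁻¹ * v z) = 0 := by
  obtain ⟨hJ, hY, hJY⟩ := besselJ_besselY_system hν
  have hJn := hJ.isNormalSolution R
  have hYn := hY.isNormalSolution R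
  have hz0 := ne_zero_of_mem_outerHalfPlane hz
  have hκz := mul_mem_outerHalfPlane hz hκ.le
  have hκz0 := ne_zero_of_mem_outerHalfPlane hκz
  have hκ0 : (κ : ℂ) ≠ 0 := by exact_mod_cast (by linarith : κ ≠ 0)
  have hs : z ^ (1 / 2 : ℂ) * z ^ (1 / 2 : ℂ) = z := by
    rw [← Complex.cpow_add _ _ hz0]; norm_num
  have hs0 : z ^ (1 / 2 : ℂ) ≠ 0 := fun h => hz0 (by rw [← hs, h, zero_mul])
  have hs0' : (κ * z) ^ (1 / 2 : ℂ) ≠ 0 := fun h => hκz0 (by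
    rw [Complex.cpow_eq_zero_iff] at h; exact h.1)
  have hw : (z ^ (1 / 2 : ℂ) * besselJ ν z) *
      (z ^ (1 / 2 : ℂ) * (deriv (besselY ν) z + z⁻¹ * besselY ν z / 2)) -
      (z ^ (1 / 2 : ℂ) * (deriv (besselJ ν) z + z⁻¹ * besselJ ν z / 2)) *
        (z ^ (1 / 2 : ℂ) * besselY ν z) ≠ 0 := by
    have h1 := hJY z hz.1
    have h2 : (2 / Real.pi : ℂ) ≠ 0 :=
      div_ne_zero two_ne_zero (by exact_mod_cast Real.pi_ne_zero)
    convert h2 using 1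
    rw [← h1]
    linear_combination (besselJ ν z * deriv (besselY ν) z - deriv (besselJ ν) z * besselY ν z) * hs
  have key := crossProduct_change_basis (μ := (1 / 2 + Complex.I * β * ν) * z⁻¹)
    (μ₂ := (1 / 2 + Complex.I * β * ν) * (κ * z)⁻¹)
    (hJn.wronskian_mul hYn hz hκ.le) (hJn.wronskian_mul hu hz hκ.le)
    (hJn.wronskian_mul hv hz hκ.le) (hYn.wronskian_mul hu hz hκ.le)
    (hYn.wronskian_mul hv hz hκ.le) hw
  have hg : obliqueG ν β κ z * (z ^ (1 / 2 : ℂ) * (κ * z) ^ (1 / 2 : ℂ)) =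
      (z ^ (1 / 2 : ℂ) * (deriv (besselJ ν) z + z⁻¹ * besselJ ν z / 2) -
        (1 / 2 + Complex.I * β * ν) * z⁻¹ * (z ^ (1 / 2 : ℂ) * besselJ ν z)) *
      ((κ * z) ^ (1 / 2 : ℂ) * (deriv (besselY ν) (κ * z) + (κ * z)⁻¹ * besselY ν (κ * z) / 2) -
        (1 / 2 + Complex.I * β * ν) * (κ * z)⁻¹ * ((κ * z) ^ (1 / 2 : ℂ) * besselY ν (κ * z))) -
      ((κ * z) ^ (1 / 2 : ℂ) * (deriv (besselJ ν) (κ * z) + (κ * z)⁻¹ * besselJ ν (κ * z) / 2) -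
        (1 / 2 + Complex.I * β * ν) * (κ * z)⁻¹ * ((κ * z) ^ (1 / 2 : ℂ) * besselJ ν (κ * z))) *
      (z ^ (1 / 2 : ℂ) * (deriv (besselY ν) z + z⁻¹ * besselY ν z / 2) -
        (1 / 2 + Complex.I * β * ν) * z⁻¹ * (z ^ (1 / 2 : ℂ) * besselY ν z)) := by
    simp only [obliqueG, besselG, iteratedDeriv_one, iteratedDeriv_zero]
    field_simp
    ring_nf
    simp only [Complex.I_sq]
    ring
  have hW' := hW z hz
  constructor
  · intro h
    rw [h, zero_mul] at hg
    rw [← hg, mul_zero] at key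
    exact (mul_eq_zero.1 key).resolve_left hw
  · intro h
    rw [h, mul_zero] at key
    rw [(mul_eq_zero.1 key.symm).resolve_left hW'] at hg
    exact (mul_eq_zero.1 hg).resolve_right (mul_ne_zero hs0 hs0')

/-! ### The phase function -/

/-- The coefficient of `z^{-(2j+1)}` in the phase `θ`. -/
noncomputable def phaseCoeff (ν β : ℝ) (j : ℕ) : ℂ :=
  -coeff (2 * j + 2) (phaseDerivSeries ν β) / (2 * j + 1)

lemma phaseCoeff_zero (ν β : ℝ) : phaseCoeff ν β 0 = hankelC ν β 1 := by
  simp [phaseCoeff, (coeff_phaseDerivSeries ν β).2.1]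

lemma phaseCoeff_one (ν β : ℝ) : phaseCoeff ν β 1 =
    -(hankelC ν β 1 ^ 3 / 3 + hankelC ν β 3 - hankelC ν β 2 * hankelC ν β 1) := by
  have := (coeff_phaseDerivSeries ν β).2.2
  simp only [phaseCoeff]
  norm_num
  rw [this]
  ring

lemma sum_coeff_phaseDerivSeries (ν β : ℝ) (x : ℂ) (N : ℕ) :
    ∑ k ∈ Finset.range (2 * N + 2), coeff k (phaseDerivSeries ν β) * x ^ k =
      ∑ j ∈ Finset.range N, -((2 * j + 1) * phaseCoeff ν β j) * x ^ (2 * j + 2) := by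
  induction N with
  | zero =>
    have h1 := coeff_phaseDerivSeries_odd ν β 0
    have h2 := (coeff_phaseDerivSeries ν β).1
    rw [mul_zero, zero_add] at h1
    rw [mul_zero, zero_add, Finset.sum_range_succ, Finset.sum_range_one, h1, h2]
    simp
  | succ N ih =>
    have h1 := coeff_phaseDerivSeries_odd ν β (N + 1)
    rw [show 2 * (N + 1) + 1 = 2 * N + 3 by ring] at h1
    rw [show 2 * (N + 1) + 2 = 2 * N + 2 + 1 + 1 by ring, Finset.sum_range_succ,
      Finset.sum_range_succ, ih, Finset.sum_range_succ, h1]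
    have h2 : (2 * (N : ℂ) + 1) ≠ 0 := by exact_mod_cast (2 * N).succ_ne_zero
    rw [phaseCoeff]
    field_simp
    ring

/-- The amplitudes stay in the disc of radius `1/2` around `1`, where the principal logarithm is
holomorphic. -/
lemma exp_log_of_norm_sub_one_le {p : ℂ} (hp : ‖p - 1‖ ≤ 1 / 2) :
    p ∈ Complex.slitPlane ∧ Complex.exp (Complex.log p) = p ∧ 1 / 2 ≤ ‖p‖ := by
  have h1 : 1 / 2 ≤ p.re := by
    have h2 := Complex.abs_re_le_norm (p - 1)
    rw [Complex.sub_re, Complex.one_re] at h2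
    linarith [neg_abs_le (p.re - 1)]
  refine ⟨Or.inl (by linarith), Complex.exp_log ?_, h1.trans (Complex.re_le_norm p)⟩
  rintro rfl
  norm_num at h1

/-- The phase function: for `κ > 1` the equation `g_ν(β, κ, z) = 0` says that
`(κ - 1) z + θ(κz) - θ(z)` is an integer multiple of `π`; the derivative of `θ` has an asymptotic
expansion in even powers of `1/z` up to the imaginary axis. -/
theorem exists_phase {ν : ℝ} (β : ℝ) (hν : 0 ≤ ν) :
    ∃ R : ℝ, 1 ≤ R ∧ ∃ θ Θ : ℂ → ℂ, (∀ z ∈ outerHalfPlane R, HasDerivAt θ (Θ z) z) ∧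
      (∀ N : ℕ, ∃ B : ℝ, ∀ z ∈ outerHalfPlane R,
        ‖Θ z - ∑ j ∈ Finset.range N, -((2 * j + 1) * phaseCoeff ν β j) * z⁻¹ ^ (2 * j + 2)‖ ≤
          B * ‖z‖⁻¹ ^ (2 * N + 2)) ∧
      ∀ κ : ℝ, 1 < κ → ∀ z ∈ outerHalfPlane R, obliqueG ν β κ z = 0 ↔
        ∃ n : ℤ, (κ - 1) * z + (θ (κ * z) - θ z) = n * Real.pi := by
  set m : ℂ := ν ^ 2 - 1 / 4 with hm
  set l : ℂ := 1 / 2 + Complex.I * β * ν with hl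
  obtain ⟨R₁, hR₁, A, A', P, P', hA, hA', hPA, hP, hb, hPe, hPe'⟩ :=
    exists_amplitude (Or.inl rfl) m l (ω := Complex.I)
  obtain ⟨R₂, hR₂, B, B', Q, Q', hB, hB', hQB, hQ, hb₂, hQe, hQe'⟩ :=
    exists_amplitude (Or.inr rfl) m l (ω := -Complex.I)
  set R := max R₁ R₂ with hR
  have hR1 : 1 ≤ R := hR₁.trans (le_max_left _ _)
  have hs₁ : outerHalfPlane R ⊆ outerHalfPlane R₁ := outerHalfPlane_anti (le_max_left _ _)
  have hs₂ : outerHalfPlane R ⊆ outerHalfPlane R₂ := outerHalfPlane_anti (le_max_right _ _)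
  replace hPe := hPe.mono (le_max_left R₁ R₂)
  replace hPe' := hPe'.mono (le_max_left R₁ R₂)
  replace hQe := hQe.mono (le_max_right R₁ R₂)
  replace hQe' := hQe'.mono (le_max_right R₁ R₂)
  have hPl := fun z (hz : z ∈ outerHalfPlane R) => exp_log_of_norm_sub_one_le (hb z (hs₁ hz)).2.2
  have hQl := fun z (hz : z ∈ outerHalfPlane R) => exp_log_of_norm_sub_one_le (hb₂ z (hs₂ hz)).2.2
  have hI := Complex.I_ne_zero
  have hI2 := Complex.I_sq
  refine ⟨R, hR1, fun z => (2 * Complex.I)⁻¹ * (Complex.log (P z) - Complex.log (Q z)),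
    fun z => (2 * Complex.I)⁻¹ * (P' z * (P z)⁻¹ - Q' z * (Q z)⁻¹), fun z hz => ?_, fun N => ?_, ?_⟩
  · have h1 := (hP z (hs₁ hz)).clog (hPl z hz).1
    have h2 := (hQ z (hs₂ hz)).clog (hQl z hz).1
    exact ((h1.sub h2).const_mul _).congr_deriv (by ring)
  · have h1 : HasInvExpansion R (phaseDerivSeries ν β)
        (fun z => (2 * Complex.I)⁻¹ * (P' z * (P z)⁻¹ - Q' z * (Q z)⁻¹)) :=
      ((hPe'.mul hR1 (hPe.inv hR1 (coeff_amplitudeSeries_zero _ _ _) fun z hz =>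
        (hPl z hz).2.2)).sub hR1 (hQe'.mul hR1 (hQe.inv hR1 (coeff_amplitudeSeries_zero _ _ _)
        fun z hz => (hQl z hz).2.2))).const_mul hR1 _
    obtain ⟨K, hK⟩ := h1.norm_sub_le (2 * N + 2)
    exact ⟨K, fun z hz => by rw [← sum_coeff_phaseDerivSeries]; exact hK z hz⟩
  · intro κ hκ z hz
    have hu := isNormalSolution_exp_mul (Or.inl rfl) (fun z hz => hA z (hs₁ hz))
      (fun z hz => hA' z (hs₁ hz))
    have hv := isNormalSolution_exp_mul (Or.inr rfl) (fun z hz => hB z (hs₂ hz))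
      (fun z hz => hB' z (hs₂ hz))
    have hee : ∀ z : ℂ, Complex.exp (Complex.I * z) * Complex.exp (-Complex.I * z) = 1 := fun z => by
      rw [← Complex.exp_add]; simp
    have hW : ∀ z ∈ outerHalfPlane R, Complex.exp (Complex.I * z) * A z *
        (Complex.exp (-Complex.I * z) * (-Complex.I * B z + B' z)) -
        Complex.exp (Complex.I * z) * (Complex.I * A z + A' z) *
          (Complex.exp (-Complex.I * z) * B z) ≠ 0 := by
      intro z hz h0
      obtain ⟨a1, a2, -⟩ := hb z (hs₁ hz)
      obtain ⟨b1, b2, -⟩ := hb₂ z (hs₂ hz)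
      have h1 : 2 * Complex.I = -2 * Complex.I * ((A z - 1) * (B z - 1) + (A z - 1) + (B z - 1)) +
          ((A z - 1) * B' z + B' z) - (A' z * (B z - 1) + A' z) := by
        linear_combination (-2 * Complex.I * (A z * B z) + A z * B' z - A' z * B z) * hee z - h0
      have h2 : (2 : ℝ) ≤ 2 * (1 / 4 * (1 / 4) + 1 / 4 + 1 / 4) + (1 / 4 * (1 / 4) + 1 / 4) +
          (1 / 4 * (1 / 4) + 1 / 4) := by
        calc (2 : ℝ) = ‖2 * Complex.I‖ := by simp
          _ ≤ _ := by
            rw [h1]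
            refine norm_sub_le_of_le (norm_add_le_of_le ?_ ?_) ?_
            · rw [norm_mul, norm_mul, norm_neg, Complex.norm_I, Complex.norm_ofNat, mul_one]
              refine mul_le_mul_of_nonneg_left ?_ zero_le_two
              refine norm_add_le_of_le (norm_add_le_of_le ?_ a1) b1
              rw [norm_mul]
              exact mul_le_mul a1 b1 (norm_nonneg _) (by norm_num)
            · refine norm_add_le_of_le ?_ b2
              rw [norm_mul]
              exact mul_le_mul a1 b2 (norm_nonneg _) (by norm_num)
            · refine norm_add_le_of_le ?_ a2
              rw [norm_mul]
              exact mul_le_mul a2 b1 (norm_nonneg _) (by norm_num)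
      norm_num at h2
    rw [obliqueG_eq_zero_iff hν hu hv hW hκ hz]
    have hκz := mul_mem_outerHalfPlane hz hκ.le
    have hPz := hPA z
    have hPκ := hPA (κ * z)
    have hQz := hQB z
    have hQκ := hQB (κ * z)
    have ep := (hPl z hz).2.1
    have epκ := (hPl _ hκz).2.1
    have eq := (hQl z hz).2.1
    have eqκ := (hQl _ hκz).2.1
    -- `f' - l f/z = ω e^{ωz} P`, and `i (-i) = 1`.
    have hMu : ∀ z, Complex.exp (Complex.I * z) * (Complex.I * A z + A' z) -
        l * z⁻¹ * (Complex.exp (Complex.I * z) * A z) =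
        Complex.I * (Complex.exp (Complex.I * z) * P z) := fun z => by
      rw [hPA]
      linear_combination (Complex.exp (Complex.I * z) * (A' z - l * (z⁻¹ * A z))) * hI2
    have hMv : ∀ z, Complex.exp (-Complex.I * z) * (-Complex.I * B z + B' z) -
        l * z⁻¹ * (Complex.exp (-Complex.I * z) * B z) =
        -Complex.I * (Complex.exp (-Complex.I * z) * Q z) := fun z => by
      rw [hQB]
      linear_combination (Complex.exp (-Complex.I * z) * (B' z - l * (z⁻¹ * B z))) * hI2
    simp only [← hl, hMu, hMv]
    rw [← ep, ← epκ, ← eq, ← eqκ]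
    simp only [← Complex.exp_add]
    rw [show ∀ a b c d : ℂ, Complex.I * Complex.exp a * (-Complex.I * Complex.exp b) -
      Complex.I * Complex.exp c * (-Complex.I * Complex.exp d) =
      Complex.exp (a + b) - Complex.exp (c + d) by
        intro a b c d
        rw [Complex.exp_add, Complex.exp_add]
        linear_combination (Complex.exp c * Complex.exp d - Complex.exp a * Complex.exp b) * hI2,
      sub_eq_zero, eq_comm, Complex.exp_eq_exp_iff_exists_int]
    refine exists_congr fun n => ?_
    rw [ep, epκ, eq, eqκ]
    constructor
    · intro h
      have h2 : (2 * Complex.I) ≠ 0 := mul_ne_zero two_ne_zero hI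
      apply mul_left_cancel₀ h2
      field_simp
      linear_combination h
    · intro h
      have h3 := congrArg (fun w => 2 * Complex.I * w) h
      field_simp at h3
      linear_combination h3

/-! ### The difference quotient of the phase -/

/-- The difference quotient `(θ(κz) - θ(z)) / (κ - 1)`. -/
noncomputable def phaseQuot (θ : ℂ → ℂ) (κ : ℝ) (z : ℂ) : ℂ := (θ (κ * z) - θ z) / (κ - 1)

/-- The coefficients of the difference quotient of a function with coefficients `t`. -/
noncomputable def quotCoeff (t : ℕ → ℂ) (κ : ℝ) (j : ℕ) : ℂ :=
  t j * (((κ : ℂ)⁻¹ ^ (2 * j + 1) - 1) / (κ - 1))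

lemma ofReal_sub_one_ne_zero {κ : ℝ} (hκ : 1 < κ) : (κ : ℂ) - 1 ≠ 0 := by
  exact_mod_cast (by linarith : κ - 1 ≠ 0)

lemma norm_quotCoeff_le (t : ℕ → ℂ) {κ : ℝ} (hκ : 1 < κ) (j : ℕ) :
    ‖quotCoeff t κ j‖ ≤ ‖t j‖ * (2 * j + 1) := by
  have hκ0 : 0 < κ := by linarith
  rw [quotCoeff, norm_mul]
  refine mul_le_mul_of_nonneg_left ?_ (norm_nonneg _)
  have h1 : ((κ : ℂ)⁻¹ ^ (2 * j + 1) - 1) / (κ - 1) =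
      (((κ⁻¹ ^ (2 * j + 1) - 1) / (κ - 1) : ℝ) : ℂ) := by push_cast; ring
  have h2 : κ⁻¹ ≤ 1 := inv_le_one_of_one_le₀ hκ.le
  have h3 : κ⁻¹ ^ (2 * j + 1) ≤ 1 := pow_le_one₀ (by positivity) h2
  have h4 := one_add_mul_le_pow (a := κ⁻¹ - 1) (by linarith [inv_pos.2 hκ0]) (2 * j + 1)
  have h5 : 1 - κ⁻¹ ≤ κ - 1 := by
    have : 1 - κ⁻¹ = κ⁻¹ * (κ - 1) := by field_simp
    rw [this]
    exact mul_le_of_le_one_left (by linarith) h2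
  rw [h1, Complex.norm_real, Real.norm_eq_abs, abs_div, abs_of_pos (by linarith : 0 < κ - 1),
    abs_of_nonpos (by linarith), div_le_iff₀ (by linarith)]
  rw [add_sub_cancel] at h4
  push_cast at h4
  have h6 : (2 * (j : ℝ) + 1) * (1 - κ⁻¹) ≤ (2 * j + 1) * (κ - 1) := by gcongr
  linarith

section phaseQuot

variable {R : ℝ} {θ Θ : ℂ → ℂ} {t : ℕ → ℂ}

/-- The difference quotient inherits the expansion of the derivative, with constants that do not
depend on `κ`. -/
lemma exists_phaseQuot_expansion (hθ : ∀ z ∈ outerHalfPlane R, HasDerivAt θ (Θ z) z)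
    {N : ℕ} (hΘ : ∃ B : ℝ, ∀ z ∈ outerHalfPlane R,
      ‖Θ z - ∑ j ∈ Finset.range N, -((2 * j + 1) * t j) * z⁻¹ ^ (2 * j + 2)‖ ≤
        B * ‖z‖⁻¹ ^ (2 * N + 2)) :
    ∃ B : ℝ, 0 ≤ B ∧ ∀ κ : ℝ, 1 < κ → ∀ z ∈ outerHalfPlane R,
      ‖phaseQuot θ κ z - ∑ j ∈ Finset.range N, quotCoeff t κ j * z⁻¹ ^ (2 * j + 1)‖ ≤
        B * ‖z‖⁻¹ ^ (2 * N + 1) := by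
  obtain ⟨B, hB⟩ := hΘ
  refine ⟨|B|, abs_nonneg _, fun κ hκ z hz => ?_⟩
  have hz0 := ne_zero_of_mem_outerHalfPlane hz
  have hnz := norm_pos_of_mem_outerHalfPlane hz
  have hκ1 := ofReal_sub_one_ne_zero hκ
  set S : ℂ → ℂ := fun z => ∑ j ∈ Finset.range N, t j * z⁻¹ ^ (2 * j + 1) with hS
  have hSd : ∀ z : ℂ, z ≠ 0 → HasDerivAt S
      (∑ j ∈ Finset.range N, -((2 * j + 1) * t j) * z⁻¹ ^ (2 * j + 2)) z := fun z hz => by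
    refine HasDerivAt.fun_sum fun j _ => ?_
    have h1 : HasDerivAt (fun z : ℂ => z⁻¹ ^ (2 * j + 1))
      ((2 * j + 1 : ℕ) * z⁻¹ ^ (2 * j + 1 - 1) * -(z ^ 2)⁻¹) z := (hasDerivAt_inv hz).pow (2 * j + 1)
    refine (h1.const_mul (t j)).congr_deriv ?_
    rw [Nat.add_sub_cancel, ← inv_pow]
    push_cast
    ring
  have hd : ∀ τ : ℝ, 1 ≤ τ → HasDerivAt (fun τ : ℝ => θ (τ * z) - S (τ * z))
      ((Θ (τ * z) - ∑ j ∈ Finset.range N, -((2 * j + 1) * t j) * (τ * z)⁻¹ ^ (2 * j + 2)) * z) τ :=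
    fun τ hτ => by
      have hm := mul_mem_outerHalfPlane hz hτ
      exact ((hasDerivAt_comp_ofReal_mul (hθ _ hm)).sub (hasDerivAt_comp_ofReal_mul
        (hSd _ (ne_zero_of_mem_outerHalfPlane hm)))).congr_deriv (by ring)
  have h1 := norm_image_sub_le_of_norm_deriv_right_le_segment (a := (1 : ℝ)) (b := κ)
    (C := |B| * ‖z‖⁻¹ ^ (2 * N + 1))
    (fun τ hτ => (hd τ hτ.1).continuousAt.continuousWithinAt)
    (fun τ hτ => (hd τ hτ.1).hasDerivWithinAt) (fun τ hτ => by
      have hm := mul_mem_outerHalfPlane hz hτ.1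
      rw [norm_mul]
      have h2 : ‖z‖ ≤ ‖(τ : ℂ) * z‖ := by
        rw [norm_mul, Complex.norm_real, Real.norm_of_nonneg (by linarith [hτ.1])]
        exact le_mul_of_one_le_left hnz.le hτ.1
      calc _ ≤ (|B| * ‖z‖⁻¹ ^ (2 * N + 2)) * ‖z‖ := by
            gcongr
            refine (hB _ hm).trans ?_
            gcongr
            exact le_abs_self B
        _ = |B| * ‖z‖⁻¹ ^ (2 * N + 1) := by
            rw [pow_succ _ (2 * N + 1)]
            field_simp) κ ⟨hκ.le, le_rfl⟩
  have h2 : phaseQuot θ κ z - ∑ j ∈ Finset.range N, quotCoeff t κ j * z⁻¹ ^ (2 * j + 1) =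
      ((θ (κ * z) - S (κ * z)) - (θ ((1 : ℝ) * z) - S ((1 : ℝ) * z))) / (κ - 1) := by
    have h3 : ∑ j ∈ Finset.range N, quotCoeff t κ j * z⁻¹ ^ (2 * j + 1) =
        (S (κ * z) - S z) / (κ - 1) := by
      rw [hS, ← Finset.sum_sub_distrib, Finset.sum_div]
      refine Finset.sum_congr rfl fun j _ => ?_
      rw [quotCoeff, mul_inv, mul_pow]
      ring
    rw [h3, phaseQuot, Complex.ofReal_one, one_mul]
    ring
  have h4 : ‖(κ : ℂ) - 1‖ = κ - 1 := by
    rw [show (κ : ℂ) - 1 = ((κ - 1 : ℝ) : ℂ) by push_cast; ring, Complex.norm_real,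
      Real.norm_of_nonneg (by linarith)]
  rw [h2, norm_div, h4, div_le_iff₀ (by linarith)]
  exact h1

lemma differentiableOn_phaseQuot (hθ : ∀ z ∈ outerHalfPlane R, HasDerivAt θ (Θ z) z)
    {κ : ℝ} (hκ : 1 < κ) : DifferentiableOn ℂ (phaseQuot θ κ) (outerHalfPlane R) := by
  intro z hz
  have h1 := hθ _ (mul_mem_outerHalfPlane hz hκ.le)
  have h2 : HasDerivAt (fun z : ℂ => (κ : ℂ) * z) κ z := by
    simpa using (hasDerivAt_id' z).const_mul (κ : ℂ)
  exact (((HasDerivAt.comp z h1 h2).sub (hθ z hz)).div_const _).differentiableAt.differentiableWithinAt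

/-! ### Solution of `z + ψ_κ(z) = α` -/

lemma closedBall_subset_outerHalfPlane {a r : ℝ} (hR : 0 ≤ R) (ha : R + r < a) :
    Metric.closedBall (a : ℂ) r ⊆ outerHalfPlane R := by
  intro w hw
  rw [Metric.mem_closedBall, dist_eq_norm] at hw
  have h1 : a - r ≤ w.re := by
    have h2 := (Complex.abs_re_le_norm (w - a)).trans hw
    rw [Complex.sub_re, Complex.ofReal_re] at h2
    linarith [(abs_le.1 h2).1]
  exact ⟨by linarith, by linarith [Complex.re_le_norm w]⟩

variable {B a : ℝ} {ψ : ℂ → ℂ}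

/-- The function `ψ` is a contraction near a point far out on the positive real axis. -/
lemma norm_sub_le_of_phase_bound (hR : 0 ≤ R) (hB : 0 ≤ B)
    (hd : DifferentiableOn ℂ ψ (outerHalfPlane R))
    (hψ : ∀ z ∈ outerHalfPlane R, ‖ψ z‖ ≤ B * ‖z‖⁻¹) (ha : R + 4 * B + 2 < a) {z w : ℂ}
    (hz : z ∈ Metric.closedBall (a : ℂ) 1) (hw : w ∈ Metric.closedBall (a : ℂ) 1) :
    ‖ψ z - ψ w‖ ≤ 1 / 4 * ‖z - w‖ := by
  have hsub : Metric.closedBall (a : ℂ) 2 ⊆ outerHalfPlane (R + 4 * B) :=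
    closedBall_subset_outerHalfPlane (by linarith) ha
  have hRB := outerHalfPlane_anti (by linarith : R ≤ R + 4 * B)
  have hbd : ∀ u ∈ Metric.closedBall (a : ℂ) 2, ‖ψ u‖ ≤ 1 / 4 := fun u hu => by
    have h1 := hsub hu
    have h2 := norm_pos_of_mem_outerHalfPlane h1
    refine (hψ u (hRB h1)).trans ?_
    rw [← div_eq_mul_inv, div_le_iff₀ h2]
    linarith [h1.2]
  have hin : ∀ u ∈ Metric.closedBall (a : ℂ) 1, Metric.closedBall u 1 ⊆ Metric.closedBall (a : ℂ) 2 :=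
    fun u hu => Metric.closedBall_subset_closedBall' (by
      rw [Metric.mem_closedBall] at hu; linarith)
  refine (convex_closedBall (a : ℂ) 1).norm_image_sub_le_of_norm_deriv_le (f := ψ)
    (fun u hu => hd.differentiableAt ((isOpen_outerHalfPlane R).mem_nhds
      (hRB (hsub (hin u hu (Metric.mem_closedBall_self zero_le_one)))))) (fun u hu => ?_) hw hz
  have := Complex.norm_deriv_le_of_forall_mem_sphere_norm_le (f := ψ) (c := u) zero_lt_one
    ((hd.mono fun v hv => hRB (hsub (hin u hu
      (Metric.closure_ball_subset_closedBall hv)))).diffContOnCl)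
    (fun v hv => hbd v (hin u hu (Metric.sphere_subset_closedBall hv)))
  simpa using this

/-- Existence by Banach's fixed point theorem for `z ↦ a - ψ(z)` on the unit disc around `a`. -/
lemma exists_phase_solution (hR : 0 ≤ R) (hB : 0 ≤ B)
    (hd : DifferentiableOn ℂ ψ (outerHalfPlane R))
    (hψ : ∀ z ∈ outerHalfPlane R, ‖ψ z‖ ≤ B * ‖z‖⁻¹) (ha : R + 4 * B + 2 < a) :
    ∃ z ∈ Metric.closedBall (a : ℂ) 1, z + ψ z = a := by
  have hsub : Metric.closedBall (a : ℂ) 1 ⊆ outerHalfPlane (R + 4 * B) :=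
    closedBall_subset_outerHalfPlane (by linarith) (by linarith)
  have hmaps : Set.MapsTo (fun z => (a : ℂ) - ψ z) (Metric.closedBall (a : ℂ) 1)
      (Metric.closedBall (a : ℂ) 1) := fun z hz => by
    have h1 := hsub hz
    have h2 := norm_pos_of_mem_outerHalfPlane h1
    have h3 := hψ z (outerHalfPlane_anti (by linarith : R ≤ R + 4 * B) h1)
    rw [Metric.mem_closedBall, dist_eq_norm, sub_sub_cancel_left, norm_neg]
    refine h3.trans ?_
    rw [← div_eq_mul_inv, div_le_iff₀ h2]
    linarith [h1.2]
  have hcontr : ContractingWith (1 / 4 : NNReal) (hmaps.restrict _ _ _) := by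
    refine ⟨by norm_num, LipschitzWith.of_dist_le_mul fun z w => ?_⟩
    have h1 := norm_sub_le_of_phase_bound hR hB hd hψ ha w.2 z.2
    rw [Subtype.dist_eq, Subtype.dist_eq, dist_eq_norm, dist_eq_norm]
    simp only [Set.MapsTo.val_restrict_apply]
    rw [sub_sub_sub_cancel_left, norm_sub_rev (z : ℂ)]
    simpa using h1
  obtain ⟨z, hz, hfix, -⟩ := hcontr.exists_fixedPoint' Metric.isClosed_closedBall.isComplete hmaps
    (Metric.mem_closedBall_self zero_le_one) (edist_ne_top _ _)
  refine ⟨z, hz, ?_⟩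
  have h1 : (a : ℂ) - ψ z = z := hfix
  linear_combination -h1

lemma phase_solution_unique (hR : 0 ≤ R) (hB : 0 ≤ B)
    (hd : DifferentiableOn ℂ ψ (outerHalfPlane R))
    (hψ : ∀ z ∈ outerHalfPlane R, ‖ψ z‖ ≤ B * ‖z‖⁻¹) (ha : R + 4 * B + 2 < a) {z w : ℂ}
    (hz : z ∈ Metric.closedBall (a : ℂ) 1) (hw : w ∈ Metric.closedBall (a : ℂ) 1)
    (hz' : z + ψ z = a) (hw' : w + ψ w = a) : z = w := by
  have h1 := norm_sub_le_of_phase_bound hR hB hd hψ ha hz hw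
  rw [show ψ z - ψ w = -(z - w) by linear_combination hz' - hw', norm_neg] at h1
  have h2 : ‖z - w‖ = 0 := le_antisymm (by linarith) (norm_nonneg _)
  exact sub_eq_zero.1 (norm_eq_zero.1 h2)

end phaseQuot

/-! ### Inversion of the expansion -/

/-- Iteration for the formal solution `W` of `W = -∑ e_j X^{j+1} (1 + W)^{-(2j+1)}`, which is the
equation `z + ∑ e_j z^{-(2j+1)} = α` in terms of `z = α (1 + W)` and `X = α^{-2}`. -/
noncomputable def inversionIter (e : ℕ → ℂ) : ℕ → PowerSeries ℂ
  | 0 => 0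
  | N + 1 => -∑ j ∈ Finset.range N, X ^ (j + 1) * (C (e j) * ((1 + inversionIter e N)⁻¹) ^ (2 * j + 1))

/-- The coefficients `d_j` of the inverted expansion `z = α + ∑ d_j α^{-(2j+1)}`. -/
noncomputable def inversionCoeff (e : ℕ → ℂ) (j : ℕ) : ℂ := coeff (j + 1) (inversionIter e (j + 2))

lemma coeff_zero_inversionIter (e : ℕ → ℂ) (N : ℕ) : coeff 0 (inversionIter e N) = 0 := by
  cases N with
  | zero => simp [inversionIter]
  | succ N =>
    rw [inversionIter, map_neg, map_sum, Finset.sum_eq_zero, neg_zero]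
    intro j _
    simp

lemma coeff_zero_one_add_inversionIter (e : ℕ → ℂ) (N : ℕ) :
    coeff 0 (1 + inversionIter e N) = 1 := by
  rw [map_add, coeff_zero_inversionIter]; simp

lemma PowerSeries.dvd_inv_sub_inv {F G D : PowerSeries ℂ} (hF : coeff 0 F = 1) (hG : coeff 0 G = 1)
    (h : D ∣ F - G) : D ∣ F⁻¹ - G⁻¹ := by
  have h1 : F * F⁻¹ = 1 := PowerSeries.mul_inv_cancel F (by
    rw [← coeff_zero_eq_constantCoeff_apply, hF]; exact one_ne_zero)
  have h2 : G * G⁻¹ = 1 := PowerSeries.mul_inv_cancel G (by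
    rw [← coeff_zero_eq_constantCoeff_apply, hG]; exact one_ne_zero)
  have h3 : F⁻¹ - G⁻¹ = (F - G) * (-(F⁻¹ * G⁻¹)) := by
    linear_combination G⁻¹ * h1 - F⁻¹ * h2
  rw [h3]
  exact h.mul_right _

/-- The iteration is a contraction for the `X`-adic topology. -/
lemma X_pow_dvd_inversionIter (e : ℕ → ℂ) (N : ℕ) :
    X ^ N ∣ inversionIter e (N + 1) - inversionIter e N := by
  induction N with
  | zero => simp
  | succ N ih =>
    have h1 : X ^ N ∣ (1 + inversionIter e (N + 1))⁻¹ - (1 + inversionIter e N)⁻¹ :=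
      dvd_inv_sub_inv (coeff_zero_one_add_inversionIter e _) (coeff_zero_one_add_inversionIter e _)
        (by simpa using ih)
    have h2 : inversionIter e (N + 1 + 1) - inversionIter e (N + 1) =
        -(X ^ (N + 1) * (C (e N) * ((1 + inversionIter e (N + 1))⁻¹) ^ (2 * N + 1))) -
        ∑ j ∈ Finset.range N, X ^ (j + 1) * (C (e j) *
          (((1 + inversionIter e (N + 1))⁻¹) ^ (2 * j + 1) -
            ((1 + inversionIter e N)⁻¹) ^ (2 * j + 1))) := by
      have h3 : inversionIter e (N + 1 + 1) = -∑ j ∈ Finset.range (N + 1), X ^ (j + 1) *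
        (C (e j) * ((1 + inversionIter e (N + 1))⁻¹) ^ (2 * j + 1)) := rfl
      have h4 : inversionIter e (N + 1) = -∑ j ∈ Finset.range N, X ^ (j + 1) *
        (C (e j) * ((1 + inversionIter e N)⁻¹) ^ (2 * j + 1)) := rfl
      rw [Finset.sum_range_succ] at h3
      simp only [mul_sub, Finset.sum_sub_distrib]
      linear_combination h3 - h4
    rw [h2]
    refine dvd_sub ((dvd_mul_right _ _).neg_right) (Finset.dvd_sum fun j _ => ?_)
    have h3 : X ^ N ∣ ((1 + inversionIter e (N + 1))⁻¹) ^ (2 * j + 1) -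
        ((1 + inversionIter e N)⁻¹) ^ (2 * j + 1) := h1.trans (sub_dvd_pow_sub_pow _ _ _)
    rw [show X ^ (N + 1) = X * (X : PowerSeries ℂ) ^ N by ring]
    exact mul_dvd_mul (dvd_pow_self X (by omega)) (h3.mul_left _)

lemma coeff_inversionIter (e : ℕ → ℂ) {j N : ℕ} (h : j + 2 ≤ N) :
    coeff (j + 1) (inversionIter e N) = inversionCoeff e j := by
  induction N, h using Nat.le_induction with
  | base => rfl
  | succ N hN ih =>
    have h1 := X_pow_dvd_iff.1 (X_pow_dvd_inversionIter e N) (j + 1) (by omega)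
    rw [map_sub, sub_eq_zero] at h1
    rw [h1, ih]

lemma inversionCoeff_zero (e : ℕ → ℂ) : inversionCoeff e 0 = -e 0 := by
  have h0 : inversionIter e 1 = 0 := by rw [inversionIter]; simp
  rw [inversionCoeff, inversionIter, h0]
  simp

lemma inversionCoeff_one (e : ℕ → ℂ) : inversionCoeff e 1 = -e 1 - e 0 ^ 2 := by
  have h1 : (1 + inversionIter e 2) * (1 + inversionIter e 2)⁻¹ = 1 :=
    PowerSeries.mul_inv_cancel _ (by
      rw [← coeff_zero_eq_constantCoeff_apply, coeff_zero_one_add_inversionIter]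
      exact one_ne_zero)
  have h2 : coeff 1 (inversionIter e 2) = -e 0 := inversionCoeff_zero e
  have hc : constantCoeff (inversionIter e 2) = 0 := by
    rw [← coeff_zero_eq_constantCoeff_apply, coeff_zero_inversionIter]
  have h3 := congrArg (coeff 1) h1
  rw [coeff_one_mul] at h3
  simp [h2, hc, coeff_one] at h3
  rw [inversionCoeff, inversionIter, map_neg, Finset.sum_range_succ, Finset.sum_range_one]
  have h4 : ∀ F : PowerSeries ℂ, coeff 2 (X ^ 2 * F) = coeff 0 F := fun F => by
    rw [pow_two, mul_assoc, coeff_succ_X_mul, coeff_succ_X_mul]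
  rw [zero_add, pow_one, mul_zero, zero_add, pow_one, map_add, coeff_succ_X_mul, h4, coeff_C_mul]
  simp [hc]
  linear_combination -e 0 * h3

/-- The solutions of `z + ψ(z) = α`, in a family in which `ψ` is expanded uniformly, have a uniform
expansion in `α^{-2}`. -/
lemma exists_inversion_expansion {ι : Type*} {α : ι → ℝ} {z p : ι → ℂ} {e : ι → ℕ → ℂ}
    (hα : ∀ i, 2 ≤ α i) (hz : ∀ i, ‖z i - α i‖ ≤ 1) (hzp : ∀ i, z i + p i = α i)
    (he : ∀ j, ∃ B : ℝ, ∀ i, ‖e i j‖ ≤ B)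
    (hp : ∀ N : ℕ, ∃ B : ℝ, 0 ≤ B ∧ ∀ i,
      ‖p i - ∑ j ∈ Finset.range N, e i j * (z i)⁻¹ ^ (2 * j + 1)‖ ≤ B * ‖z i‖⁻¹ ^ (2 * N + 1))
    (N : ℕ) :
    ∃ K : ℝ, ∀ i, ‖z i - ((α i : ℂ) + ∑ j ∈ Finset.range N, inversionCoeff (e i) j *
      ((α i : ℂ) ^ (2 * j + 1))⁻¹)‖ ≤ K * (α i ^ (2 * N + 1))⁻¹ := by
  set x : ι → ℂ := fun i => (α i : ℂ)⁻¹ ^ 2 with hx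
  set w : ι → ℂ := fun i => z i / α i - 1 with hw
  have hα0 : ∀ i, (0 : ℝ) < α i := fun i => by linarith [hα i]
  have hαc : ∀ i, (α i : ℂ) ≠ 0 := fun i => by exact_mod_cast (hα0 i).ne'
  have hαn : ∀ i, ‖(α i : ℂ)‖ = α i := fun i => by
    rw [Complex.norm_real, Real.norm_of_nonneg (hα0 i).le]
  have hx0 : ∀ i, x i ≠ 0 := fun i => pow_ne_zero 2 (inv_ne_zero (hαc i))
  have hxn : ∀ i, ‖x i‖ = (α i)⁻¹ ^ 2 := fun i => by rw [hx, norm_pow, norm_inv, hαn]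
  have hx1 : ∀ i, ‖x i‖ ≤ 1 := fun i => by
    rw [hxn]
    exact pow_le_one₀ (inv_nonneg.2 (hα0 i).le) (inv_le_one_of_one_le₀ (by linarith [hα i]))
  have hw2 : ∀ i, ‖w i‖ ≤ 1 / 2 := fun i => by
    have h1 : w i = (z i - α i) / α i := by
      have := hαc i
      simp only [hw]
      field_simp
    rw [h1, norm_div, hαn, div_le_iff₀ (hα0 i)]
    linarith [hz i, hα i]
  have hu2 : ∀ i, 1 / 2 ≤ ‖1 + w i‖ := fun i => by
    have h1 := norm_sub_le (1 + w i) (w i)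
    rw [add_sub_cancel_right, norm_one] at h1
    linarith [hw2 i]
  have hzw : ∀ i, z i = α i * (1 + w i) := fun i => by
    have := hαc i
    simp only [hw]
    field_simp
    ring
  have hzn : ∀ i, ‖z i‖⁻¹ ≤ 2 * (α i)⁻¹ := fun i => by
    rw [hzw, norm_mul, hαn, mul_inv, mul_comm]
    refine mul_le_mul_of_nonneg_right ?_ (inv_nonneg.2 (hα0 i).le)
    exact (inv_anti₀ (by norm_num) (hu2 i)).trans (by norm_num)
  have hexp : ∀ N, HasExpansion x N (fun i => inversionIter (e i) N) w := by
    intro N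
    induction N with
    | zero => exact ⟨1 / 2, hw2⟩
    | succ N ih =>
      have hone : HasExpansion x N (fun _ => (1 : PowerSeries ℂ)) (fun _ : ι => (1 : ℂ)) := by
        simpa using HasExpansion.const (x := x) N (c := fun _ => (1 : ℂ)) ⟨1, fun _ => by simp⟩
      have hu := (hone.add ih).inv hx0 hx1
        (fun i => coeff_zero_one_add_inversionIter (e i) N) hu2
      have hmono : ∀ (j : ℕ) {F : ι → PowerSeries ℂ} {f : ι → ℂ},
          HasExpansion x (N + (j + 1)) F f → HasExpansion x (N + 1) F f := by
        intro j
        induction j with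
        | zero => exact fun h => h
        | succ j ihj => exact fun h => ihj (HasExpansion.of_succ hx0 hx1 h)
      have hterm : ∀ j ∈ Finset.range N, HasExpansion x (N + 1)
          (fun i => X ^ (j + 1) * (C (e i j) * ((1 + inversionIter (e i) N)⁻¹) ^ (2 * j + 1)))
          (fun i => x i ^ (j + 1) * (e i j * ((1 + w i)⁻¹) ^ (2 * j + 1))) := fun j _ =>
        hmono j (((HasExpansion.const N (he j)).mul hx0 hx1 (hu.pow hx0 hx1 (2 * j + 1))).X_pow_mul
          hx0 (j + 1))
      have hsum := (HasExpansion.sum (Finset.range N) hterm).neg hx0 hx1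
      obtain ⟨B, hB0, hB⟩ := hp N
      -- The remainder is the error term of `p`, divided by `α`.
      have hrem : HasExpansion x (N + 1) (fun _ => 0) (fun i => w i +
          ∑ j ∈ Finset.range N, x i ^ (j + 1) * (e i j * ((1 + w i)⁻¹) ^ (2 * j + 1))) := by
        refine HasExpansion.of_norm_le hx0 ⟨B * 2 ^ (2 * N + 1), fun i => ?_⟩
        have h1 : w i + ∑ j ∈ Finset.range N, x i ^ (j + 1) *
            (e i j * ((1 + w i)⁻¹) ^ (2 * j + 1)) = -(α i : ℂ)⁻¹ *
            (p i - ∑ j ∈ Finset.range N, e i j * (z i)⁻¹ ^ (2 * j + 1)) := by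
          have h2 : p i = -(α i * w i) := by
            linear_combination hzp i - hzw i
          rw [mul_sub, h2, Finset.mul_sum, sub_eq_add_neg, ← Finset.sum_neg_distrib]
          congr 1
          · have := hαc i
            field_simp
          · refine Finset.sum_congr rfl fun j _ => ?_
            rw [hzw i, mul_inv, mul_pow, hx, ← pow_mul, show 2 * (j + 1) = 2 * j + 1 + 1 by ring]
            ring
        rw [h1, norm_mul, norm_neg, norm_inv, hαn, hxn]
        have hαi := (hα0 i).le
        calc _ ≤ (α i)⁻¹ * (B * (2 * (α i)⁻¹) ^ (2 * N + 1)) := by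
              gcongr
              exact (hB i).trans (by gcongr; exact hzn i)
          _ = _ := by ring
      refine (hrem.add hsum).congr (fun i => ?_) fun i => by ring
      rw [inversionIter, zero_add]
  obtain ⟨K, hK⟩ := (hexp (N + 1)).norm_sub_le hx0
  refine ⟨K, fun i => ?_⟩
  have h1 := hK i
  rw [Finset.sum_range_succ', coeff_zero_inversionIter, zero_mul, add_zero] at h1
  have h2 : z i - ((α i : ℂ) + ∑ j ∈ Finset.range N, inversionCoeff (e i) j *
      ((α i : ℂ) ^ (2 * j + 1))⁻¹) = α i * (w i -
      ∑ k ∈ Finset.range N, coeff (k + 1) (inversionIter (e i) (N + 1)) * x i ^ (k + 1)) := by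
    rw [mul_sub, Finset.mul_sum, hzw i]
    have h3 : ∑ j ∈ Finset.range N, inversionCoeff (e i) j * ((α i : ℂ) ^ (2 * j + 1))⁻¹ =
        ∑ k ∈ Finset.range N, (α i : ℂ) *
          (coeff (k + 1) (inversionIter (e i) (N + 1)) * x i ^ (k + 1)) := by
      refine Finset.sum_congr rfl fun j hj => ?_
      rw [coeff_inversionIter _ (by have := Finset.mem_range.1 hj; omega), hx, ← pow_mul,
        show 2 * (j + 1) = 2 * j + 1 + 1 by ring, pow_succ (α i : ℂ)⁻¹, inv_pow]
      have := hαc i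
      field_simp
    rw [h3]
    ring
  rw [h2, norm_mul, hαn]
  calc _ ≤ α i * (K * ‖x i‖ ^ (N + 1)) := mul_le_mul_of_nonneg_left h1 (hα0 i).le
    _ = _ := by
      have := (hα0 i).ne'
      rw [hxn, ← pow_mul, show 2 * (N + 1) = 2 * N + 1 + 1 by ring, pow_succ (α i)⁻¹, inv_pow]
      field_simp

end phase

/-! ### The zeros of the cross-product -/

lemma inversionCoeff_quotCoeff_zero (ν β : ℝ) {κ : ℝ} (hκ : 1 < κ) :
    inversionCoeff (quotCoeff (phaseCoeff ν β) κ) 0 = mcMahonP ν β κ := by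
  have h1 := ofReal_sub_one_ne_zero hκ
  have h2 : (κ : ℂ) ≠ 0 := by exact_mod_cast (by linarith : κ ≠ 0)
  rw [inversionCoeff_zero, quotCoeff, phaseCoeff_zero, mcMahonP]
  simp only [mul_zero, zero_add, pow_one]
  field_simp
  ring

lemma inversionCoeff_quotCoeff_one (ν β : ℝ) {κ : ℝ} (hκ : 1 < κ) :
    inversionCoeff (quotCoeff (phaseCoeff ν β) κ) 1 = mcMahonQ ν β κ - mcMahonP ν β κ ^ 2 := by
  have h1 := ofReal_sub_one_ne_zero hκ
  have h2 : (κ : ℂ) ≠ 0 := by exact_mod_cast (by linarith : κ ≠ 0)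
  have h0 := inversionCoeff_quotCoeff_zero ν β hκ
  rw [inversionCoeff_zero] at h0
  have h3 : -quotCoeff (phaseCoeff ν β) κ 1 = mcMahonQ ν β κ := by
    rw [quotCoeff, phaseCoeff_one, mcMahonQ]
    norm_num
    field_simp
    ring
  rw [inversionCoeff_one, h3, ← h0]
  ring

lemma mcMahon_of_beta_eq_zero (ν : ℝ) {κ : ℝ} (hκ : 1 < κ) :
    (∀ w : ℂ, obliqueG ν 0 κ w = besselG ν 1 1 κ w) ∧
      mcMahonP ν 0 κ = (((4 * ν ^ 2 + 3) / (8 * κ) : ℝ) : ℂ) ∧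
      mcMahonQ ν 0 κ = (((κ ^ 3 - 1) * (16 * ν ^ 4 + 184 * ν ^ 2 - 63) /
        (384 * κ ^ 3 * (κ - 1)) : ℝ) : ℂ) := by
  have h1 := ofReal_sub_one_ne_zero hκ
  have h2 : (κ : ℂ) ≠ 0 := by exact_mod_cast (by linarith : κ ≠ 0)
  refine ⟨fun w => by simp [obliqueG], ?_, ?_⟩
  · simp only [mcMahonP, hankelC, hankelB]
    push_cast
    field_simp
    norm_num
    ring
  · simp only [mcMahonQ, hankelC, hankelB, Finset.prod_range_succ, Finset.prod_range_zero]
    norm_num [Nat.factorial]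
    field_simp
    ring

theorem mainTheorem2 (ν β : ℝ) (hν : 0 ≤ ν) :
    (∃ (κ₀ R : ℝ) (z : ℕ → ℝ → ℂ) (d : ℕ → ℝ → ℂ), 1 < κ₀ ∧ 0 < R ∧
      -- for `κ` close to `1`, the large zeros in the right half-plane are exactly the `z_s(κ)`, `s ≥ 1`
      (∀ κ ∈ Set.Ioo 1 κ₀, Set.BijOn (fun s : ℕ => z s κ) (Set.Ici 1)
        {w : ℂ | 0 < w.re ∧ R < ‖w‖ ∧ obliqueG ν β κ w = 0}) ∧
      -- each of them diverges as `κ → 1+`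
      (∀ s : ℕ, 1 ≤ s → Tendsto (fun κ : ℝ => ‖z s κ‖) (𝓝[>] 1) atTop) ∧
      -- the first two coefficients of the expansion
      (∀ κ ∈ Set.Ioo 1 κ₀, d 0 κ = mcMahonP ν β κ ∧
        d 1 κ = mcMahonQ ν β κ - mcMahonP ν β κ ^ 2) ∧
      -- the asymptotic expansion in odd negative powers of `α = sπ/(κ-1)`, to every order
      (∀ N : ℕ, ∃ C : ℝ, ∀ κ ∈ Set.Ioo 1 κ₀, ∀ s : ℕ, 1 ≤ s →
        ‖z s κ - ((mcMahonAlpha s κ : ℂ) +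
            ∑ j ∈ Finset.range N, d j κ * ((mcMahonAlpha s κ : ℂ) ^ (2 * j + 1))⁻¹)‖
          ≤ C * (mcMahonAlpha s κ ^ (2 * N + 1))⁻¹)) ∧
    -- the case `β = 0`
    (β = 0 → ∀ κ : ℝ, 1 < κ →
      (∀ w : ℂ, obliqueG ν β κ w = besselG ν 1 1 κ w) ∧
      mcMahonP ν β κ = (((4 * ν ^ 2 + 3) / (8 * κ) : ℝ) : ℂ) ∧
      mcMahonQ ν β κ = (((κ ^ 3 - 1) * (16 * ν ^ 4 + 184 * ν ^ 2 - 63) /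
        (384 * κ ^ 3 * (κ - 1)) : ℝ) : ℂ)) := by
  refine ⟨?_, fun h κ hκ => by subst h; exact mcMahon_of_beta_eq_zero ν hκ⟩
  obtain ⟨R₀, hR₀, θ, Θ, hθ, hΘ, hzero⟩ := exists_phase β hν
  have hR₀0 : 0 ≤ R₀ := by linarith
  obtain ⟨B, hB0, hB⟩ := exists_phaseQuot_expansion (t := phaseCoeff ν β) hθ (hΘ 0)
  set ψ := phaseQuot θ with hψ
  have hψB : ∀ κ : ℝ, 1 < κ → ∀ z ∈ outerHalfPlane R₀, ‖ψ κ z‖ ≤ B * ‖z‖⁻¹ := fun κ hκ z hz => by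
    simpa using hB κ hκ z hz
  have hψd : ∀ κ : ℝ, 1 < κ → DifferentiableOn ℂ (ψ κ) (outerHalfPlane R₀) :=
    fun κ hκ => differentiableOn_phaseQuot hθ hκ
  -- Beyond `R` the quotient `ψ κ` is at most `1 / 4`; the bound `κ₀` makes every `sπ / (κ - 1)`
  -- larger than `R + 2`.
  set R : ℝ := R₀ + 4 * B + 1 with hR
  have hRR : R₀ ≤ R := by linarith
  set κ₀ : ℝ := 1 + Real.pi / (R + 2) with hκ₀
  have hpi := Real.pi_pos
  have hR2 : 0 < R + 2 := by linarith
  have hα : ∀ κ ∈ Set.Ioo 1 κ₀, ∀ s : ℕ, 1 ≤ s → R + 2 < mcMahonAlpha s κ := by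
    intro κ hκ s hs
    have h1 : 0 < κ - 1 := by linarith [hκ.1]
    have h2 : κ - 1 < Real.pi / (R + 2) := by linarith [hκ.2]
    have h3 : (1 : ℝ) ≤ s := by exact_mod_cast hs
    rw [lt_div_iff₀ hR2] at h2
    rw [mcMahonAlpha, lt_div_iff₀ h1]
    nlinarith
  have hex : ∀ (s : ℕ) (κ : ℝ), ∃ z : ℂ, κ ∈ Set.Ioo 1 κ₀ → 1 ≤ s →
      z ∈ Metric.closedBall (mcMahonAlpha s κ : ℂ) 1 ∧ z + ψ κ z = mcMahonAlpha s κ := by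
    intro s κ
    by_cases h : κ ∈ Set.Ioo 1 κ₀ ∧ 1 ≤ s
    · obtain ⟨z, hz1, hz2⟩ := exists_phase_solution (a := mcMahonAlpha s κ) hR₀0 hB0
        (hψd κ h.1.1) (hψB κ h.1.1) (by linarith [hα κ h.1 s h.2])
      exact ⟨z, fun _ _ => ⟨hz1, hz2⟩⟩
    · exact ⟨0, fun h1 h2 => absurd ⟨h1, h2⟩ h⟩
  choose z hz using hex
  have hzmem : ∀ κ ∈ Set.Ioo 1 κ₀, ∀ s : ℕ, 1 ≤ s → z s κ ∈ outerHalfPlane R :=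
    fun κ hκ s hs => closedBall_subset_outerHalfPlane (by linarith)
      (by linarith [hα κ hκ s hs]) (hz s κ hκ hs).1
  -- The equation for the phase, divided by `κ - 1`.
  have hphase : ∀ κ : ℝ, 1 < κ → ∀ w ∈ outerHalfPlane R, obliqueG ν β κ w = 0 ↔
      ∃ n : ℤ, w + ψ κ w = (n * Real.pi / (κ - 1) : ℝ) := fun κ hκ w hw => by
    rw [hzero κ hκ w (outerHalfPlane_anti hRR hw)]
    refine exists_congr fun n => ?_
    have h1 := ofReal_sub_one_ne_zero hκ
    rw [hψ, phaseQuot]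
    push_cast
    rw [eq_div_iff h1, add_mul, div_mul_cancel₀ _ h1, mul_comm w]
  refine ⟨κ₀, R, z, fun j κ => inversionCoeff (quotCoeff (phaseCoeff ν β) κ) j, ?_, by linarith,
    fun κ hκ => ⟨fun s hs => ?_, fun s hs s' hs' hss => ?_, fun w hw => ?_⟩, fun s hs => ?_,
    fun κ hκ => ⟨inversionCoeff_quotCoeff_zero ν β hκ.1, inversionCoeff_quotCoeff_one ν β hκ.1⟩,
    fun N => ?_⟩
  · have : 0 < Real.pi / (R + 2) := by positivity
    linarith
  · have h1 := hzmem κ hκ s hs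
    refine ⟨h1.1, h1.2, (hphase κ hκ.1 _ h1).2 ⟨s, ?_⟩⟩
    rw [(hz s κ hκ hs).2, mcMahonAlpha]
    simp
  · have h1 := (hz s κ hκ hs).2
    have h2 := (hz s' κ hκ hs').2
    have hss' : z s κ = z s' κ := hss
    rw [hss', h2] at h1
    have h3 : mcMahonAlpha s' κ = mcMahonAlpha s κ := by exact_mod_cast h1
    have h4 : κ - 1 ≠ 0 := by linarith [hκ.1]
    rw [mcMahonAlpha, mcMahonAlpha, div_left_inj' h4, mul_left_inj' hpi.ne'] at h3
    exact_mod_cast h3.symm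
  · obtain ⟨hw1, hw2, hw3⟩ := hw
    have hwR : w ∈ outerHalfPlane R := ⟨hw1, hw2⟩
    obtain ⟨n, hn⟩ := (hphase κ hκ.1 w hwR).1 hw3
    have hψw : ‖ψ κ w‖ ≤ 1 / 4 := by
      refine (hψB κ hκ.1 w (outerHalfPlane_anti hRR hwR)).trans ?_
      rw [← div_eq_mul_inv, div_le_iff₀ (norm_pos_of_mem_outerHalfPlane hwR)]
      linarith
    set a : ℝ := n * Real.pi / (κ - 1) with ha
    -- If `n ≤ 0`, then `w` would be within distance `1 / 2` of the origin.
    have hnpos : 0 < n := by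
      by_contra hn0
      have hn0' : (n : ℝ) ≤ 0 := by exact_mod_cast not_lt.1 hn0
      have ha0 : a ≤ 0 := div_nonpos_of_nonpos_of_nonneg
        (mul_nonpos_of_nonpos_of_nonneg hn0' hpi.le) (by linarith [hκ.1])
      have h1 : a = w.re + (ψ κ w).re := by
        have := congrArg Complex.re hn
        rw [Complex.add_re, Complex.ofReal_re] at this
        exact this.symm
      have h2 := (abs_le.1 ((Complex.abs_re_le_norm (ψ κ w)).trans hψw)).1
      have h3 : ‖w‖ ≤ |a| + 1 / 4 := by
        have h4 := norm_sub_le (a : ℂ) (ψ κ w)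
        rw [← hn, add_sub_cancel_right, hn, Complex.norm_real, Real.norm_eq_abs] at h4
        linarith
      rw [abs_of_nonpos ha0] at h3
      linarith
    lift n to ℕ using hnpos.le
    have hs : 1 ≤ n := by exact_mod_cast hnpos
    have ha' : a = mcMahonAlpha n κ := by simp [ha, mcMahonAlpha]
    rw [ha'] at hn
    refine ⟨n, hs, ?_⟩
    refine phase_solution_unique hR₀0 hB0 (hψd κ hκ.1) (hψB κ hκ.1)
      (by linarith [hα κ hκ n hs]) (hz n κ hκ hs).1 ?_ (hz n κ hκ hs).2 hn
    rw [Metric.mem_closedBall, dist_eq_norm, ← hn, sub_add_cancel_left, norm_neg]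
    linarith
  · have h1 : Tendsto (fun κ : ℝ => mcMahonAlpha s κ + (-1)) (𝓝[>] 1) atTop := by
      refine tendsto_atTop_add_const_right _ _ ?_
      have h2 : Tendsto (fun κ : ℝ => κ - 1) (𝓝[>] 1) (𝓝[>] 0) := by
        refine tendsto_nhdsWithin_iff.2 ⟨?_, ?_⟩
        · have : Tendsto (fun κ : ℝ => κ - 1) (𝓝 1) (𝓝 (1 - 1)) := tendsto_id.sub_const 1
          rw [sub_self] at this
          exact this.mono_left nhdsWithin_le_nhds
        · filter_upwards [self_mem_nhdsWithin] with κ hκ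
          exact Set.mem_Ioi.2 (sub_pos.2 (Set.mem_Ioi.1 hκ))
      have h3 : (0 : ℝ) < s * Real.pi := by
        have : (0 : ℝ) < s := by exact_mod_cast hs
        positivity
      refine ((tendsto_inv_nhdsGT_zero.comp h2).const_mul_atTop h3).congr fun κ => ?_
      simp [mcMahonAlpha, div_eq_mul_inv]
    refine tendsto_atTop_mono' _ ?_ h1
    have hκ₀1 : 1 < κ₀ := by
      have : 0 < Real.pi / (R + 2) := by positivity
      linarith
    filter_upwards [Ioo_mem_nhdsGT hκ₀1] with κ hκ
    have h2 := (hz s κ hκ hs).1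
    rw [Metric.mem_closedBall, dist_eq_norm, norm_sub_rev] at h2
    have h3 := norm_sub_norm_le (mcMahonAlpha s κ : ℂ) (z s κ)
    rw [Complex.norm_real] at h3
    have h4 := Real.le_norm_self (mcMahonAlpha s κ)
    linarith
  · obtain ⟨K, hK⟩ := exists_inversion_expansion
      (ι := {i : ℝ × ℕ // i.1 ∈ Set.Ioo 1 κ₀ ∧ 1 ≤ i.2})
      (α := fun i => mcMahonAlpha i.1.2 i.1.1) (z := fun i => z i.1.2 i.1.1)
      (p := fun i => ψ i.1.1 (z i.1.2 i.1.1)) (e := fun i => quotCoeff (phaseCoeff ν β) i.1.1)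
      (fun i => by linarith [hα _ i.2.1 _ i.2.2])
      (fun i => by simpa [dist_eq_norm] using (hz _ _ i.2.1 i.2.2).1)
      (fun i => (hz _ _ i.2.1 i.2.2).2)
      (fun j => ⟨_, fun i => norm_quotCoeff_le _ i.2.1.1 j⟩)
      (fun M => by
        obtain ⟨B', hB0', hB'⟩ := exists_phaseQuot_expansion hθ (hΘ M)
        exact ⟨B', hB0', fun i => hB' _ i.2.1.1 _
          (outerHalfPlane_anti hRR (hzmem _ i.2.1 _ i.2.2))⟩) N
    exact ⟨K, fun κ hκ s hs => hK ⟨(κ, s), hκ, hs⟩⟩
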